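/- Let $L_\omega$ be the language of arithmetic in all finite types (type $0$ for $\mathbb N$, type $1$ for $\mathbb N^{\mathbb N}$, type $2$ for functionals from type $1$ to type $0$, and so on). Let $\mathsf{RCA}_0^\omega$ be Kohlenbach's base theory: classical logic, the axioms for zero and successor, the combinators, and primitive recursion of type $0$, the axiom of extensionality at all types, induction for quantifier-free formulas, and the quantifier-free axiom of choice $\mathsf{QF\text{-}AC}^{1,0}$. Let $\mathsf{ACA}_0^\omega=\mathsf{RCA}_0^\omega+(\exists^2)$, where $(\exists^2)$ is $$(\exists \varphi^2\le_2 1)(\forall f^1)\big[(\exists n)(f(n)=0)\leftrightarrow \varphi(f)=0\big].$$ Let $\mathsf{IND}_0$ be the axiom: if for every $n\in\mathbb N$ there is at most one $f\in 2^{\mathbb N}$ with $Y(f,n)=0$, then for every $k\in\mathbb N$ there is a finite sequence $w$ of elements of $\mathbb N^{\mathbb N}$ such that for all $m\le k$ $$(\exists i<|w|)\big(w(i)\in 2^{\mathbb N}\wedge Y(w(i),m)=0\big)\leftrightarrow(\exists f\in 2^{\mathbb N})(Y(f,m)=0).$$ Within $L_\omega$, real numbers are represented by fast-converging Cauchy sequences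 of (codes of) rationals ($|q_n-q_{n+i}|<2^{-n}$), functions on $[0,1]$ by functionals respecting equality of reals, and sets of reals by characteristic functions respecting equality of reals. A set of reals is Borel if it belongs to every $\sigma$-algebra of sets of reals (given by a characteristic functional, and closed under complements and under unions of sequences) that contains all open intervals. A function $f:[0,1]\to\mathbb R$ is Borel if $\{x\in[0,1]:f(x)>a\}$ is a Borel set for every $a\in\mathbb R$, and it is upper semi-continuous if $f(x_0)\ge\limsup_{x\to x_0}f(x)$ for every $x_0\in[0,1]$. Consider the following statements of $L_\omega$. * $\mathsf{NIN}$: there is no injection from $[0,1]$ to $\mathbb N$. * $\mathsf{HBU}_{\mathsf{semi}}$ (resp. $\mathsf{HBU}_{\mathsf{Borel}}$): for every upper semi-continuous (resp. Borel) function $\Psi:[0,1]\to\mathbb R^+$ there are finitely many $y_0,\dots,y_k\in[0,1]$ such that $[0,1]\subset\bigcup_{i\le k}B(y_i,\Psi(y_i))$, where $B(y,r)$ is the open ball with centre $y$ and radius $r$. **Theorem.** 1. The theory $\mathsf{ACA}_0^\omega+\mathsf{IND}_0$ proves $\mathsf{HBU}_{\mathsf{semi}}\rightarrow\mathsf{NIN}$.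 2. The theory $\mathsf{ACA}_0^\omega$ proves $\mathsf{HBU}_{\mathsf{Borel}}\rightarrow\mathsf{NIN}$. -/

import Mathlib

/-!  Higher-order arithmetic: the language of all finite types, classical many-sorted natural
deduction, the theories `RCA₀^ω` and `ACA₀^ω`, and the formalisation of real numbers, NIN and
(restrictions of) Cousin's lemma in that language.  All principles (including statements about
real numbers, sets of reals and functions) are formulas of the object language. -/

namespace HigherOrder

/-! ### Finite types, terms and formulas -/

/-- Finite types over the natural numbers; `N` is the type `0`. -/
inductive Ty : Type
  | N : Ty
  | arr : Ty → Ty → Ty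

infixr:62 " ⟶ₜ " => Ty.arr

/-- The type `1` of functions from numbers to numbers. -/
abbrev Ty.one : Ty := Ty.N ⟶ₜ Ty.N

/-- The type `2` of functionals from type `1` to type `0`. -/
abbrev Ty.two : Ty := Ty.one ⟶ₜ Ty.N

/-- A typed family of variables `V`, extended by one new variable of type `τ`. -/
inductive Ext (V : Ty → Type) (τ : Ty) : Ty → Type
  | new : Ext V τ τ
  | old {σ : Ty} (v : V σ) : Ext V τ σ

/-- Terms with variables from `V`: zero, successor, the combinators `K` and `S`, and the recursor
`R₀` (for recursion of type `0` only), closed under application. -/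
inductive Tm (V : Ty → Type) : Ty → Type
  | var {τ : Ty} (v : V τ) : Tm V τ
  | zero : Tm V Ty.N
  | succ : Tm V (Ty.N ⟶ₜ Ty.N)
  | K (σ τ : Ty) : Tm V (σ ⟶ₜ τ ⟶ₜ σ)
  | S (ρ σ τ : Ty) : Tm V ((ρ ⟶ₜ σ ⟶ₜ τ) ⟶ₜ (ρ ⟶ₜ σ) ⟶ₜ ρ ⟶ₜ τ)
  | R : Tm V ((Ty.N ⟶ₜ Ty.N ⟶ₜ Ty.N) ⟶ₜ Ty.N ⟶ₜ Ty.N ⟶ₜ Ty.N)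
  | app {σ τ : Ty} (f : Tm V (σ ⟶ₜ τ)) (t : Tm V σ) : Tm V τ

infixl:75 " ⬝ₜ " => Tm.app

/-- Formulas with free variables from `V`.  The only primitive relation is equality of numbers. -/
inductive Fm : (Ty → Type) → Type 1
  | bot {V : Ty → Type} : Fm V
  | eq {V : Ty → Type} (s t : Tm V Ty.N) : Fm V
  | imp {V : Ty → Type} (φ ψ : Fm V) : Fm V
  | all {V : Ty → Type} (τ : Ty) (φ : Fm (Ext V τ)) : Fm V

infix:50 " =ₒ " => Fm.eq
infixr:25 " ⇒ₒ " => Fm.imp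

/-- Simultaneous substitution in terms. -/
def Tm.subst {V W : Ty → Type} (f : (τ : Ty) → V τ → Tm W τ) : {τ : Ty} → Tm V τ → Tm W τ
  | τ, .var v => f τ v
  | _, .zero => .zero
  | _, .succ => .succ
  | _, .K σ τ => .K σ τ
  | _, .S ρ σ τ => .S ρ σ τ
  | _, .R => .R
  | _, .app s t => .app (s.subst f) (t.subst f)

/-- Weakening of a term by one new variable. -/
def Tm.wk {V : Ty → Type} {σ τ : Ty} (t : Tm V τ) : Tm (Ext V σ) τ :=
  t.subst fun _ v => .var (.old v)

postfix:max "⇑" => Tm.wk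

/-- A substitution carried under a quantifier. -/
def liftSubst {V W : Ty → Type} (f : (τ : Ty) → V τ → Tm W τ) (σ : Ty) :
    (τ : Ty) → Ext V σ τ → Tm (Ext W σ) τ
  | _, .new => .var .new
  | τ, .old v => (f τ v)⇑

/-- Simultaneous (capture-free) substitution in formulas. -/
def Fm.subst : {V W : Ty → Type} → ((τ : Ty) → V τ → Tm W τ) → Fm V → Fm W
  | _, _, _, .bot => .bot
  | _, _, f, .eq s t => .eq (s.subst f) (t.subst f)
  | _, _, f, .imp φ ψ => .imp (φ.subst f) (ψ.subst f)
  | _, _, f, .all τ φ => .all τ (φ.subst (liftSubst f τ))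

/-- Weakening of a formula by one new variable. -/
def Fm.wk {V : Ty → Type} {σ : Ty} (φ : Fm V) : Fm (Ext V σ) :=
  φ.subst fun _ v => .var (.old v)

/-- The substitution replacing the newest variable by `t`. -/
def instSubst {V : Ty → Type} {σ : Ty} (t : Tm V σ) : (τ : Ty) → Ext V σ τ → Tm V τ
  | _, .new => t
  | _, .old v => .var v

/-- The instance `φ(t)`. -/
def Fm.inst {V : Ty → Type} {σ : Ty} (φ : Fm (Ext V σ)) (t : Tm V σ) : Fm V :=
  φ.subst (instSubst t)

/-- Quantifier-free formulas. -/
def Fm.QF : {V : Ty → Type} → Fm V → Prop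
  | _, .bot => True
  | _, .eq _ _ => True
  | _, .imp φ ψ => φ.QF ∧ ψ.QF
  | _, .all _ _ => False

/-! Defined connectives.  In `allB τ fun x => φ` and `exB τ fun x => φ`, the argument `x` is the
newly bound variable; terms from outside are used inside after weakening `t⇑`. -/

def Fm.neg {V : Ty → Type} (φ : Fm V) : Fm V := φ ⇒ₒ .bot

def Fm.and {V : Ty → Type} (φ ψ : Fm V) : Fm V := (φ ⇒ₒ ψ.neg).neg

infixr:35 " ∧ₒ " => Fm.and
prefix:40 "¬ₒ " => Fm.neg

def Fm.iff {V : Ty → Type} (φ ψ : Fm V) : Fm V := (φ ⇒ₒ ψ) ∧ₒ (ψ ⇒ₒ φ)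

infix:24 " ⇔ₒ " => Fm.iff

def allB {V : Ty → Type} (τ : Ty) (φ : Tm (Ext V τ) τ → Fm (Ext V τ)) : Fm V :=
  .all τ (φ (.var .new))

def exB {V : Ty → Type} (τ : Ty) (φ : Tm (Ext V τ) τ → Fm (Ext V τ)) : Fm V :=
  ¬ₒ allB τ fun x => ¬ₒ φ x

/-- Equality at all finite types, defined extensionally from equality of numbers. -/
def eqAt : (τ : Ty) → {V : Ty → Type} → Tm V τ → Tm V τ → Fm V
  | .N, _, s, t => s =ₒ t
  | .arr σ τ, _, s, t => allB σ fun x => eqAt τ (s⇑ ⬝ₜ x) (t⇑ ⬝ₜ x)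

/-! ### The calculus -/

/-- A theory: a set of axioms in every context (free variables of an axiom act as parameters). -/
def Theory : Type 1 := (V : Ty → Type) → Set (Fm V)

/-- Classical natural deduction, with equality of numbers, over the axioms of `T`;
`Γ` is the set of open assumptions. -/
inductive Derives (T : Theory) : {V : Ty → Type} → Set (Fm V) → Fm V → Prop
  | ax {V : Ty → Type} {Γ : Set (Fm V)} {φ : Fm V} (h : φ ∈ T V) : Derives T Γ φ
  | hyp {V : Ty → Type} {Γ : Set (Fm V)} {φ : Fm V} (h : φ ∈ Γ) : Derives T Γ φ
  | impI {V : Ty → Type} {Γ : Set (Fm V)} {φ ψ : Fm V}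
      (h : Derives T (insert φ Γ) ψ) : Derives T Γ (φ ⇒ₒ ψ)
  | impE {V : Ty → Type} {Γ : Set (Fm V)} {φ ψ : Fm V}
      (h : Derives T Γ (φ ⇒ₒ ψ)) (h' : Derives T Γ φ) : Derives T Γ ψ
  | raa {V : Ty → Type} {Γ : Set (Fm V)} {φ : Fm V}
      (h : Derives T (insert (¬ₒ φ) Γ) .bot) : Derives T Γ φ
  | allI {V : Ty → Type} {Γ : Set (Fm V)} {τ : Ty} {φ : Fm (Ext V τ)}
      (h : Derives T (Fm.wk '' Γ) φ) : Derives T Γ (.all τ φ)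
  | allE {V : Ty → Type} {Γ : Set (Fm V)} {τ : Ty} {φ : Fm (Ext V τ)}
      (h : Derives T Γ (.all τ φ)) (t : Tm V τ) : Derives T Γ (φ.inst t)
  | eqI {V : Ty → Type} {Γ : Set (Fm V)} (t : Tm V Ty.N) : Derives T Γ (t =ₒ t)
  | eqE {V : Ty → Type} {Γ : Set (Fm V)} {s t : Tm V Ty.N} (φ : Fm (Ext V Ty.N))
      (h : Derives T Γ (s =ₒ t)) (h' : Derives T Γ (φ.inst s)) : Derives T Γ (φ.inst t)

/-- No free variables. -/
abbrev NoVars : Ty → Type := fun _ => Empty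

abbrev Sentence : Type 1 := Fm NoVars

/-- The theory `T` proves the sentence `φ`. -/
def Theory.Proves (T : Theory) (φ : Sentence) : Prop := Derives T ∅ φ

/-- The theory `T` with one more axiom `φ` (a closed formula, given in every context). -/
def Theory.plus (T : Theory) (φ : (V : Ty → Type) → Fm V) : Theory :=
  fun V => insert (φ V) (T V)

/-! ### Numbers -/

section Numbers

variable {V : Ty → Type}

def Tm.S1 (t : Tm V Ty.N) : Tm V Ty.N := Tm.succ ⬝ₜ t

/-- `s + t`, by recursion on `t`. -/
def Tm.add (s t : Tm V Ty.N) : Tm V Ty.N := Tm.R ⬝ₜ (Tm.K _ _ ⬝ₜ Tm.succ) ⬝ₜ s ⬝ₜ t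

infixl:65 " +ₒ " => Tm.add

/-- `s * t`, by recursion on `t`: the step function is `n, u ↦ u + s`. -/
def Tm.mul (s t : Tm V Ty.N) : Tm V Ty.N :=
  Tm.R ⬝ₜ (Tm.K _ _ ⬝ₜ (Tm.S _ _ _ ⬝ₜ (Tm.R ⬝ₜ (Tm.K _ _ ⬝ₜ Tm.succ)) ⬝ₜ (Tm.K _ _ ⬝ₜ s)))
    ⬝ₜ Tm.zero ⬝ₜ t

infixl:70 " *ₒ " => Tm.mul

/-- The identity combinator. -/
def Tm.I (σ : Ty) : Tm V (σ ⟶ₜ σ) := Tm.S σ (σ ⟶ₜ σ) σ ⬝ₜ Tm.K _ _ ⬝ₜ Tm.K _ _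

/-- The numeral `1`. -/
def Tm.n1 : Tm V Ty.N := Tm.zero.S1

/-- The numeral `2`. -/
def Tm.n2 : Tm V Ty.N := Tm.n1.S1

/-- The numeral `4`. -/
def Tm.n4 : Tm V Ty.N := Tm.n2.S1.S1

/-- `2 ^ t`, by recursion on `t`: the step function is `n, u ↦ u + u`. -/
def Tm.pow2 (t : Tm V Ty.N) : Tm V Ty.N :=
  Tm.R ⬝ₜ (Tm.K _ _ ⬝ₜ (Tm.S _ _ _ ⬝ₜ (Tm.R ⬝ₜ (Tm.K _ _ ⬝ₜ Tm.succ)) ⬝ₜ Tm.I _))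
    ⬝ₜ Tm.n1 ⬝ₜ t

def leN (s t : Tm V Ty.N) : Fm V := exB Ty.N fun u => s⇑ +ₒ u =ₒ t⇑

def ltN (s t : Tm V Ty.N) : Fm V := leN s.S1 t

end Numbers

/-! ### The theories -/

/-- In `A(x, y)`, with `x` of type `1` and `y` of type `0` the newest variable, replace `y` by
`Y x`; in the result `Y` of type `2` precedes the newest variable `x`. -/
def choiceSubst (V : Ty → Type) :
    (τ : Ty) → Ext (Ext V Ty.one) Ty.N τ → Tm (Ext (Ext V Ty.two) Ty.one) τ
  | _, .new => Tm.var (.old .new) ⬝ₜ Tm.var .new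
  | _, .old .new => .var .new
  | _, .old (.old v) => .var (.old (.old v))

/-- In `A(n)`, with `n` the newest variable, replace `n` by its successor. -/
def succSubst (V : Ty → Type) : (τ : Ty) → Ext V Ty.N τ → Tm (Ext V Ty.N) τ
  | _, .new => (Tm.var .new).S1
  | _, .old v => .var (.old v)

/-- The axioms of Kohlenbach's base theory `RCA₀^ω`: the defining axioms of successor, the
combinators and the recursor, extensionality, induction for quantifier-free formulas, and the
quantifier-free axiom of choice `QF-AC^{1,0}`. -/
inductive RCAAxiom : {V : Ty → Type} → Fm V → Prop
  | succ_ne {V : Ty → Type} (t : Tm V Ty.N) : RCAAxiom (¬ₒ (t.S1 =ₒ Tm.zero))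
  | succ_inj {V : Ty → Type} (s t : Tm V Ty.N) : RCAAxiom (s.S1 =ₒ t.S1 ⇒ₒ s =ₒ t)
  | comb_K {V : Ty → Type} {σ τ : Ty} (s : Tm V σ) (t : Tm V τ) :
      RCAAxiom (eqAt σ (Tm.K σ τ ⬝ₜ s ⬝ₜ t) s)
  | comb_S {V : Ty → Type} {ρ σ τ : Ty} (r : Tm V (ρ ⟶ₜ σ ⟶ₜ τ)) (s : Tm V (ρ ⟶ₜ σ))
      (t : Tm V ρ) : RCAAxiom (eqAt τ (Tm.S ρ σ τ ⬝ₜ r ⬝ₜ s ⬝ₜ t) (r ⬝ₜ t ⬝ₜ (s ⬝ₜ t)))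
  | rec_zero {V : Ty → Type} (f : Tm V (Ty.N ⟶ₜ Ty.N ⟶ₜ Ty.N)) (m : Tm V Ty.N) :
      RCAAxiom (Tm.R ⬝ₜ f ⬝ₜ m ⬝ₜ Tm.zero =ₒ m)
  | rec_succ {V : Ty → Type} (f : Tm V (Ty.N ⟶ₜ Ty.N ⟶ₜ Ty.N)) (m n : Tm V Ty.N) :
      RCAAxiom (Tm.R ⬝ₜ f ⬝ₜ m ⬝ₜ n.S1 =ₒ f ⬝ₜ n ⬝ₜ (Tm.R ⬝ₜ f ⬝ₜ m ⬝ₜ n))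
  | ext {V : Ty → Type} {σ τ : Ty} (s t : Tm V σ) (f : Tm V (σ ⟶ₜ τ)) :
      RCAAxiom (eqAt σ s t ⇒ₒ eqAt τ (f ⬝ₜ s) (f ⬝ₜ t))
  | qf_ind {V : Ty → Type} (A : Fm (Ext V Ty.N)) (hA : A.QF) :
      RCAAxiom (A.inst Tm.zero ⇒ₒ .all Ty.N (A ⇒ₒ A.subst (succSubst V)) ⇒ₒ .all Ty.N A)
  | qf_ac {V : Ty → Type} (A : Fm (Ext (Ext V Ty.one) Ty.N)) (hA : A.QF) :
      RCAAxiom (.all Ty.one (¬ₒ .all Ty.N (¬ₒ A)) ⇒ₒ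
        ¬ₒ .all Ty.two (¬ₒ .all Ty.one (A.subst (choiceSubst V))))

/-- The theory `RCA₀^ω`. -/
def RCA : Theory := fun _ => {φ | RCAAxiom φ}

/-- The axiom `(∃²)`: there is `E ≤ 1` of type `2` with `(∃ n, f n = 0) ↔ E f = 0` for all `f`. -/
def existsTwo (V : Ty → Type) : Fm V :=
  exB Ty.two fun E =>
    (allB Ty.one fun f => leN (E⇑ ⬝ₜ f) Tm.n1) ∧ₒ
    allB Ty.one fun f => (exB Ty.N fun n => f⇑ ⬝ₜ n =ₒ Tm.zero) ⇔ₒ (E⇑ ⬝ₜ f =ₒ Tm.zero)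

/-- The theory `ACA₀^ω`, i.e. `RCA₀^ω + (∃²)`. -/
def ACA : Theory := RCA.plus existsTwo

/-- `f` is an element of Cantor space. -/
def isBinary {V : Ty → Type} (f : Tm V Ty.one) : Fm V :=
  allB Ty.N fun n => leN (f⇑ ⬝ₜ n) Tm.n1

/-- The axiom `IND₀`.  A finite sequence of elements of type `1` is given by its length `l` and
`w` of type `0 → 1`. -/
def IND (V : Ty → Type) : Fm V :=
  allB (Ty.one ⟶ₜ Ty.N ⟶ₜ Ty.N) fun Y =>
    (allB Ty.N fun n => allB Ty.one fun f => allB Ty.one fun g =>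
      isBinary f⇑ ⇒ₒ isBinary g ⇒ₒ
      Y⇑⇑⇑ ⬝ₜ f⇑ ⬝ₜ n⇑⇑ =ₒ Tm.zero ⇒ₒ Y⇑⇑⇑ ⬝ₜ g ⬝ₜ n⇑⇑ =ₒ Tm.zero ⇒ₒ
      eqAt Ty.one f⇑ g) ⇒ₒ
    allB Ty.N fun k =>
      exB Ty.N fun l => exB (Ty.N ⟶ₜ Ty.one) fun w =>
        allB Ty.N fun m => leN m k⇑⇑⇑ ⇒ₒ
          ((exB Ty.N fun i => ltN i l⇑⇑⇑ ∧ₒ isBinary (w⇑⇑ ⬝ₜ i) ∧ₒ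
              Y⇑⇑⇑⇑⇑ ⬝ₜ (w⇑⇑ ⬝ₜ i) ⬝ₜ m⇑ =ₒ Tm.zero) ⇔ₒ
            exB Ty.one fun f => isBinary f ∧ₒ Y⇑⇑⇑⇑⇑ ⬝ₜ f ⬝ₜ m⇑ =ₒ Tm.zero)

/-! ### Rational and real numbers -/

section Reals

variable {V : Ty → Type}

/-- `c` is the code of the pair `(a, b)`, i.e. `c = (a + b) (a + b + 1) / 2 + b`. -/
def isPair (c a b : Tm V Ty.N) : Fm V :=
  c +ₒ c =ₒ (a +ₒ b) *ₒ (a +ₒ b).S1 +ₒ (b +ₒ b)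

/-- `q` codes the rational number `(a - b) / (d + 1)`; every number codes exactly one triple. -/
def isRat (q a b d : Tm V Ty.N) : Fm V :=
  exB Ty.N fun p => isPair p a⇑ b⇑ ∧ₒ isPair q⇑ p d⇑

/-- A rational number `(pos - neg) / den` given by three terms (with `den` positive). -/
structure Frac (V : Ty → Type) where
  pos : Tm V Ty.N
  neg : Tm V Ty.N
  den : Tm V Ty.N

def Frac.wk {σ : Ty} (q : Frac V) : Frac (Ext V σ) := ⟨q.pos⇑, q.neg⇑, q.den⇑⟩

def Frac.add (q r : Frac V) : Frac V :=
  ⟨q.pos *ₒ r.den +ₒ r.pos *ₒ q.den, q.neg *ₒ r.den +ₒ r.neg *ₒ q.den, q.den *ₒ r.den⟩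

def Frac.lt (q r : Frac V) : Fm V :=
  ltN (q.pos *ₒ r.den +ₒ r.neg *ₒ q.den) (r.pos *ₒ q.den +ₒ q.neg *ₒ r.den)

def Frac.le (q r : Frac V) : Fm V :=
  leN (q.pos *ₒ r.den +ₒ r.neg *ₒ q.den) (r.pos *ₒ q.den +ₒ q.neg *ₒ r.den)

/-- The rational number `c * 2 ^ (-n)`. -/
def Frac.scaled (c n : Tm V Ty.N) : Frac V := ⟨c, Tm.zero, n.pow2⟩

/-- `φ(r)`, where `r` is the rational number coded by `q`. -/
def withRat (q : Tm V Ty.N)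
    (φ : Frac (Ext (Ext (Ext V Ty.N) Ty.N) Ty.N) → Fm (Ext (Ext (Ext V Ty.N) Ty.N) Ty.N)) : Fm V :=
  exB Ty.N fun a => exB Ty.N fun b => exB Ty.N fun d =>
    isRat q⇑⇑⇑ a⇑⇑ b⇑ d ∧ₒ φ ⟨a⇑⇑, b⇑, d.S1⟩

/-- `x` is a real number: `|x(n) - x(n+i)| < 2 ^ (-n)` for all `n, i`. -/
def isReal (x : Tm V Ty.one) : Fm V :=
  allB Ty.N fun n => allB Ty.N fun i =>
    withRat (x⇑⇑ ⬝ₜ n⇑) fun q => withRat (x⇑⇑⇑⇑⇑ ⬝ₜ (n⇑⇑⇑⇑ +ₒ i⇑⇑⇑)) fun r =>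
      Frac.lt q.wk.wk.wk (r.add (.scaled Tm.n1 n⇑⇑⇑⇑⇑⇑⇑)) ∧ₒ
      Frac.lt r (q.wk.wk.wk.add (.scaled Tm.n1 n⇑⇑⇑⇑⇑⇑⇑))

/-- `x =_ℝ y`, i.e. `|x(n) - y(n)| ≤ 2 * 2 ^ (-n)` for all `n`. -/
def eqR (x y : Tm V Ty.one) : Fm V :=
  allB Ty.N fun n =>
    withRat (x⇑ ⬝ₜ n) fun q => withRat (y⇑⇑⇑⇑ ⬝ₜ n⇑⇑⇑) fun r =>
      Frac.le q.wk.wk.wk (r.add (.scaled Tm.n2 n⇑⇑⇑⇑⇑⇑)) ∧ₒ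
      Frac.le r (q.wk.wk.wk.add (.scaled Tm.n2 n⇑⇑⇑⇑⇑⇑))

/-- `x <_ℝ y`, i.e. `x(n) + 2 * 2 ^ (-n) < y(n)` for some `n`. -/
def ltR (x y : Tm V Ty.one) : Fm V :=
  exB Ty.N fun n =>
    withRat (x⇑ ⬝ₜ n) fun q => withRat (y⇑⇑⇑⇑ ⬝ₜ n⇑⇑⇑) fun r =>
      Frac.lt (q.wk.wk.wk.add (.scaled Tm.n2 n⇑⇑⇑⇑⇑⇑)) r

/-- `x <_ℝ y + z`, i.e. `x(n) + 4 * 2 ^ (-n) < y(n) + z(n)` for some `n`. -/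
def ltAddR (x y z : Tm V Ty.one) : Fm V :=
  exB Ty.N fun n =>
    withRat (x⇑ ⬝ₜ n) fun q => withRat (y⇑⇑⇑⇑ ⬝ₜ n⇑⇑⇑) fun r =>
      withRat (z⇑⇑⇑⇑⇑⇑⇑ ⬝ₜ n⇑⇑⇑⇑⇑⇑) fun s =>
        Frac.lt (q.wk.wk.wk.wk.wk.wk.add (.scaled Tm.n4 n⇑⇑⇑⇑⇑⇑⇑⇑⇑)) (r.wk.wk.wk.add s)

/-- `|x - y| <_ℝ z`, i.e. `x` lies in the open ball `B(y, z)`. -/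
def inBall (x y z : Tm V Ty.one) : Fm V := ltAddR x y z ∧ₒ ltAddR y x z

/-- The real number `0` (the number `0` codes the rational `(0 - 0) / 1`). -/
def zeroR : Tm V Ty.one := Tm.K _ _ ⬝ₜ Tm.zero

/-- The real number `1` (the number `1` codes the rational `(1 - 0) / 1`). -/
def oneR : Tm V Ty.one := Tm.K _ _ ⬝ₜ Tm.n1

/-- `x ∈ [0,1]`. -/
def inUnit (x : Tm V Ty.one) : Fm V := isReal x ∧ₒ ¬ₒ ltR x zeroR ∧ₒ ¬ₒ ltR oneR x

/-! ### The principles -/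

/-- NIN: there is no injection from `[0,1]` to the natural numbers. -/
def NIN (V : Ty → Type) : Fm V :=
  ¬ₒ exB Ty.two fun Y =>
    allB Ty.one fun x => allB Ty.one fun y => inUnit x⇑ ⇒ₒ inUnit y ⇒ₒ
      (eqR x⇑ y ⇔ₒ Y⇑⇑ ⬝ₜ x⇑ =ₒ Y⇑⇑ ⬝ₜ y)

/-- `Ψ` is a function from `[0,1]` to the positive reals (it respects `=_ℝ`). -/
def isGauge (Ψ : Tm V (Ty.one ⟶ₜ Ty.one)) : Fm V :=
  (allB Ty.one fun x => inUnit x ⇒ₒ isReal (Ψ⇑ ⬝ₜ x) ∧ₒ ltR zeroR (Ψ⇑ ⬝ₜ x)) ∧ₒ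
  allB Ty.one fun x => allB Ty.one fun y => inUnit x⇑ ⇒ₒ inUnit y ⇒ₒ
    eqR x⇑ y ⇒ₒ eqR (Ψ⇑⇑ ⬝ₜ x⇑) (Ψ⇑⇑ ⬝ₜ y)

/-- Some `y_0, …, y_k ∈ [0,1]` satisfy `[0,1] ⊆ ⋃ i ≤ k, B(y_i, Ψ(y_i))`. -/
def hasFiniteCover (Ψ : Tm V (Ty.one ⟶ₜ Ty.one)) : Fm V :=
  exB Ty.N fun k => exB (Ty.N ⟶ₜ Ty.one) fun y =>
    (allB Ty.N fun i => leN i k⇑⇑ ⇒ₒ inUnit (y⇑ ⬝ₜ i)) ∧ₒ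
    allB Ty.one fun x => inUnit x ⇒ₒ
      exB Ty.N fun i => leN i k⇑⇑⇑ ∧ₒ inBall x⇑ (y⇑⇑ ⬝ₜ i) (Ψ⇑⇑⇑⇑ ⬝ₜ (y⇑⇑ ⬝ₜ i))

/-- `f : [0,1] → ℝ` is upper semi-continuous: for every `x₀ ∈ [0,1]` and `ε > 0` there is `δ > 0`
such that `f(x) < f(x₀) + ε` for all `x ∈ [0,1]` with `|x - x₀| < δ`. -/
def isUSC (f : Tm V (Ty.one ⟶ₜ Ty.one)) : Fm V :=
  allB Ty.one fun x₀ => inUnit x₀ ⇒ₒ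
    allB Ty.one fun ε => isReal ε ⇒ₒ ltR zeroR ε ⇒ₒ
      exB Ty.one fun δ => isReal δ ∧ₒ ltR zeroR δ ∧ₒ
        allB Ty.one fun x => inUnit x ⇒ₒ inBall x x₀⇑⇑⇑ δ⇑ ⇒ₒ
          ltAddR (f⇑⇑⇑⇑ ⬝ₜ x) (f⇑⇑⇑⇑ ⬝ₜ x₀⇑⇑⇑) ε⇑⇑

/-- `A` represents a set of reals: its values on reals are `0` or `1` and it respects `=_ℝ`. -/
def isSet (A : Tm V Ty.two) : Fm V :=
  (allB Ty.one fun x => isReal x ⇒ₒ leN (A⇑ ⬝ₜ x) Tm.n1) ∧ₒ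
  allB Ty.one fun x => allB Ty.one fun y => isReal x⇑ ⇒ₒ isReal y ⇒ₒ
    eqR x⇑ y ⇒ₒ A⇑⇑ ⬝ₜ x⇑ =ₒ A⇑⇑ ⬝ₜ y

/-- `x ∈ A`, for a set `A` given by its characteristic function. -/
def isMem {σ : Ty} (x : Tm V σ) (A : Tm V (σ ⟶ₜ Ty.N)) : Fm V := A ⬝ₜ x =ₒ Tm.n1

/-- `𝒮` is (the characteristic function of) a σ-algebra of sets of reals that contains the open
intervals. -/
def isSigmaAlgebra (𝒮 : Tm V (Ty.two ⟶ₜ Ty.N)) : Fm V :=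
  (allB Ty.two fun A => isSet A ⇒ₒ leN (𝒮⇑ ⬝ₜ A) Tm.n1) ∧ₒ
  (allB Ty.one fun a => allB Ty.one fun b => allB Ty.two fun A =>
    isReal a⇑⇑ ⇒ₒ isReal b⇑ ⇒ₒ isSet A ⇒ₒ
    (allB Ty.one fun x => isReal x ⇒ₒ (isMem x A⇑ ⇔ₒ ltR a⇑⇑⇑ x ∧ₒ ltR x b⇑⇑)) ⇒ₒ
    isMem A 𝒮⇑⇑⇑) ∧ₒ
  (allB Ty.two fun A => allB Ty.two fun B =>
    isSet A⇑ ⇒ₒ isSet B ⇒ₒ isMem A⇑ 𝒮⇑⇑ ⇒ₒ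
    (allB Ty.one fun x => isReal x ⇒ₒ (isMem x B⇑ ⇔ₒ ¬ₒ isMem x A⇑⇑)) ⇒ₒ
    isMem B 𝒮⇑⇑) ∧ₒ
  (allB (Ty.N ⟶ₜ Ty.two) fun A => allB Ty.two fun B =>
    (allB Ty.N fun n => isSet (A⇑⇑ ⬝ₜ n) ∧ₒ isMem (A⇑⇑ ⬝ₜ n) 𝒮⇑⇑⇑) ⇒ₒ isSet B ⇒ₒ
    (allB Ty.one fun x => isReal x ⇒ₒ
      (isMem x B⇑ ⇔ₒ exB Ty.N fun n => isMem x⇑ (A⇑⇑⇑ ⬝ₜ n))) ⇒ₒ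
    isMem B 𝒮⇑⇑)

/-- `B` is a Borel set of reals: it belongs to every σ-algebra containing the open intervals. -/
def isBorelSet (B : Tm V Ty.two) : Fm V :=
  isSet B ∧ₒ allB (Ty.two ⟶ₜ Ty.N) fun 𝒮 => isSigmaAlgebra 𝒮 ⇒ₒ isMem B⇑ 𝒮

/-- `f : [0,1] → ℝ` is a Borel function: for every real `a`, `{x ∈ [0,1] : f(x) > a}` is a Borel
set. -/
def isBorelFun (f : Tm V (Ty.one ⟶ₜ Ty.one)) : Fm V :=
  allB Ty.one fun a => isReal a ⇒ₒ
    exB Ty.two fun B => isBorelSet B ∧ₒ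
      allB Ty.one fun x => isReal x ⇒ₒ
        (isMem x B⇑ ⇔ₒ inUnit x ∧ₒ ltR a⇑⇑ (f⇑⇑⇑ ⬝ₜ x))

/-- Cousin's lemma for upper semi-continuous gauges. -/
def HBUsemi (V : Ty → Type) : Fm V :=
  allB (Ty.one ⟶ₜ Ty.one) fun Ψ => isGauge Ψ ⇒ₒ isUSC Ψ ⇒ₒ hasFiniteCover Ψ

/-- Cousin's lemma for Borel gauges. -/
def HBUBorel (V : Ty → Type) : Fm V :=
  allB (Ty.one ⟶ₜ Ty.one) fun Ψ => isGauge Ψ ⇒ₒ isBorelFun Ψ ⇒ₒ hasFiniteCover Ψ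

end Reals

end HigherOrder

/-!
A theory in this calculus whose axioms are stable under substitution and make all functionals
extensional is complete for extensional structures (Henkin's construction), so it suffices to argue
inside an arbitrary, possibly nonstandard, model of `ACA₀^ω`.

In such a model, let `Y` be an injection of `[0,1]` into the numbers. The gauge
`Ψ(x) = 4^(-(Y(x) + 1))` has no finite cover `B(y_i, Ψ(y_i))`, `i ≤ k`. Indeed, pass repeatedly to
the first or the last quarter of an interval, starting with `[0,1]`. There is at most one `y_i` with
`Y(y_i) = m`, and at stage `m` the choice of the quarter on the other side of the midpoint keeps the
distance `4^(-(m + 1))` from it. After more stages than all the `Y(y_i)`, the left endpoint of the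
interval lies in none of the balls.

It remains to see that `Ψ` has the regularity required by the covering principle. Because of `Y`,
every subset of `[0,1]` is a countable union of sets with at most one element, so that all sets and
functions are Borel. For upper semi-continuity, a real is replaced by the characteristic function of
its lower cut, which is unique as an element of `2^ℕ`. Then `IND₀` lists the finitely many points
with `Y`-value at most `Y(x₀)`, so `Y(x₀)` is the least value of `Y` in a neighbourhood of `x₀`, and
`Ψ(x₀)` is the greatest value of `Ψ` there.
-/

namespace HigherOrder

/-! ### Substitution -/

/-- Simultaneous substitutions of terms over `W` for the variables in `V`. -/
abbrev Subst (V W : Ty → Type) : Type := (τ : Ty) → V τ → Tm W τ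

section Substitution

variable {V W X : Ty → Type}

theorem Tm.subst_subst (f : Subst V W) (g : Subst W X) {τ : Ty} (t : Tm V τ) :
    (t.subst f).subst g = t.subst fun σ v => (f σ v).subst g := by
  induction t with
  | app s t hs ht => simp only [Tm.subst, hs, ht]
  | _ => rfl

theorem Tm.subst_var {τ : Ty} (t : Tm V τ) : t.subst (fun _ v => .var v) = t := by
  induction t with
  | app s t hs ht => simp only [Tm.subst, hs, ht]
  | _ => rfl

theorem Tm.wk_subst {σ τ : Ty} (t : Tm V τ) (f : Subst (Ext V σ) W) :
    t⇑.subst f = t.subst fun ρ v => f ρ (.old v) := by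
  simp only [Tm.wk, Tm.subst_subst, Tm.subst]

theorem Tm.subst_wk {σ τ : Ty} (t : Tm V τ) (f : Subst V W) :
    (t.subst f).wk (σ := σ) = t.subst fun ρ v => (f ρ v)⇑ := by
  simp only [Tm.wk, Tm.subst_subst]

theorem liftSubst_subst (f : Subst V W) (g : Subst W X) (σ : Ty) :
    (fun τ v => (liftSubst f σ τ v).subst (liftSubst g σ)) =
      liftSubst (fun τ v => (f τ v).subst g) σ := by
  funext τ v
  cases v with
  | new => rfl
  | old v => simp only [liftSubst, Tm.wk_subst, Tm.subst_wk]

theorem Fm.subst_subst (φ : Fm V) : ∀ {W X : Ty → Type} (f : Subst V W) (g : Subst W X),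
    (φ.subst f).subst g = φ.subst fun σ v => (f σ v).subst g := by
  induction φ with
  | bot => intros; rfl
  | eq s t => intros; simp only [Fm.subst, Tm.subst_subst]
  | imp φ ψ hφ hψ => intros; simp only [Fm.subst, hφ, hψ]
  | all τ φ h => intros; simp only [Fm.subst, h, liftSubst_subst]

theorem liftSubst_var (σ : Ty) :
    liftSubst (fun (τ : Ty) (v : V τ) => Tm.var v) σ = fun _ v => .var v := by
  funext τ v
  cases v <;> rfl

theorem Fm.subst_var (φ : Fm V) : φ.subst (fun _ v => .var v) = φ := by
  induction φ with
  | bot => rfl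
  | eq s t => simp only [Fm.subst, Tm.subst_var]
  | imp φ ψ hφ hψ => simp only [Fm.subst, hφ, hψ]
  | all τ φ h => simp only [Fm.subst, liftSubst_var, h]

/-- The extension of a substitution by a term for the newest variable. -/
def consSubst {σ : Ty} (f : Subst V W) (t : Tm W σ) : Subst (Ext V σ) W
  | _, .new => t
  | τ, .old v => f τ v

theorem Fm.inst_subst {σ : Ty} (φ : Fm (Ext V σ)) (t : Tm V σ) (f : Subst V W) :
    (φ.inst t).subst f = φ.subst (consSubst f (t.subst f)) := by
  rw [Fm.inst, Fm.subst_subst]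
  congr 1
  funext τ v
  cases v <;> rfl

theorem Fm.subst_liftSubst_inst {σ : Ty} (φ : Fm (Ext V σ)) (f : Subst V W) (t : Tm W σ) :
    (φ.subst (liftSubst f σ)).inst t = φ.subst (consSubst f t) := by
  rw [Fm.inst, Fm.subst_subst]
  congr 1
  funext τ v
  cases v with
  | new => rfl
  | old v => simp only [liftSubst, Tm.wk_subst, instSubst, consSubst, Tm.subst_var]

theorem Fm.inst_subst_eq_subst_inst {σ : Ty} (φ : Fm (Ext V σ)) (t : Tm V σ) (f : Subst V W) :
    (φ.inst t).subst f = (φ.subst (liftSubst f σ)).inst (t.subst f) := by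
  rw [Fm.inst_subst, Fm.subst_liftSubst_inst]

theorem Fm.wk_subst_liftSubst {σ : Ty} (φ : Fm V) (f : Subst V W) :
    (φ.wk (σ := σ)).subst (liftSubst f σ) = (φ.subst f).wk := by
  simp only [Fm.wk, Fm.subst_subst, Tm.subst, liftSubst]
  rfl

theorem eqAt_subst : ∀ (τ : Ty) {V W : Ty → Type} (s t : Tm V τ) (f : Subst V W),
    (eqAt τ s t).subst f = eqAt τ (s.subst f) (t.subst f)
  | .N, _, _, _, _, _ => rfl
  | .arr σ τ, _, _, s, t, f => by
    simp only [eqAt, allB, Fm.subst, eqAt_subst τ, Tm.subst, Tm.wk_subst, Tm.subst_wk, liftSubst]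

end Substitution

section FreeVariables

variable {V W : Ty → Type}

/-- The set of variables of a term. -/
def Tm.occ : {τ : Ty} → Tm V τ → Set (Σ τ, V τ)
  | τ, .var v => {⟨τ, v⟩}
  | _, .app s t => s.occ ∪ t.occ
  | _, _ => ∅

/-- The set of free variables of a formula. -/
def Fm.occ : {V : Ty → Type} → Fm V → Set (Σ τ, V τ)
  | _, .bot => ∅
  | _, .eq s t => s.occ ∪ t.occ
  | _, .imp φ ψ => φ.occ ∪ ψ.occ
  | _, .all _ φ => {v | ⟨v.1, .old v.2⟩ ∈ φ.occ}

theorem Tm.occ_finite {τ : Ty} (t : Tm V τ) : t.occ.Finite := by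
  induction t with
  | var v => exact Set.finite_singleton _
  | app s t hs ht => exact hs.union ht
  | _ => exact Set.finite_empty

theorem Ext.old_injective {τ : Ty} :
    Function.Injective fun v : Σ σ, V σ => (⟨v.1, .old v.2⟩ : Σ σ, Ext V τ σ) := by
  rintro ⟨_, _⟩ ⟨_, _⟩ h
  cases h
  rfl

theorem Fm.occ_finite (φ : Fm V) : φ.occ.Finite := by
  induction φ with
  | bot => exact Set.finite_empty
  | eq s t => exact s.occ_finite.union t.occ_finite
  | imp φ ψ hφ hψ => exact hφ.union hψ
  | all τ φ h => exact h.preimage Ext.old_injective.injOn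

theorem Tm.subst_congr {f g : Subst V W} {τ : Ty} (t : Tm V τ)
    (h : ∀ v ∈ t.occ, f v.1 v.2 = g v.1 v.2) : t.subst f = t.subst g := by
  induction t with
  | var v => exact h ⟨_, v⟩ rfl
  | app s t hs ht =>
    simp only [Tm.subst]
    rw [hs fun v hv => h v (.inl hv), ht fun v hv => h v (.inr hv)]
  | _ => rfl

theorem Fm.subst_congr (φ : Fm V) : ∀ {W : Ty → Type} {f g : Subst V W},
    (∀ v ∈ φ.occ, f v.1 v.2 = g v.1 v.2) → φ.subst f = φ.subst g := by
  induction φ with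
  | bot => intros; rfl
  | eq s t =>
    intro W f g h
    simp only [Fm.subst]
    rw [s.subst_congr fun v hv => h v (.inl hv), t.subst_congr fun v hv => h v (.inr hv)]
  | imp φ ψ hφ hψ =>
    intro W f g h
    simp only [Fm.subst]
    rw [hφ fun v hv => h v (.inl hv), hψ fun v hv => h v (.inr hv)]
  | all τ φ ih =>
    intro W f g h
    simp only [Fm.subst]
    rw [ih]
    rintro ⟨σ, v⟩ hv
    cases v with
    | new => rfl
    | old v => exact congrArg Tm.wk (h ⟨σ, v⟩ hv)

end FreeVariables

/-! ### Completeness -/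

/-- A theory is closed if substitution maps axioms to axioms; this makes derivability stable under
substitution, in particular under renaming of parameters. -/
def Theory.Closed (T : Theory) : Prop :=
  ∀ {V W : Ty → Type} (f : Subst V W) (φ : Fm V), φ ∈ T V → φ.subst f ∈ T W

theorem Derives.mono {T : Theory} {V : Ty → Type} {Γ : Set (Fm V)} {φ : Fm V}
    (h : Derives T Γ φ) : ∀ {Δ : Set (Fm V)}, Γ ⊆ Δ → Derives T Δ φ := by
  induction h with
  | ax h => exact fun _ => .ax h
  | hyp h => exact fun hs => .hyp (hs h)
  | impI _ ih => exact fun hs => .impI (ih (Set.insert_subset_insert hs))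
  | impE _ _ ih ih' => exact fun hs => .impE (ih hs) (ih' hs)
  | raa _ ih => exact fun hs => .raa (ih (Set.insert_subset_insert hs))
  | allI _ ih => exact fun hs => .allI (ih (Set.image_mono hs))
  | allE _ t ih => exact fun hs => .allE (ih hs) t
  | eqI t => exact fun _ => .eqI t
  | eqE φ _ _ ih ih' => exact fun hs => .eqE φ (ih hs) (ih' hs)

theorem Derives.subst {T : Theory} (hT : T.Closed) {V : Ty → Type} {Γ : Set (Fm V)} {φ : Fm V}
    (h : Derives T Γ φ) : ∀ {W : Ty → Type} (f : Subst V W),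
      Derives T (Fm.subst f '' Γ) (φ.subst f) := by
  induction h with
  | ax h => exact fun f => .ax (hT f _ h)
  | hyp h => exact fun f => .hyp (Set.mem_image_of_mem _ h)
  | impI _ ih => exact fun f => .impI (by simpa only [Set.image_insert_eq] using ih f)
  | impE _ _ ih ih' => exact fun f => .impE (ih f) (ih' f)
  | raa _ ih =>
    intro W f
    have := ih f
    rw [Set.image_insert_eq] at this
    exact .raa this
  | allI _ ih =>
    intro W f
    refine .allI ?_
    convert ih (liftSubst f _) using 1
    simp only [Set.image_image, Fm.wk_subst_liftSubst]
  | allE _ t ih =>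
    intro W f
    rw [Fm.inst_subst_eq_subst_inst]
    exact .allE (ih f) _
  | eqI t => exact fun f => .eqI _
  | eqE φ _ _ ih ih' =>
    intro W f
    rw [Fm.inst_subst_eq_subst_inst]
    refine .eqE _ (ih f) ?_
    rw [← Fm.inst_subst_eq_subst_inst]
    exact ih' f

theorem Derives.imp_of_neg {T : Theory} {V : Ty → Type} {Γ : Set (Fm V)} {φ ψ : Fm V}
    (h : Derives T Γ (¬ₒ φ)) : Derives T Γ (φ ⇒ₒ ψ) := by
  have hsub : Γ ⊆ insert (¬ₒ ψ) (insert φ Γ) :=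
    (Set.subset_insert _ _).trans (Set.subset_insert _ _)
  exact .impI (.raa (.impE (h.mono hsub) (.hyp (.inr (.inl rfl)))))

/-- A numbering of the types, witnessing that there are countably many. -/
def Ty.enc : Ty → ℕ
  | .N => 0
  | .arr σ τ => Nat.pair σ.enc τ.enc + 1

theorem Ty.enc_inj {σ : Ty} : ∀ {τ : Ty}, σ.enc = τ.enc → σ = τ := by
  induction σ with
  | _ => rintro ⟨⟩ <;> grind [Ty.enc, Nat.pair_eq_pair]

/-- The numbering of terms induced by a numbering `e` of their variables. -/
def Tm.enc {V : Ty → Type} (e : (Σ τ, V τ) → ℕ) : {τ : Ty} → Tm V τ → ℕ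
  | τ, .var v => Nat.pair 0 (e ⟨τ, v⟩)
  | _, .zero => Nat.pair 1 0
  | _, .succ => Nat.pair 2 0
  | _, .K σ τ => Nat.pair 3 (Nat.pair σ.enc τ.enc)
  | _, .S ρ σ τ => Nat.pair 4 (Nat.pair ρ.enc (Nat.pair σ.enc τ.enc))
  | _, .R => Nat.pair 5 0
  | _, .app s t => Nat.pair 6 (Nat.pair (s.enc e) (t.enc e))

theorem Tm.enc_inj {V : Ty → Type} {e : (Σ τ, V τ) → ℕ} (he : e.Injective) {σ : Ty}
    (s : Tm V σ) : ∀ {τ : Ty} (t : Tm V τ), s.enc e = t.enc e → σ = τ ∧ s ≍ t := by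
  induction s with
  | _ => intro τ t; cases t <;> grind [Tm.enc, Nat.pair_eq_pair, Ty.enc_inj, Function.Injective]

/-- A numbering of variables, extended to one new variable. -/
def extEnc {V : Ty → Type} (e : (Σ τ, V τ) → ℕ) (σ : Ty) : (Σ τ, Ext V σ τ) → ℕ
  | ⟨_, .new⟩ => 0
  | ⟨τ, .old v⟩ => e ⟨τ, v⟩ + 1

theorem extEnc_injective {V : Ty → Type} {e : (Σ τ, V τ) → ℕ} (he : e.Injective) (σ : Ty) :
    (extEnc e σ).Injective := by
  rintro ⟨_, _ | v⟩ ⟨_, _ | w⟩ h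
  · rfl
  · cases h
  · cases h
  · cases he (Nat.succ_injective h)
    rfl

/-- The numbering of formulas induced by a numbering of their variables. -/
def Fm.enc : {V : Ty → Type} → Fm V → ((Σ τ, V τ) → ℕ) → ℕ
  | _, .bot, _ => Nat.pair 0 0
  | _, .eq s t, e => Nat.pair 1 (Nat.pair (s.enc e) (t.enc e))
  | _, .imp φ ψ, e => Nat.pair 2 (Nat.pair (φ.enc e) (ψ.enc e))
  | _, .all τ φ, e => Nat.pair 3 (Nat.pair τ.enc (φ.enc (extEnc e τ)))

theorem Fm.enc_inj {V : Ty → Type} (φ : Fm V) : ∀ {e : (Σ τ, V τ) → ℕ}, e.Injective →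
    ∀ ψ : Fm V, φ.enc e = ψ.enc e → φ = ψ := by
  induction φ with
  | _ =>
    intro e he ψ
    cases ψ <;> grind [Fm.enc, Nat.pair_eq_pair, Ty.enc_inj, Tm.enc_inj, extEnc_injective]

/-- Countably many variables of each type. -/
abbrev NatVars : Ty → Type := fun _ => ℕ

instance : Countable (Fm NatVars) := by
  let e : (Σ τ, NatVars τ) → ℕ := fun v => Nat.pair v.1.enc v.2
  have he : e.Injective := by
    rintro ⟨_, v⟩ ⟨_, w⟩ h
    obtain ⟨hσ, rfl : v = w⟩ := Nat.pair_eq_pair.1 h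
    cases Ty.enc_inj hσ
    rfl
  exact Function.Injective.countable (f := fun φ : Fm NatVars => φ.enc e)
    fun φ ψ h => φ.enc_inj he ψ h

section Henkin

variable {T : Theory}

/-- The formulas in `Γ` are consistent with `T`, their free variables acting as constants. -/
def Theory.Consistent (T : Theory) {V : Ty → Type} (Γ : Set (Fm V)) : Prop :=
  ¬ Derives T Γ .bot

theorem Theory.Consistent.insert_or_insert_neg {V : Ty → Type} {Γ : Set (Fm V)}
    (h : T.Consistent Γ) (θ : Fm V) :
    T.Consistent (insert θ Γ) ∨ T.Consistent (insert (¬ₒ θ) Γ) := by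
  by_contra! hθ
  simp only [Consistent, not_not] at hθ
  exact h (.impE (.impI hθ.1) (.raa hθ.2))

/-- The renaming that makes the variable `k` of type `τ` the newest variable. -/
noncomputable def freshSubst (τ : Ty) (k : ℕ) : Subst NatVars (Ext NatVars τ) :=
  fun σ v => open Classical in
    if h : σ = τ ∧ v = k then h.1 ▸ .var .new else .var (.old v)

theorem freshSubst_self (τ : Ty) (k : ℕ) : freshSubst τ k τ k = .var .new := by
  simp [freshSubst]

theorem freshSubst_of_ne {τ : Ty} {k : ℕ} {v : Σ σ, NatVars σ} (h : v ≠ ⟨τ, k⟩) :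
    freshSubst τ k v.1 v.2 = .var (.old v.2) := by
  rw [freshSubst, dif_neg]
  rintro ⟨hτ, hk⟩
  obtain ⟨σ, v⟩ := v
  cases hτ
  cases hk
  exact h rfl

theorem Fm.subst_freshSubst {τ : Ty} {k : ℕ} (φ : Fm NatVars)
    (h : (⟨τ, k⟩ : Σ σ, NatVars σ) ∉ φ.occ) : φ.subst (freshSubst τ k) = φ.wk :=
  φ.subst_congr fun _ hv => freshSubst_of_ne fun e => h (e ▸ hv)

theorem Fm.inst_subst_freshSubst {τ : Ty} {k : ℕ} (χ : Fm (Ext NatVars τ))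
    (h : (⟨τ, k⟩ : Σ σ, NatVars σ) ∉ (Fm.all τ χ).occ) :
    (χ.inst (.var k)).subst (freshSubst τ k) = χ := by
  rw [Fm.inst_subst]
  conv_rhs => rw [← χ.subst_var]
  refine χ.subst_congr ?_
  rintro ⟨σ, v⟩ hv
  cases v with
  | new => exact freshSubst_self τ k
  | old w => exact freshSubst_of_ne (v := ⟨σ, w⟩) fun e => h (e ▸ hv)

theorem Derives.all_of_fresh (hT : T.Closed) {Γ : Set (Fm NatVars)} {τ : Ty} {k : ℕ}
    {χ : Fm (Ext NatVars τ)} (hΓ : ∀ ψ ∈ Γ, (⟨τ, k⟩ : Σ σ, NatVars σ) ∉ ψ.occ)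
    (hχ : (⟨τ, k⟩ : Σ σ, NatVars σ) ∉ (Fm.all τ χ).occ) (h : Derives T Γ (χ.inst (.var k))) :
    Derives T Γ (.all τ χ) := by
  have hsubst := h.subst hT (freshSubst τ k)
  rw [Fm.inst_subst_freshSubst χ hχ,
    Set.image_congr fun ψ hψ => ψ.subst_freshSubst (hΓ ψ hψ)] at hsubst
  exact .allI hsubst

/-- The conditions of Henkin's construction: consistent sets of formulas in which only finitely
many variables occur, so that fresh variables remain available as witnesses. -/
abbrev Theory.Condition (T : Theory) : Type 1 :=
  {Γ : Set (Fm NatVars) // T.Consistent Γ ∧ (⋃ ψ ∈ Γ, ψ.occ).Finite}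

/-- The condition `Γ` with one more formula. -/
def Theory.Condition.insert (Γ : T.Condition) (φ : Fm NatVars)
    (hφ : T.Consistent (insert φ Γ.1)) : T.Condition :=
  ⟨Insert.insert φ Γ.1, hφ, by
    rw [Set.biUnion_insert]
    exact φ.occ_finite.union Γ.2.2⟩

theorem Theory.Condition.exists_fresh (Γ : T.Condition) (τ : Ty) :
    ∃ k : ℕ, ∀ ψ ∈ Γ.1, (⟨τ, k⟩ : Σ σ, NatVars σ) ∉ ψ.occ := by
  have hinj : Function.Injective fun k : ℕ => (⟨τ, k⟩ : Σ σ, NatVars σ) :=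
    fun a b h => by cases h; rfl
  obtain ⟨k, hk⟩ := (Γ.2.2.preimage hinj.injOn).exists_notMem
  exact ⟨k, fun ψ hψ hmem => hk (Set.mem_biUnion hψ hmem)⟩

/-- `Γ` decides `θ`, with a witness if `θ` is a refuted universal statement. -/
def Decides (Γ : Set (Fm NatVars)) (θ : Fm NatVars) : Prop :=
  θ ∈ Γ ∨ ((¬ₒ θ) ∈ Γ ∧ ∀ τ χ, θ = .all τ χ → ∃ t, (¬ₒ χ.inst t) ∈ Γ)

theorem Theory.Condition.exists_decides (hT : T.Closed) (Γ : T.Condition) (θ : Fm NatVars) :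
    ∃ Δ : T.Condition, Γ ≤ Δ ∧ Decides Δ.1 θ := by
  obtain hθ | hθ := Γ.2.1.insert_or_insert_neg θ
  · exact ⟨Γ.insert θ hθ, Set.subset_insert _ _, .inl (Set.mem_insert _ _)⟩
  let Δ := Γ.insert (¬ₒ θ) hθ
  have hΓΔ : Γ ≤ Δ := Set.subset_insert _ _
  have hnot : (¬ₒ θ) ∈ Δ.1 := Set.mem_insert _ _
  cases θ with
  | all τ χ =>
    obtain ⟨k, hk⟩ := Δ.exists_fresh τ
    have hwit : T.Consistent (Insert.insert (¬ₒ χ.inst (.var k)) Δ.1) := fun hbot =>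
      Δ.2.1 (.impE (.hyp hnot)
        (.all_of_fresh hT hk (fun hmem => hk _ hnot (.inl hmem)) (.raa hbot)))
    refine ⟨Δ.insert _ hwit, hΓΔ.trans (Set.subset_insert _ _), .inr ⟨.inr hnot, ?_⟩⟩
    rintro _ _ ⟨⟩
    exact ⟨_, .inl rfl⟩
  | _ => exact ⟨Δ, hΓΔ, .inr ⟨hnot, fun _ _ e => by cases e⟩⟩

/-- A set of formulas with the closure properties of the set of all formulas that hold in a model
of `T` whose elements are all named by terms. -/
structure IsTruthSet (T : Theory) (H : Set (Fm NatVars)) : Prop where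
  ax_mem : ∀ φ ∈ T NatVars, φ ∈ H
  bot_notMem : Fm.bot ∉ H
  imp_mem_iff : ∀ φ ψ, (φ ⇒ₒ ψ) ∈ H ↔ (φ ∈ H → ψ ∈ H)
  all_mem_iff : ∀ τ φ, Fm.all τ φ ∈ H ↔ ∀ t, φ.inst t ∈ H
  refl_mem : ∀ t, (t =ₒ t) ∈ H
  inst_mem : ∀ s t (φ : Fm (Ext NatVars Ty.N)), (s =ₒ t) ∈ H → φ.inst s ∈ H → φ.inst t ∈ H

/-- The formulas derivable from a member of `𝒢`. -/
def Theory.consequences (T : Theory) (𝒢 : Set (Set (Fm NatVars))) : Set (Fm NatVars) :=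
  {φ | ∃ Γ ∈ 𝒢, Derives T Γ φ}

theorem Theory.exists_derives_of_directedOn {𝒢 : Set (Set (Fm NatVars))}
    (hdir : DirectedOn (· ⊆ ·) 𝒢) {φ ψ : Fm NatVars} (hφ : φ ∈ T.consequences 𝒢)
    (hψ : ψ ∈ T.consequences 𝒢) : ∃ Γ ∈ 𝒢, Derives T Γ φ ∧ Derives T Γ ψ := by
  obtain ⟨Γ, hΓ, hφ⟩ := hφ
  obtain ⟨Δ, hΔ, hψ⟩ := hψ
  obtain ⟨Ξ, hΞ, hΓΞ, hΔΞ⟩ := hdir Γ hΓ Δ hΔ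
  exact ⟨Ξ, hΞ, hφ.mono hΓΞ, hψ.mono hΔΞ⟩

theorem Theory.isTruthSet_consequences {𝒢 : Set (Set (Fm NatVars))} (hdir : DirectedOn (· ⊆ ·) 𝒢)
    (hcon : ∀ Γ ∈ 𝒢, T.Consistent Γ) (hdec : ∀ θ, ∃ Γ ∈ 𝒢, Decides Γ θ) :
    IsTruthSet T (T.consequences 𝒢) := by
  obtain ⟨Γ₀, hΓ₀, -⟩ := hdec .bot
  have hneg {φ : Fm NatVars} (hφ : φ ∉ T.consequences 𝒢) : (¬ₒ φ) ∈ T.consequences 𝒢 := by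
    obtain ⟨Γ, hΓ, h | h⟩ := hdec φ
    · exact absurd ⟨Γ, hΓ, .hyp h⟩ hφ
    · exact ⟨Γ, hΓ, .hyp h.1⟩
  refine ⟨fun φ hφ => ⟨Γ₀, hΓ₀, .ax hφ⟩, fun ⟨Γ, hΓ, h⟩ => hcon Γ hΓ h, ?_, ?_,
    fun t => ⟨Γ₀, hΓ₀, .eqI t⟩, ?_⟩
  · refine fun φ ψ => ⟨fun himp hφ => ?_, fun h => ?_⟩
    · obtain ⟨Γ, hΓ, himp, hφ⟩ := exists_derives_of_directedOn hdir himp hφ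
      exact ⟨Γ, hΓ, .impE himp hφ⟩
    · by_cases hφ : φ ∈ T.consequences 𝒢
      · obtain ⟨Γ, hΓ, hψ⟩ := h hφ
        exact ⟨Γ, hΓ, .impI (hψ.mono (Set.subset_insert _ _))⟩
      · obtain ⟨Γ, hΓ, hφ⟩ := hneg hφ
        exact ⟨Γ, hΓ, hφ.imp_of_neg⟩
  · refine fun τ φ => ⟨fun ⟨Γ, hΓ, h⟩ t => ⟨Γ, hΓ, .allE h t⟩, fun h => ?_⟩
    obtain ⟨Γ, hΓ, hall | ⟨-, hwit⟩⟩ := hdec (.all τ φ)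
    · exact ⟨Γ, hΓ, .hyp hall⟩
    · obtain ⟨t, ht⟩ := hwit _ _ rfl
      obtain ⟨Δ, hΔ, hpos, hneg⟩ := exists_derives_of_directedOn hdir (h t) ⟨Γ, hΓ, .hyp ht⟩
      exact absurd (.impE hneg hpos) (hcon Δ hΔ)
  · intro s t φ heq hs
    obtain ⟨Γ, hΓ, heq, hs⟩ := exists_derives_of_directedOn hdir heq hs
    exact ⟨Γ, hΓ, .eqE φ heq hs⟩

/- By the Rasiowa–Sikorski lemma, some ideal of conditions below `Γ` decides each of the countably
many formulas. -/
theorem Theory.Condition.exists_isTruthSet (hT : T.Closed) (Γ : T.Condition) :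
    ∃ H, IsTruthSet T H ∧ Γ.1 ⊆ H := by
  let := Encodable.ofCountable (Fm NatVars)
  let deciding (θ : Fm NatVars) : Order.Cofinal T.Condition :=
    ⟨{Δ | Decides Δ.1 θ}, fun Δ => by
      obtain ⟨Ξ, hΔΞ, hΞ⟩ := Δ.exists_decides hT θ
      exact ⟨Ξ, hΞ, hΔΞ⟩⟩
  let I := Order.idealOfCofinals Γ deciding
  have hΓ : Γ ∈ I := Order.mem_idealOfCofinals Γ deciding
  refine ⟨T.consequences (Subtype.val '' (I : Set T.Condition)),
    T.isTruthSet_consequences ?_ ?_ fun θ => ?_, fun φ hφ => ⟨_, ⟨Γ, hΓ, rfl⟩, .hyp hφ⟩⟩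
  · exact directedOn_image.2 I.directed
  · rintro _ ⟨Δ, -, rfl⟩
    exact Δ.2.1
  · obtain ⟨Δ, hΔθ, hΔI⟩ := Order.cofinal_meets_idealOfCofinals Γ deciding θ
    exact ⟨_, ⟨Δ, hΔI, rfl⟩, hΔθ⟩

end Henkin

/-- An extensional structure for the language of all finite types. -/
structure Struct where
  C : Ty → Type
  app : {σ τ : Ty} → C (σ ⟶ₜ τ) → C σ → C τ
  zero : C Ty.N
  succ : C (Ty.N ⟶ₜ Ty.N)
  K : (σ τ : Ty) → C (σ ⟶ₜ τ ⟶ₜ σ)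
  S : (ρ σ τ : Ty) → C ((ρ ⟶ₜ σ ⟶ₜ τ) ⟶ₜ (ρ ⟶ₜ σ) ⟶ₜ ρ ⟶ₜ τ)
  R : C ((Ty.N ⟶ₜ Ty.N ⟶ₜ Ty.N) ⟶ₜ Ty.N ⟶ₜ Ty.N ⟶ₜ Ty.N)
  ext : ∀ {σ τ : Ty} {f g : C (σ ⟶ₜ τ)}, (∀ x, app f x = app g x) → f = g

/-- Assignments of elements of `𝓜` to the variables in `V`. -/
abbrev Struct.Assign (𝓜 : Struct) (V : Ty → Type) : Type := (τ : Ty) → V τ → 𝓜.C τ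

/-- The extension of an assignment by a value for the newest variable. -/
def Struct.cons {𝓜 : Struct} {V : Ty → Type} {σ : Ty} (ρ : 𝓜.Assign V) (a : 𝓜.C σ) :
    𝓜.Assign (Ext V σ)
  | _, .new => a
  | τ, .old v => ρ τ v

/-- The value of a term under an assignment. -/
def Tm.eval {𝓜 : Struct} {V : Ty → Type} (ρ : 𝓜.Assign V) : {τ : Ty} → Tm V τ → 𝓜.C τ
  | τ, .var v => ρ τ v
  | _, .zero => 𝓜.zero
  | _, .succ => 𝓜.succ
  | _, .K σ τ => 𝓜.K σ τ
  | _, .S ρ σ τ => 𝓜.S ρ σ τ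
  | _, .R => 𝓜.R
  | _, .app s t => 𝓜.app (s.eval ρ) (t.eval ρ)

/-- Tarski's truth of a formula under an assignment. -/
def Fm.Sat {𝓜 : Struct} : {V : Ty → Type} → Fm V → 𝓜.Assign V → Prop
  | _, .bot, _ => False
  | _, .eq s t, ρ => s.eval ρ = t.eval ρ
  | _, .imp φ ψ, ρ => φ.Sat ρ → ψ.Sat ρ
  | _, .all _ φ, ρ => ∀ a, φ.Sat (Struct.cons ρ a)

/-- `𝓜` satisfies every axiom of `T` under every assignment. -/
def Struct.Models (𝓜 : Struct) (T : Theory) : Prop :=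
  ∀ ⦃V : Ty → Type⦄ (φ : Fm V), φ ∈ T V → ∀ ρ : 𝓜.Assign V, φ.Sat ρ

/-- The axioms of `T` contain the extensionality axioms. -/
def Theory.Extensional (T : Theory) : Prop :=
  ∀ {σ τ : Ty} (s t : Tm NatVars σ) (f : Tm NatVars (σ ⟶ₜ τ)),
    (eqAt σ s t ⇒ₒ eqAt τ (f ⬝ₜ s) (f ⬝ₜ t)) ∈ T NatVars

namespace IsTruthSet

variable {T : Theory} {H : Set (Fm NatVars)}

theorem eqAt_arr_mem_iff (hH : IsTruthSet T H) {σ τ : Ty} (s t : Tm NatVars (σ ⟶ₜ τ)) :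
    eqAt (σ ⟶ₜ τ) s t ∈ H ↔ ∀ x, eqAt τ (s ⬝ₜ x) (t ⬝ₜ x) ∈ H := by
  rw [eqAt, allB, hH.all_mem_iff]
  refine forall_congr' fun x => ?_
  rw [Fm.inst, eqAt_subst]
  simp only [Tm.subst, Tm.wk_subst, instSubst, Tm.subst_var]

theorem eq_symm (hH : IsTruthSet T H) {s t : Tm NatVars Ty.N} (h : (s =ₒ t) ∈ H) :
    (t =ₒ s) ∈ H := by
  have := hH.inst_mem s t (.var .new =ₒ s⇑) h
  simp only [Fm.inst, Fm.subst, Tm.subst, instSubst, Tm.wk_subst, Tm.subst_var] at this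
  exact this (hH.refl_mem s)

theorem eq_trans (hH : IsTruthSet T H) {s t u : Tm NatVars Ty.N} (hst : (s =ₒ t) ∈ H)
    (htu : (t =ₒ u) ∈ H) : (s =ₒ u) ∈ H := by
  have := hH.inst_mem t u (s⇑ =ₒ .var .new) htu
  simp only [Fm.inst, Fm.subst, Tm.subst, instSubst, Tm.wk_subst, Tm.subst_var] at this
  exact this hst

theorem eqAt_equivalence (hH : IsTruthSet T H) : ∀ τ : Ty,
    Equivalence fun s t : Tm NatVars τ => eqAt τ s t ∈ H
  | .N => ⟨hH.refl_mem, hH.eq_symm, hH.eq_trans⟩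
  | .arr σ τ => by
    have ih := hH.eqAt_equivalence τ
    simp only [hH.eqAt_arr_mem_iff]
    exact ⟨fun _ _ => ih.refl _, fun h x => ih.symm (h x), fun h h' x => ih.trans (h x) (h' x)⟩

/-- The equivalence of terms whose equality belongs to `H`. -/
def setoid (hH : IsTruthSet T H) (τ : Ty) : Setoid (Tm NatVars τ) := ⟨_, hH.eqAt_equivalence τ⟩

/-- The term model of `H`: terms modulo equality according to `H`. -/
def termModel (hH : IsTruthSet T H) (hE : T.Extensional) : Struct where
  C τ := Quotient (hH.setoid τ)
  app {σ τ} := Quotient.map₂ (sa := hH.setoid _) (sb := hH.setoid _) (sc := hH.setoid _) Tm.app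
    fun f g hfg s t hst => (hH.eqAt_equivalence τ).trans ((hH.eqAt_arr_mem_iff f g).1 hfg s)
      ((hH.imp_mem_iff _ _).1 (hH.ax_mem _ (hE s t g)) hst)
  zero := Quotient.mk _ .zero
  succ := Quotient.mk _ .succ
  K σ τ := Quotient.mk _ (.K σ τ)
  S ρ σ τ := Quotient.mk _ (.S ρ σ τ)
  R := Quotient.mk _ .R
  ext {σ τ f g} := by
    induction f using Quotient.inductionOn
    induction g using Quotient.inductionOn
    intro h
    refine Quotient.sound ((hH.eqAt_arr_mem_iff _ _).2 fun x => ?_)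
    exact Quotient.exact (h (Quotient.mk _ x))

/-- The assignment of classes of terms to variables that corresponds to a substitution. -/
def assign (hH : IsTruthSet T H) (hE : T.Extensional) {V : Ty → Type} (f : Subst V NatVars) :
    (hH.termModel hE).Assign V :=
  fun τ v => Quotient.mk (hH.setoid τ) (f τ v)

theorem assign_surjective (hH : IsTruthSet T H) (hE : T.Extensional) {V : Ty → Type} :
    Function.Surjective (hH.assign hE (V := V)) := by
  intro ρ
  choose f hf using fun τ v => Quotient.exists_rep (s := hH.setoid τ) (ρ τ v)
  exact ⟨f, funext₂ hf⟩

theorem cons_assign (hH : IsTruthSet T H) (hE : T.Extensional) {V : Ty → Type} {τ : Ty}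
    (f : Subst V NatVars) (t : Tm NatVars τ) :
    Struct.cons (hH.assign hE f) (Quotient.mk (hH.setoid τ) t) =
      hH.assign hE (consSubst f t) := by
  funext σ v
  cases v <;> rfl

theorem eval_assign (hH : IsTruthSet T H) (hE : T.Extensional) {V : Ty → Type} {τ : Ty}
    (t : Tm V τ) (f : Subst V NatVars) :
    t.eval (hH.assign hE f) = Quotient.mk (hH.setoid τ) (t.subst f) := by
  induction t with
  | app s t hs ht => exact congrArg₂ (hH.termModel hE).app hs ht
  | _ => rfl

theorem sat_assign (hH : IsTruthSet T H) (hE : T.Extensional) {V : Ty → Type}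
    (φ : Fm V) : ∀ f : Subst V NatVars, φ.Sat (hH.assign hE f) ↔ φ.subst f ∈ H := by
  induction φ with
  | bot => exact fun f => ⟨False.elim, fun h => hH.bot_notMem h⟩
  | eq s t =>
    intro f
    rw [Fm.Sat, hH.eval_assign, hH.eval_assign]
    exact Quotient.eq (r := hH.setoid Ty.N)
  | imp φ ψ hφ hψ =>
    intro f
    exact (imp_congr (hφ f) (hψ f)).trans (hH.imp_mem_iff _ _).symm
  | all τ φ ih =>
    intro f
    refine (Quotient.forall (s := hH.setoid τ)).trans (Iff.trans ?_ (hH.all_mem_iff _ _).symm)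
    refine forall_congr' fun t => ?_
    rw [Fm.subst_liftSubst_inst, ← ih, cons_assign]

theorem termModel_models (hH : IsTruthSet T H) (hE : T.Extensional) (hT : T.Closed) :
    (hH.termModel hE).Models T := by
  intro V φ hφ ρ
  obtain ⟨f, rfl⟩ := hH.assign_surjective hE ρ
  exact (hH.sat_assign hE φ f).2 (hH.ax_mem _ (hT f φ hφ))

end IsTruthSet

/-- A closed term of each type. -/
def closedTm {V : Ty → Type} : (τ : Ty) → Tm V τ
  | .N => .zero
  | .arr σ τ => .K τ σ ⬝ₜ closedTm τ

/-- The empty substitution. -/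
abbrev noSubst (V : Ty → Type) : Subst NoVars V := fun _ v => v.elim

theorem Theory.consistent_neg_of_not_proves {T : Theory} (hT : T.Closed) {φ : Sentence}
    (hφ : ¬ T.Proves φ) : T.Consistent {(¬ₒ φ).subst (noSubst NatVars)} := by
  intro hbot
  have hclosed := hbot.subst hT (fun τ _ => closedTm (V := NoVars) τ)
  rw [Set.image_singleton, Fm.subst_subst,
    show (fun σ v => (noSubst NatVars σ v).subst fun τ _ => closedTm τ) =
      fun _ v => Tm.var (V := NoVars) v from funext₂ fun _ v => v.elim, Fm.subst_var,
    ← insert_empty_eq] at hclosed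
  exact hφ (.raa hclosed)

theorem Theory.proves_of_forall_models {T : Theory} (hT : T.Closed) (hE : T.Extensional)
    (φ : Sentence) (h : ∀ 𝓜 : Struct, 𝓜.Models T → ∀ ρ : 𝓜.Assign NoVars, φ.Sat ρ) :
    T.Proves φ := by
  by_contra hφ
  let Γ : T.Condition := ⟨{(¬ₒ φ).subst (noSubst NatVars)}, consistent_neg_of_not_proves hT hφ, by
    simpa only [Set.biUnion_singleton] using Fm.occ_finite _⟩
  obtain ⟨H, hH, hΓH⟩ := Γ.exists_isTruthSet hT
  have hneg : (¬ₒ φ).Sat (hH.assign hE (noSubst NatVars)) := (hH.sat_assign hE _ _).2 (hΓH rfl)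
  exact hneg (h _ (hH.termModel_models hE hT) _)

/-! ### Closure of the axioms under substitution -/

theorem Fm.QF.subst {V : Ty → Type} {φ : Fm V} : φ.QF → ∀ {W : Ty → Type} (f : Subst V W),
    (φ.subst f).QF := by
  induction φ with
  | bot => exact fun h _ _ => h
  | eq s t => exact fun h _ _ => h
  | imp φ ψ hφ hψ => exact fun h _ f => ⟨hφ h.1 f, hψ h.2 f⟩
  | all τ φ _ => exact fun h => h.elim

theorem Fm.subst_succSubst {V W : Ty → Type} (A : Fm (Ext V Ty.N)) (f : Subst V W) :
    (A.subst (succSubst V)).subst (liftSubst f Ty.N) =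
      (A.subst (liftSubst f Ty.N)).subst (succSubst W) := by
  rw [Fm.subst_subst, Fm.subst_subst]
  congr 1
  funext τ v
  cases v with
  | new => rfl
  | old v => exact (Tm.wk_subst (f τ v) (succSubst W)).symm

theorem Fm.subst_choiceSubst {V W : Ty → Type} (A : Fm (Ext (Ext V Ty.one) Ty.N))
    (f : Subst V W) :
    (A.subst (choiceSubst V)).subst (liftSubst (liftSubst f Ty.two) Ty.one) =
      (A.subst (liftSubst (liftSubst f Ty.one) Ty.N)).subst (choiceSubst W) := by
  rw [Fm.subst_subst, Fm.subst_subst]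
  congr 1
  funext τ v
  obtain _ | (_ | v) := v
  · rfl
  · rfl
  · simp only [choiceSubst, Tm.subst, liftSubst, Tm.wk, Tm.subst_subst]

theorem RCAAxiom.subst {V : Ty → Type} {φ : Fm V} (h : RCAAxiom φ) {W : Ty → Type}
    (f : Subst V W) : RCAAxiom (φ.subst f) := by
  cases h with
  | succ_ne t => exact .succ_ne _
  | succ_inj s t => exact .succ_inj _ _
  | comb_K s t => rw [eqAt_subst]; exact .comb_K _ _
  | comb_S r s t => rw [eqAt_subst]; exact .comb_S _ _ _
  | rec_zero g m => exact .rec_zero _ _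
  | rec_succ g m n => exact .rec_succ _ _ _
  | ext s t g => simp only [Fm.subst, eqAt_subst]; exact .ext _ _ _
  | qf_ind A hA =>
    have h := RCAAxiom.qf_ind (A.subst (liftSubst f Ty.N)) (hA.subst _)
    rw [← Fm.subst_succSubst] at h
    simp only [Fm.subst, Fm.inst_subst_eq_subst_inst]
    exact h
  | qf_ac A hA =>
    have h := RCAAxiom.qf_ac (A.subst (liftSubst (liftSubst f Ty.one) Ty.N)) (hA.subst _)
    rw [← Fm.subst_choiceSubst] at h
    exact h

theorem Theory.Closed.plus {T : Theory} (hT : T.Closed) {φ : (V : Ty → Type) → Fm V}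
    (hφ : ∀ {V W : Ty → Type} (f : Subst V W), (φ V).subst f = φ W) : (T.plus φ).Closed := by
  rintro V W f ψ (rfl | h)
  · exact .inl (hφ f)
  · exact .inr (hT f ψ h)

theorem RCA_closed : RCA.Closed := fun f _ h => RCAAxiom.subst h f

theorem ACA_closed : ACA.Closed := RCA_closed.plus fun _ => rfl

theorem ACA_extensional : ACA.Extensional := fun s t f => .inr (.ext s t f)

theorem Theory.Extensional.plus {T : Theory} (hT : T.Extensional) (φ : (V : Ty → Type) → Fm V) :
    (T.plus φ).Extensional :=
  fun s t f => .inr (hT s t f)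

/-! ### Truth of the defined connectives -/

section Sat

variable {𝓜 : Struct} {V W : Ty → Type} (ρ : 𝓜.Assign V)

theorem Tm.eval_subst (f : Subst W V) {τ : Ty} (t : Tm W τ) :
    (t.subst f).eval ρ = t.eval fun σ v => (f σ v).eval ρ := by
  induction t with
  | app s t hs ht => simp only [Tm.subst, Tm.eval, hs, ht]
  | _ => rfl

@[simp]
theorem Tm.eval_wk {σ τ : Ty} (t : Tm V τ) (a : 𝓜.C σ) :
    t⇑.eval (Struct.cons ρ a) = t.eval ρ := by
  rw [Tm.wk, Tm.eval_subst]
  rfl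

theorem Fm.sat_subst (φ : Fm W) :
    ∀ {V : Ty → Type} (ρ : 𝓜.Assign V) (f : Subst W V),
      (φ.subst f).Sat ρ ↔ φ.Sat fun σ v => (f σ v).eval ρ := by
  induction φ with
  | bot => exact fun _ _ => Iff.rfl
  | eq s t => intro V ρ f; simp only [Fm.subst, Fm.Sat, Tm.eval_subst]
  | imp φ ψ hφ hψ => exact fun ρ f => imp_congr (hφ ρ f) (hψ ρ f)
  | all τ φ ih =>
    intro V ρ f
    refine forall_congr' fun a => ?_
    have hcons : (fun σ v => (liftSubst f τ σ v).eval (Struct.cons ρ a)) =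
        Struct.cons (fun σ v => (f σ v).eval ρ) a := by
      funext σ v
      cases v with
      | new => rfl
      | old v => exact Tm.eval_wk ρ (f σ v) a
    rw [ih, hcons]

@[simp]
theorem Fm.sat_eq (s t : Tm V Ty.N) : (s =ₒ t).Sat ρ ↔ s.eval ρ = t.eval ρ := Iff.rfl

@[simp]
theorem Fm.sat_imp (φ ψ : Fm V) : (φ ⇒ₒ ψ).Sat ρ ↔ (φ.Sat ρ → ψ.Sat ρ) := Iff.rfl

@[simp]
theorem Fm.sat_neg (φ : Fm V) : (¬ₒ φ).Sat ρ ↔ ¬ φ.Sat ρ := Iff.rfl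

@[simp]
theorem Fm.sat_and (φ ψ : Fm V) : (φ ∧ₒ ψ).Sat ρ ↔ φ.Sat ρ ∧ ψ.Sat ρ := by
  simp [Fm.and]

@[simp]
theorem Fm.sat_iff (φ ψ : Fm V) : (φ ⇔ₒ ψ).Sat ρ ↔ (φ.Sat ρ ↔ ψ.Sat ρ) := by
  simp [Fm.iff, iff_def]

@[simp]
theorem sat_allB (τ : Ty) (φ : Tm (Ext V τ) τ → Fm (Ext V τ)) :
    (allB τ φ).Sat ρ ↔ ∀ a : 𝓜.C τ, (φ (.var .new)).Sat (Struct.cons ρ a) := Iff.rfl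

@[simp]
theorem sat_exB (τ : Ty) (φ : Tm (Ext V τ) τ → Fm (Ext V τ)) :
    (exB τ φ).Sat ρ ↔ ∃ a : 𝓜.C τ, (φ (.var .new)).Sat (Struct.cons ρ a) := by
  simp [exB]

@[simp]
theorem Tm.eval_new {σ : Ty} (a : 𝓜.C σ) :
    (Tm.var (.new : Ext V σ σ)).eval (Struct.cons ρ a) = a := rfl

@[simp]
theorem Tm.eval_app {σ τ : Ty} (s : Tm V (σ ⟶ₜ τ)) (t : Tm V σ) :
    (s ⬝ₜ t).eval ρ = 𝓜.app (s.eval ρ) (t.eval ρ) := rfl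

@[simp]
theorem sat_eqAt : ∀ (τ : Ty) {V : Ty → Type} (ρ : 𝓜.Assign V) (s t : Tm V τ),
    (eqAt τ s t).Sat ρ ↔ s.eval ρ = t.eval ρ
  | .N, _, _, _, _ => Iff.rfl
  | .arr σ τ, _, ρ, s, t => by
    simp only [eqAt, sat_allB, sat_eqAt τ, Tm.eval_app, Tm.eval_wk, Tm.eval_new]
    exact ⟨𝓜.ext, fun h x => by rw [h]⟩

end Sat

/-! ### Models of `ACA₀^ω` -/

infixl:75 " ⬝ " => Struct.app _

namespace Struct.Models

variable {𝓜 : Struct}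

theorem of_plus {T : Theory} {φ : (V : Ty → Type) → Fm V} (h : 𝓜.Models (T.plus φ)) : 𝓜.Models T :=
  fun _ _ hψ => h _ (.inr hψ)

theorem sat_qf_ind (h : 𝓜.Models RCA) {V : Ty → Type} (ρ : 𝓜.Assign V)
    (A : Fm (Ext V Ty.N)) (hA : A.QF) (zero : A.Sat (cons ρ 𝓜.zero))
    (succ : ∀ n, A.Sat (cons ρ n) → A.Sat (cons ρ (𝓜.succ ⬝ n))) (n : 𝓜.C Ty.N) :
    A.Sat (cons ρ n) := by
  refine h _ (.qf_ind A hA) ρ ?_ (fun m hm => ?_) n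
  · rw [Fm.inst, Fm.sat_subst]
    convert zero using 1
    funext τ v
    cases v <;> rfl
  · rw [Fm.sat_subst]
    convert succ m hm using 1
    funext τ v
    cases v <;> rfl

theorem sat_qf_ac (h : 𝓜.Models RCA) {V : Ty → Type} (ρ : 𝓜.Assign V)
    (A : Fm (Ext (Ext V Ty.one) Ty.N)) (hA : A.QF) (hex : ∀ x, ∃ n, A.Sat (cons (cons ρ x) n)) :
    ∃ Y : 𝓜.C Ty.two, ∀ x, A.Sat (cons (cons ρ x) (Y ⬝ x)) := by
  have choice := h _ (.qf_ac A hA) ρ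
  simp only [Fm.sat_neg, Fm.Sat, not_forall, not_not] at choice
  obtain ⟨Y, hY⟩ := choice hex
  rw [not_exists_not] at hY
  refine ⟨Y, fun x => ?_⟩
  convert (Fm.sat_subst ..).1 (hY x) using 1
  funext τ v
  cases v with
  | new => rfl
  | old v => cases v <;> simp only [choiceSubst, Tm.eval, Struct.cons]

/-- The elements of a structure, used as variables, standing for themselves. -/
abbrev selfAssign (𝓜 : Struct) : 𝓜.Assign 𝓜.C := fun _ a => a

theorem succ_ne_zero (h : 𝓜.Models RCA) (n : 𝓜.C Ty.N) : 𝓜.succ ⬝ n ≠ 𝓜.zero :=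
  h _ (.succ_ne (.var n)) (selfAssign 𝓜)

theorem app_K (h : 𝓜.Models RCA) {σ τ : Ty} (a : 𝓜.C σ) (b : 𝓜.C τ) : 𝓜.K σ τ ⬝ a ⬝ b = a :=
  (sat_eqAt ..).1 (h _ (.comb_K (.var a) (.var b)) (selfAssign 𝓜))

theorem app_S (h : 𝓜.Models RCA) {ρ σ τ : Ty} (a : 𝓜.C (ρ ⟶ₜ σ ⟶ₜ τ)) (b : 𝓜.C (ρ ⟶ₜ σ))
    (c : 𝓜.C ρ) : 𝓜.S ρ σ τ ⬝ a ⬝ b ⬝ c = a ⬝ c ⬝ (b ⬝ c) :=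
  (sat_eqAt ..).1 (h _ (.comb_S (.var a) (.var b) (.var c)) (selfAssign 𝓜))

theorem rec_succ (h : 𝓜.Models RCA) (f : 𝓜.C (Ty.N ⟶ₜ Ty.N ⟶ₜ Ty.N)) (m n : 𝓜.C Ty.N) :
    𝓜.R ⬝ f ⬝ m ⬝ (𝓜.succ ⬝ n) = f ⬝ n ⬝ (𝓜.R ⬝ f ⬝ m ⬝ n) :=
  h _ (.rec_succ (.var f) (.var m) (.var n)) (selfAssign 𝓜)

/- Quantifier-free induction applies to `n ≠ 0 → n = S (pred n)`. -/
theorem eq_zero_or_exists_succ (h : 𝓜.Models RCA) (n : 𝓜.C Ty.N) :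
    n = 𝓜.zero ∨ ∃ m, n = 𝓜.succ ⬝ m := by
  let x : Tm (Ext 𝓜.C Ty.N) Ty.N := .var .new
  let pred : 𝓜.C Ty.one := 𝓜.R ⬝ 𝓜.K _ _ ⬝ 𝓜.zero
  have pred_succ (m : 𝓜.C Ty.N) : pred ⬝ (𝓜.succ ⬝ m) = m := (h.rec_succ ..).trans (h.app_K ..)
  have hn := h.sat_qf_ind (selfAssign 𝓜)
    ((¬ₒ x =ₒ .zero) ⇒ₒ x =ₒ .succ ⬝ₜ (.var (.old pred) ⬝ₜ x)) ⟨⟨trivial, trivial⟩, trivial⟩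
    (fun hne => absurd rfl hne) (fun m _ _ => congrArg (𝓜.succ ⬝ ·) (pred_succ m).symm) n
  by_cases hzero : n = 𝓜.zero
  · exact .inl hzero
  · exact .inr ⟨_, hn hzero⟩

theorem ind (h : 𝓜.Models RCA) (f : 𝓜.C Ty.one) (zero : f ⬝ 𝓜.zero = 𝓜.zero)
    (succ : ∀ n, f ⬝ n = 𝓜.zero → f ⬝ (𝓜.succ ⬝ n) = 𝓜.zero) : ∀ n, f ⬝ n = 𝓜.zero :=
  h.sat_qf_ind (selfAssign 𝓜) (.var (.old f) ⬝ₜ .var .new =ₒ .zero) trivial zero succ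

theorem qf_ac (h : 𝓜.Models RCA) (f : 𝓜.C (Ty.one ⟶ₜ Ty.one))
    (hf : ∀ x, ∃ n, f ⬝ x ⬝ n = 𝓜.zero) : ∃ Y : 𝓜.C Ty.two, ∀ x, f ⬝ x ⬝ (Y ⬝ x) = 𝓜.zero :=
  h.sat_qf_ac (selfAssign 𝓜)
    (.var (.old (.old f)) ⬝ₜ .var (.old .new) ⬝ₜ .var .new =ₒ .zero) trivial hf

/- Quantifier-free choice, applied to `(x 0 = x 1 → n = 0) ∧ (x 0 ≠ x 1 → n = 1)`. -/
theorem exists_eq_char (h : 𝓜.Models RCA) :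
    ∃ e : 𝓜.C Ty.two, ∀ x, e ⬝ x = 𝓜.zero ↔ x ⬝ 𝓜.zero = x ⬝ (𝓜.succ ⬝ 𝓜.zero) := by
  let x : Tm (Ext (Ext 𝓜.C Ty.one) Ty.N) Ty.one := .var (.old .new)
  let n : Tm (Ext (Ext 𝓜.C Ty.one) Ty.N) Ty.N := .var .new
  obtain ⟨e, he⟩ := h.sat_qf_ac (selfAssign 𝓜)
    ((x ⬝ₜ .zero =ₒ x ⬝ₜ .n1 ⇒ₒ n =ₒ .zero) ∧ₒ ((¬ₒ x ⬝ₜ .zero =ₒ x ⬝ₜ .n1) ⇒ₒ n =ₒ .n1))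
    (by simp [Fm.and, Fm.neg, Fm.QF]) fun a => by
      simp only [Fm.sat_and, Fm.sat_imp, Fm.sat_neg]
      by_cases ha : a ⬝ 𝓜.zero = a ⬝ (𝓜.succ ⬝ 𝓜.zero)
      · exact ⟨𝓜.zero, fun _ => rfl, fun hne => absurd ha hne⟩
      · exact ⟨𝓜.succ ⬝ 𝓜.zero, fun heq => absurd heq ha, fun _ => rfl⟩
  refine ⟨e, fun a => ?_⟩
  have hea := he a
  simp only [Fm.sat_and, Fm.sat_imp, Fm.sat_neg] at hea
  refine ⟨fun hzero => by_contra fun hne => ?_, hea.1⟩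
  exact h.succ_ne_zero 𝓜.zero ((hea.2 hne).symm.trans hzero)

theorem exists_two (h : 𝓜.Models ACA) :
    ∃ E : 𝓜.C Ty.two, ∀ f, E ⬝ f = 𝓜.zero ↔ ∃ n, f ⬝ n = 𝓜.zero := by
  have hE := h _ (.inl rfl) (selfAssign 𝓜)
  simp only [existsTwo, sat_exB, Fm.sat_and, sat_allB, Fm.sat_iff, Fm.sat_eq, Tm.eval_app,
    Tm.eval_wk, Tm.eval_new] at hE
  obtain ⟨E, -, hE⟩ := hE
  exact ⟨E, fun f => (hE f).symm⟩

end Struct.Models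

/-- A structure with the properties that the axioms of `ACA₀^ω` express. The axioms of
quantifier-free induction and choice are kept for equations only, which suffices since
quantifier-free formulas have characteristic functions. -/
structure ACAModel extends Struct where
  succ_ne_zero : ∀ n, app succ n ≠ zero
  succ_inj : ∀ m n, app succ m = app succ n → m = n
  app_K : ∀ {σ τ : Ty} (a : C σ) (b : C τ), app (app (K σ τ) a) b = a
  app_S : ∀ {ρ σ τ : Ty} (a : C (ρ ⟶ₜ σ ⟶ₜ τ)) (b : C (ρ ⟶ₜ σ)) (c : C ρ),
    app (app (app (S ρ σ τ) a) b) c = app (app a c) (app b c)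
  rec_zero : ∀ f m, app (app (app R f) m) zero = m
  rec_succ : ∀ f m n, app (app (app R f) m) (app succ n) = app (app f n) (app (app (app R f) m) n)
  eq_zero_or_exists_succ : ∀ n, n = zero ∨ ∃ m, n = app succ m
  ind : ∀ f : C Ty.one, app f zero = zero → (∀ n, app f n = zero → app f (app succ n) = zero) →
    ∀ n, app f n = zero
  exists_eq_char : ∃ e : C Ty.two, ∀ x, app e x = zero ↔ app x zero = app x (app succ zero)
  exists_two : ∃ E : C Ty.two, ∀ f, app E f = zero ↔ ∃ n, app f n = zero
  qf_ac : ∀ f : C (Ty.one ⟶ₜ Ty.one), (∀ x, ∃ n, app (app f x) n = zero) →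
    ∃ Y : C Ty.two, ∀ x, app (app f x) (app Y x) = zero

/-- A structure satisfying all axioms of `ACA₀^ω`, as an `ACAModel`. -/
def Struct.Models.toACAModel {𝓜 : Struct} (h : 𝓜.Models ACA) : ACAModel where
  toStruct := 𝓜
  succ_ne_zero := h.of_plus.succ_ne_zero
  succ_inj m n := h.of_plus _ (.succ_inj (.var m) (.var n)) (selfAssign 𝓜)
  app_K := h.of_plus.app_K
  app_S := h.of_plus.app_S
  rec_zero f m := h.of_plus _ (.rec_zero (.var f) (.var m)) (selfAssign 𝓜)
  rec_succ := h.of_plus.rec_succ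
  eq_zero_or_exists_succ := h.of_plus.eq_zero_or_exists_succ
  ind := h.of_plus.ind
  exists_eq_char := h.of_plus.exists_eq_char
  exists_two := h.exists_two
  qf_ac := h.of_plus.qf_ac

/-! ### Definable functions and predicates in a model -/

/-- `X` is a product of types of the model; `arr τ` is the iterated arrow type of the internal
functions from `X` to `τ`, and `ev` is their evaluation. -/
class Context (𝓜 : ACAModel) (X : Type) where
  arr : Ty → Ty
  ev : {τ : Ty} → 𝓜.C (arr τ) → X → 𝓜.C τ
  exists_const : ∀ {τ : Ty} (c : 𝓜.C τ), ∃ e : 𝓜.C (arr τ), ∀ x, ev e x = c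
  exists_app : ∀ {σ τ : Ty} (f : 𝓜.C (arr (σ ⟶ₜ τ))) (a : 𝓜.C (arr σ)),
    ∃ e : 𝓜.C (arr τ), ∀ x, ev e x = ev f x ⬝ ev a x

instance Context.unit (𝓜 : ACAModel) : Context 𝓜 Unit where
  arr τ := τ
  ev e _ := e
  exists_const c := ⟨c, fun _ => rfl⟩
  exists_app f a := ⟨f ⬝ a, fun _ => rfl⟩

instance Context.prod (𝓜 : ACAModel) (X : Type) [Context 𝓜 X] (ρ : Ty) :
    Context 𝓜 (X × 𝓜.C ρ) where
  arr τ := Context.arr 𝓜 X (ρ ⟶ₜ τ)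
  ev e p := Context.ev e p.1 ⬝ p.2
  exists_const {τ} c := by
    obtain ⟨e, he⟩ := Context.exists_const (X := X) (𝓜.K τ ρ ⬝ c)
    exact ⟨e, fun p => by rw [he, 𝓜.app_K]⟩
  exists_app {σ τ} f a := by
    obtain ⟨s, hs⟩ := Context.exists_const (X := X) (𝓜.S ρ σ τ)
    obtain ⟨sf, hsf⟩ := Context.exists_app s f
    obtain ⟨e, he⟩ := Context.exists_app sf a
    exact ⟨e, fun p => by rw [he, hsf, hs, 𝓜.app_S]⟩

section Definability

variable {𝓜 : ACAModel} {X : Type} [Context 𝓜 X]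

/-- The function `f` is given by an element of the model. -/
class Definable {τ : Ty} (f : X → 𝓜.C τ) : Prop where
  exists_ev : ∃ e : 𝓜.C (Context.arr 𝓜 X τ), ∀ x, Context.ev e x = f x

/-- The predicate `P` has a characteristic function in the model; the value `zero` stands for
truth. -/
class DefinablePred (𝓜 : ACAModel) {X : Type} [Context 𝓜 X] (P : X → Prop) : Prop where
  exists_char : ∃ c : X → 𝓜.C Ty.N, Definable c ∧ ∀ x, P x ↔ c x = 𝓜.zero

namespace Definable

theorem congr {τ : Ty} {f g : X → 𝓜.C τ} (hf : Definable f) (h : ∀ x, f x = g x) :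
    Definable g :=
  (funext h : f = g) ▸ hf

instance const {τ : Ty} (c : 𝓜.C τ) : Definable fun _ : X => c := ⟨Context.exists_const c⟩

instance app {σ τ : Ty} (f : X → 𝓜.C (σ ⟶ₜ τ)) (a : X → 𝓜.C σ) [hf : Definable f]
    [ha : Definable a] : Definable fun x => f x ⬝ a x := by
  obtain ⟨ef, hef⟩ := hf
  obtain ⟨ea, hea⟩ := ha
  obtain ⟨e, he⟩ := Context.exists_app ef ea
  exact ⟨e, fun x => by rw [he, hef, hea]⟩

theorem comp_fst {σ τ : Ty} {f : X → 𝓜.C τ} (hf : Definable f) :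
    Definable fun p : X × 𝓜.C σ => f p.1 := by
  obtain ⟨e, he⟩ := (app (fun _ => 𝓜.K τ σ) f).exists_ev
  exact ⟨e, fun p => (congrArg (· ⬝ p.2) (he p.1)).trans (𝓜.app_K _ _)⟩

instance var₀ {σ : Ty} : Definable fun p : X × 𝓜.C σ => p.2 := by
  obtain ⟨e, he⟩ := Context.exists_const (X := X) (𝓜.S σ (σ ⟶ₜ σ) σ ⬝ 𝓜.K _ _ ⬝ 𝓜.K _ _)
  exact ⟨e, fun p => (congrArg (· ⬝ p.2) (he p.1)).trans
    ((𝓜.app_S _ _ _).trans (𝓜.app_K _ _))⟩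

instance var₁ {σ σ₁ : Ty} : Definable fun p : (X × 𝓜.C σ) × 𝓜.C σ₁ => p.1.2 := var₀.comp_fst

instance var₂ {σ σ₁ σ₂ : Ty} :
    Definable fun p : ((X × 𝓜.C σ) × 𝓜.C σ₁) × 𝓜.C σ₂ => p.1.1.2 :=
  var₁.comp_fst

instance var₃ {σ σ₁ σ₂ σ₃ : Ty} :
    Definable fun p : (((X × 𝓜.C σ) × 𝓜.C σ₁) × 𝓜.C σ₂) × 𝓜.C σ₃ => p.1.1.1.2 :=
  var₂.comp_fst

instance var₄ {σ σ₁ σ₂ σ₃ σ₄ : Ty} :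
    Definable fun p : ((((X × 𝓜.C σ) × 𝓜.C σ₁) × 𝓜.C σ₂) × 𝓜.C σ₃) × 𝓜.C σ₄ => p.1.1.1.1.2 :=
  var₃.comp_fst

theorem exists_curry {σ τ : Ty} (f : X → 𝓜.C σ → 𝓜.C τ)
    [hf : Definable fun p : X × 𝓜.C σ => f p.1 p.2] :
    ∃ g : X → 𝓜.C (σ ⟶ₜ τ), Definable g ∧ ∀ x y, g x ⬝ y = f x y := by
  obtain ⟨e, he⟩ := hf
  exact ⟨fun x => Context.ev e x, ⟨e, fun _ => rfl⟩, fun x y => he (x, y)⟩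

theorem exists_element {σ τ : Ty} (f : 𝓜.C σ → 𝓜.C τ)
    [hf : Definable fun p : Unit × 𝓜.C σ => f p.2] :
    ∃ e : 𝓜.C (σ ⟶ₜ τ), ∀ x, e ⬝ x = f x := by
  obtain ⟨g, -, hg⟩ := exists_curry (𝓜 := 𝓜) (fun _ : Unit => f)
  exact ⟨g (), hg ()⟩

theorem exists_element₂ {σ ρ τ : Ty} (f : 𝓜.C σ → 𝓜.C ρ → 𝓜.C τ)
    [hf : Definable fun p : (Unit × 𝓜.C σ) × 𝓜.C ρ => f p.1.2 p.2] :
    ∃ e : 𝓜.C (σ ⟶ₜ ρ ⟶ₜ τ), ∀ x y, e ⬝ x ⬝ y = f x y := by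
  obtain ⟨g, hg, hgf⟩ := exists_curry (fun (x : Unit × 𝓜.C σ) (y : 𝓜.C ρ) => f x.2 y)
  obtain ⟨e, he⟩ := exists_element (fun x => g ((), x)) (hf := hg)
  exact ⟨e, fun x y => by rw [he, hgf]⟩

theorem comp {σ τ : Ty} {f : 𝓜.C σ → 𝓜.C τ} (hf : Definable fun p : Unit × 𝓜.C σ => f p.2)
    (a : X → 𝓜.C σ) [Definable a] : Definable fun x => f (a x) := by
  obtain ⟨e, he⟩ := exists_element f
  exact (app (fun _ => e) a).congr fun x => he _

theorem comp₂ {σ ρ τ : Ty} {f : 𝓜.C σ → 𝓜.C ρ → 𝓜.C τ}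
    (hf : Definable fun p : (Unit × 𝓜.C σ) × 𝓜.C ρ => f p.1.2 p.2)
    (a : X → 𝓜.C σ) (b : X → 𝓜.C ρ) [Definable a] [Definable b] :
    Definable fun x => f (a x) (b x) := by
  obtain ⟨e, he⟩ := exists_element₂ f
  exact (app (fun x => e ⬝ a x) b).congr fun x => he _ _

open Classical in
instance ite (P : X → Prop) (a b : X → 𝓜.C Ty.N) [hP : DefinablePred 𝓜 P] [Definable a]
    [Definable b] : Definable fun x => if P x then a x else b x := by
  obtain ⟨c, hc, hPc⟩ := hP
  refine congr (f := fun x => 𝓜.R ⬝ (𝓜.K _ _ ⬝ (𝓜.K _ _ ⬝ b x)) ⬝ a x ⬝ c x)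
    inferInstance fun x => ?_
  split_ifs with hx
  · rw [(hPc x).1 hx, 𝓜.rec_zero]
  · rw [hPc] at hx
    obtain hzero | ⟨m, hm⟩ := 𝓜.eq_zero_or_exists_succ (c x)
    · exact absurd hzero hx
    · rw [hm, 𝓜.rec_succ, 𝓜.app_K, 𝓜.app_K]

end Definable

/-- The number one of the model. -/
def ACAModel.one (𝓜 : ACAModel) : 𝓜.C Ty.N := 𝓜.succ ⬝ 𝓜.zero

theorem ACAModel.one_ne_zero (𝓜 : ACAModel) : 𝓜.one ≠ 𝓜.zero := 𝓜.succ_ne_zero _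

namespace DefinablePred

variable {P Q : X → Prop}

theorem congr (hP : DefinablePred 𝓜 P) (h : ∀ x, P x ↔ Q x) : DefinablePred 𝓜 Q :=
  (funext fun x => propext (h x) : P = Q) ▸ hP

theorem comp {σ : Ty} {P : 𝓜.C σ → Prop} (hP : DefinablePred 𝓜 fun p : Unit × 𝓜.C σ => P p.2)
    (a : X → 𝓜.C σ) [Definable a] : DefinablePred 𝓜 fun x => P (a x) := by
  obtain ⟨c, hc, hPc⟩ := hP
  exact ⟨_, Definable.comp (f := fun y => c ((), y)) hc a, fun x => hPc ((), a x)⟩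

theorem comp₂ {σ ρ : Ty} {P : 𝓜.C σ → 𝓜.C ρ → Prop}
    (hP : DefinablePred 𝓜 fun p : (Unit × 𝓜.C σ) × 𝓜.C ρ => P p.1.2 p.2)
    (a : X → 𝓜.C σ) (b : X → 𝓜.C ρ) [Definable a] [Definable b] :
    DefinablePred 𝓜 fun x => P (a x) (b x) := by
  obtain ⟨c, hc, hPc⟩ := hP
  exact ⟨_, Definable.comp₂ (f := fun y z => c (((), y), z)) hc a b,
    fun x => hPc (((), a x), b x)⟩

instance eq (a b : X → 𝓜.C Ty.N) [Definable a] [Definable b] :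
    DefinablePred 𝓜 fun x => a x = b x := by
  obtain ⟨e, he⟩ := 𝓜.exists_eq_char
  refine ⟨fun x => e ⬝ (𝓜.R ⬝ (𝓜.K _ _ ⬝ (𝓜.K _ _ ⬝ b x)) ⬝ a x), inferInstance, fun x => ?_⟩
  rw [he, 𝓜.rec_zero, 𝓜.rec_succ, 𝓜.app_K, 𝓜.app_K]

open Classical in
instance imp (P Q : X → Prop) [DefinablePred 𝓜 P] [hQ : DefinablePred 𝓜 Q] :
    DefinablePred 𝓜 fun x => P x → Q x := by
  obtain ⟨q, hq, hQq⟩ := hQ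
  refine ⟨fun x => if P x then q x else 𝓜.zero, inferInstance, fun x => ?_⟩
  by_cases hx : P x <;> simp [hx, hQq]

instance false : DefinablePred 𝓜 fun _ : X => False :=
  ⟨fun _ => 𝓜.one, inferInstance, fun _ => by simp [𝓜.one_ne_zero]⟩

instance not (P : X → Prop) [DefinablePred 𝓜 P] : DefinablePred 𝓜 fun x => ¬ P x := imp _ _

instance and (P Q : X → Prop) [DefinablePred 𝓜 P] [DefinablePred 𝓜 Q] :
    DefinablePred 𝓜 fun x => P x ∧ Q x :=
  congr (P := fun x => ¬ (P x → ¬ Q x)) inferInstance fun x => by simp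

instance or (P Q : X → Prop) [DefinablePred 𝓜 P] [DefinablePred 𝓜 Q] :
    DefinablePred 𝓜 fun x => P x ∨ Q x :=
  congr (P := fun x => ¬ P x → Q x) inferInstance fun _ => or_iff_not_imp_left.symm

instance iff (P Q : X → Prop) [DefinablePred 𝓜 P] [DefinablePred 𝓜 Q] :
    DefinablePred 𝓜 fun x => P x ↔ Q x :=
  congr (P := fun x => (P x → Q x) ∧ (Q x → P x)) inferInstance fun _ => iff_def.symm

instance exists_num (P : X → 𝓜.C Ty.N → Prop)
    [hP : DefinablePred 𝓜 fun p : X × 𝓜.C Ty.N => P p.1 p.2] :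
    DefinablePred 𝓜 fun x => ∃ n, P x n := by
  obtain ⟨c, hc, hPc⟩ := hP
  obtain ⟨g, hg, hgc⟩ := Definable.exists_curry (fun x n => c (x, n))
  obtain ⟨E, hE⟩ := 𝓜.exists_two
  refine ⟨fun x => E ⬝ g x, inferInstance, fun x => ?_⟩
  rw [hE]
  simp only [hgc]
  exact exists_congr fun n => hPc (x, n)

instance forall_num (P : X → 𝓜.C Ty.N → Prop)
    [hP : DefinablePred 𝓜 fun p : X × 𝓜.C Ty.N => P p.1 p.2] :
    DefinablePred 𝓜 fun x => ∀ n, P x n :=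
  congr (P := fun x => ¬ ∃ n, ¬ P x n) inferInstance fun x => by simp

end DefinablePred

/- Since `∃ m, f m = 0` is definable, quantifier-free choice applies to
`(∃ m, f m = 0) → f n = 0`, which has a solution `n` for every `f`. -/
theorem ACAModel.exists_search (𝓜 : ACAModel) :
    ∃ μ : 𝓜.C Ty.two, ∀ f, (∃ n, f ⬝ n = 𝓜.zero) → f ⬝ (μ ⬝ f) = 𝓜.zero := by
  let P (f : 𝓜.C Ty.one) (n : 𝓜.C Ty.N) : Prop := (∃ m, f ⬝ m = 𝓜.zero) → f ⬝ n = 𝓜.zero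
  obtain ⟨c, hc, hPc⟩ :
      DefinablePred 𝓜 fun p : (Unit × 𝓜.C Ty.one) × 𝓜.C Ty.N => P p.1.2 p.2 := by
    dsimp only [P]
    infer_instance
  obtain ⟨e, he⟩ := Definable.exists_element₂ (fun f n => c (((), f), n)) (hf := hc)
  have hPe (f n) : P f n ↔ e ⬝ f ⬝ n = 𝓜.zero := (hPc (((), f), n)).trans (by rw [he])
  have hex (f) : ∃ n, e ⬝ f ⬝ n = 𝓜.zero := by
    by_cases hf : ∃ m, f ⬝ m = 𝓜.zero
    · exact hf.imp fun m hm => (hPe f m).1 fun _ => hm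
    · exact ⟨𝓜.zero, (hPe f _).1 fun h => absurd h hf⟩
  obtain ⟨μ, hμ⟩ := 𝓜.qf_ac e hex
  exact ⟨μ, fun f => (hPe f _).2 (hμ f)⟩

theorem Definable.exists_choice (P : X → 𝓜.C Ty.N → Prop)
    [hP : DefinablePred 𝓜 fun p : X × 𝓜.C Ty.N => P p.1 p.2] :
    ∃ g : X → 𝓜.C Ty.N, Definable g ∧ ∀ x, (∃ n, P x n) → P x (g x) := by
  obtain ⟨c, hc, hPc⟩ := hP
  obtain ⟨g, hg, hgc⟩ := exists_curry (fun x n => c (x, n))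
  have hPg (x n) : P x n ↔ g x ⬝ n = 𝓜.zero := (hPc (x, n)).trans (by rw [hgc])
  obtain ⟨μ, hμ⟩ := 𝓜.exists_search
  exact ⟨fun x => μ ⬝ g x, inferInstance, fun x hx =>
    (hPg x _).2 (hμ _ (hx.imp fun n => (hPg x n).1))⟩

theorem Definable.exists_choice_element {σ : Ty} (P : 𝓜.C σ → 𝓜.C Ty.N → Prop)
    [hP : DefinablePred 𝓜 fun p : (Unit × 𝓜.C σ) × 𝓜.C Ty.N => P p.1.2 p.2] :
    ∃ e : 𝓜.C (σ ⟶ₜ Ty.N), ∀ x, (∃ n, P x n) → P x (e ⬝ x) := by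
  obtain ⟨g, hg, hPg⟩ := exists_choice (fun (x : Unit × 𝓜.C σ) n => P x.2 n)
  obtain ⟨e, he⟩ := exists_element (fun x => g ((), x)) (hf := hg)
  exact ⟨e, fun x hx => by rw [he]; exact hPg ((), x) hx⟩

theorem Definable.exists_rec (a : 𝓜.C Ty.N) (s : 𝓜.C Ty.N → 𝓜.C Ty.N → 𝓜.C Ty.N)
    [hs : Definable fun p : (Unit × 𝓜.C Ty.N) × 𝓜.C Ty.N => s p.1.2 p.2] :
    ∃ e : 𝓜.C Ty.one, e ⬝ 𝓜.zero = a ∧ ∀ n, e ⬝ (𝓜.succ ⬝ n) = s n (e ⬝ n) := by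
  obtain ⟨e, he⟩ := exists_element₂ s
  exact ⟨𝓜.R ⬝ e ⬝ a, 𝓜.rec_zero _ _, fun n => by rw [𝓜.rec_succ, he]⟩

theorem ACAModel.induction (P : 𝓜.C Ty.N → Prop)
    (definable : DefinablePred 𝓜 fun p : Unit × 𝓜.C Ty.N => P p.2)
    (zero : P 𝓜.zero) (succ : ∀ n, P n → P (𝓜.succ ⬝ n)) (n : 𝓜.C Ty.N) : P n := by
  obtain ⟨c, hc, hPc⟩ := definable
  obtain ⟨e, he⟩ := Definable.exists_element (fun x => c ((), x)) (hf := hc)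
  have hPe (x) : P x ↔ e ⬝ x = 𝓜.zero := (hPc ((), x)).trans (by rw [he])
  simp only [hPe] at zero succ ⊢
  exact 𝓜.ind e zero succ n

end Definability

/-! ### Arithmetic in a model -/

namespace ACAModel

variable {𝓜 : ACAModel}

/-- Addition of the model, as a functional. -/
def adder (𝓜 : ACAModel) : 𝓜.C (Ty.N ⟶ₜ Ty.N ⟶ₜ Ty.N) := 𝓜.R ⬝ (𝓜.K _ _ ⬝ 𝓜.succ)

instance : Zero (𝓜.C Ty.N) := ⟨𝓜.zero⟩

instance : One (𝓜.C Ty.N) := ⟨𝓜.one⟩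

instance : Add (𝓜.C Ty.N) := ⟨fun s t => 𝓜.adder ⬝ s ⬝ t⟩

instance : Mul (𝓜.C Ty.N) :=
  ⟨fun s t => 𝓜.R ⬝ (𝓜.K _ _ ⬝ (𝓜.S _ _ _ ⬝ 𝓜.adder ⬝ (𝓜.K _ _ ⬝ s))) ⬝ 𝓜.zero ⬝ t⟩

/-- `2 ^ t` in the model, given by the recursion in `Tm.pow2`. -/
def pow2 (t : 𝓜.C Ty.N) : 𝓜.C Ty.N :=
  𝓜.R ⬝ (𝓜.K _ _ ⬝ (𝓜.S _ _ _ ⬝ 𝓜.adder ⬝ (𝓜.S _ (Ty.N ⟶ₜ Ty.N) _ ⬝ 𝓜.K _ _ ⬝ 𝓜.K _ _)))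
    ⬝ 𝓜.one ⬝ t

end ACAModel

namespace Definable

variable {𝓜 : ACAModel} {X : Type} [Context 𝓜 X] (a b : X → 𝓜.C Ty.N) [Definable a] [Definable b]

instance add : Definable fun x => a x + b x :=
  inferInstanceAs (Definable fun x => 𝓜.adder ⬝ a x ⬝ b x)

instance mul : Definable fun x => a x * b x :=
  inferInstanceAs (Definable fun x =>
    𝓜.R ⬝ (𝓜.K _ _ ⬝ (𝓜.S _ _ _ ⬝ 𝓜.adder ⬝ (𝓜.K _ _ ⬝ a x))) ⬝ 𝓜.zero ⬝ b x)

instance pow2 : Definable fun x => ACAModel.pow2 (a x) := by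
  unfold ACAModel.pow2
  infer_instance

end Definable

namespace ACAModel

variable {𝓜 : ACAModel}

protected theorem add_zero (a : 𝓜.C Ty.N) : a + 0 = a := 𝓜.rec_zero _ _

theorem add_succ (a b : 𝓜.C Ty.N) : a + 𝓜.succ ⬝ b = 𝓜.succ ⬝ (a + b) :=
  (𝓜.rec_succ _ _ _).trans (congrArg (· ⬝ _) (𝓜.app_K _ _))

protected theorem mul_zero (a : 𝓜.C Ty.N) : a * 0 = 0 := 𝓜.rec_zero _ _

theorem mul_succ (a b : 𝓜.C Ty.N) : a * 𝓜.succ ⬝ b = a * b + a :=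
  calc a * 𝓜.succ ⬝ b
      = 𝓜.K _ _ ⬝ (𝓜.S _ _ _ ⬝ 𝓜.adder ⬝ (𝓜.K _ _ ⬝ a)) ⬝ b ⬝ (a * b) := 𝓜.rec_succ _ _ _
    _ = 𝓜.adder ⬝ (a * b) ⬝ a := by rw [𝓜.app_K, 𝓜.app_S, 𝓜.app_K]

theorem pow2_zero : pow2 (0 : 𝓜.C Ty.N) = 1 := 𝓜.rec_zero _ _

theorem pow2_succ (a : 𝓜.C Ty.N) : pow2 (𝓜.succ ⬝ a) = pow2 a + pow2 a := by
  change _ = 𝓜.adder ⬝ pow2 a ⬝ pow2 a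
  rw [pow2, 𝓜.rec_succ, ← pow2, 𝓜.app_K, 𝓜.app_S, 𝓜.app_S, 𝓜.app_K]

theorem succ_eq_add_one (a : 𝓜.C Ty.N) : 𝓜.succ ⬝ a = a + 1 :=
  ((add_succ a 0).trans (by rw [ACAModel.add_zero])).symm

protected theorem zero_add (a : 𝓜.C Ty.N) : 0 + a = a := by
  induction a using ACAModel.induction with
  | definable => infer_instance
  | zero => exact ACAModel.add_zero _
  | succ n ih => rw [add_succ, ih]

theorem succ_add (a b : 𝓜.C Ty.N) : 𝓜.succ ⬝ a + b = 𝓜.succ ⬝ (a + b) := by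
  induction b using ACAModel.induction with
  | definable => infer_instance
  | zero => exact (ACAModel.add_zero _).trans (congrArg _ (ACAModel.add_zero _).symm)
  | succ n ih => rw [add_succ, add_succ, ih]

protected theorem add_comm (a b : 𝓜.C Ty.N) : a + b = b + a := by
  induction b using ACAModel.induction with
  | definable => infer_instance
  | zero => exact (ACAModel.add_zero _).trans (ACAModel.zero_add _).symm
  | succ n ih => rw [add_succ, succ_add, ih]

protected theorem add_assoc (a b c : 𝓜.C Ty.N) : a + b + c = a + (b + c) := by
  induction c using ACAModel.induction with
  | definable => infer_instance
  | zero => exact (ACAModel.add_zero _).trans (congrArg _ (ACAModel.add_zero _).symm)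
  | succ n ih => rw [add_succ, add_succ, add_succ, ih]

protected theorem mul_add (a b c : 𝓜.C Ty.N) : a * (b + c) = a * b + a * c := by
  induction c using ACAModel.induction with
  | definable => infer_instance
  | zero =>
    change a * (b + 0) = a * b + a * 0
    rw [ACAModel.add_zero, ACAModel.mul_zero, ACAModel.add_zero]
  | succ n ih => rw [add_succ, mul_succ, mul_succ, ih, ACAModel.add_assoc]

protected theorem zero_mul (a : 𝓜.C Ty.N) : 0 * a = 0 := by
  induction a using ACAModel.induction with
  | definable => infer_instance
  | zero => exact ACAModel.mul_zero _
  | succ n ih => rw [mul_succ, ih, ACAModel.add_zero]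

theorem succ_mul (a b : 𝓜.C Ty.N) : 𝓜.succ ⬝ a * b = a * b + b := by
  induction b using ACAModel.induction with
  | definable => infer_instance
  | zero =>
    change _ * 0 = a * 0 + 0
    rw [ACAModel.mul_zero, ACAModel.mul_zero, ACAModel.add_zero]
  | succ n ih =>
    rw [mul_succ, mul_succ, ih, add_succ, add_succ, ACAModel.add_assoc, ACAModel.add_assoc,
      ACAModel.add_comm n a]

protected theorem mul_comm (a b : 𝓜.C Ty.N) : a * b = b * a := by
  induction b using ACAModel.induction with
  | definable => infer_instance
  | zero => exact (ACAModel.mul_zero _).trans (ACAModel.zero_mul _).symm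
  | succ n ih => rw [mul_succ, succ_mul, ih]

protected theorem mul_assoc (a b c : 𝓜.C Ty.N) : a * b * c = a * (b * c) := by
  induction c using ACAModel.induction with
  | definable => infer_instance
  | zero =>
    change a * b * 0 = a * (b * 0)
    rw [ACAModel.mul_zero, ACAModel.mul_zero, ACAModel.mul_zero]
  | succ n ih => rw [mul_succ, mul_succ, ACAModel.mul_add, ih]

protected theorem mul_one (a : 𝓜.C Ty.N) : a * 1 = a :=
  (mul_succ a 0).trans (by rw [ACAModel.mul_zero, ACAModel.zero_add])

instance : CommSemiring (𝓜.C Ty.N) where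
  add_assoc := ACAModel.add_assoc
  zero_add := ACAModel.zero_add
  add_zero := ACAModel.add_zero
  add_comm := ACAModel.add_comm
  nsmul := nsmulRec
  left_distrib := ACAModel.mul_add
  right_distrib a b c := by
    rw [ACAModel.mul_comm, ACAModel.mul_add, ACAModel.mul_comm c a, ACAModel.mul_comm c b]
  zero_mul := ACAModel.zero_mul
  mul_zero := ACAModel.mul_zero
  mul_assoc := ACAModel.mul_assoc
  one_mul a := (ACAModel.mul_comm 1 a).trans (ACAModel.mul_one a)
  mul_one := ACAModel.mul_one
  mul_comm := ACAModel.mul_comm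

theorem pow2_add_one (a : 𝓜.C Ty.N) : pow2 (a + 1) = 2 * pow2 a := by
  rw [← succ_eq_add_one, pow2_succ, two_mul]

theorem add_one_induction (P : 𝓜.C Ty.N → Prop)
    (definable : DefinablePred 𝓜 fun p : Unit × 𝓜.C Ty.N => P p.2)
    (zero : P 0) (add_one : ∀ n, P n → P (n + 1)) (n : 𝓜.C Ty.N) : P n :=
  ACAModel.induction P definable zero (fun m hm => succ_eq_add_one m ▸ add_one m hm) n

theorem eq_zero_or_exists_add_one (n : 𝓜.C Ty.N) : n = 0 ∨ ∃ m, n = m + 1 :=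
  (𝓜.eq_zero_or_exists_succ n).imp_right fun ⟨m, h⟩ => ⟨m, h.trans (succ_eq_add_one m)⟩

theorem add_one_ne_zero (n : 𝓜.C Ty.N) : n + 1 ≠ 0 := succ_eq_add_one n ▸ 𝓜.succ_ne_zero n

theorem add_one_injective : Function.Injective fun n : 𝓜.C Ty.N => n + 1 := fun m n h => by
  simp only [← succ_eq_add_one] at h
  exact 𝓜.succ_inj _ _ h

instance : IsRightCancelAdd (𝓜.C Ty.N) where
  add_right_cancel c a b := by
    induction c using add_one_induction with
    | definable => infer_instance
    | zero => simp only [_root_.add_zero, imp_self]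
    | add_one n ih =>
      intro h
      simp only [← _root_.add_assoc] at h
      exact ih (add_one_injective h)

instance : IsCancelAdd (𝓜.C Ty.N) := AddCommMagma.IsRightCancelAdd.toIsCancelAdd _

theorem eq_zero_of_add_eq_zero {a b : 𝓜.C Ty.N} (h : a + b = 0) : b = 0 := by
  obtain hzero | ⟨m, rfl⟩ := eq_zero_or_exists_add_one b
  · exact hzero
  · rw [← _root_.add_assoc] at h
    exact absurd h (add_one_ne_zero _)

theorem exists_add_eq_or_exists_add_eq (a b : 𝓜.C Ty.N) : (∃ u, a + u = b) ∨ ∃ u, b + u = a := by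
  induction a using add_one_induction with
  | definable => infer_instance
  | zero => exact .inl ⟨b, _root_.zero_add b⟩
  | add_one n ih =>
    obtain ⟨u, rfl⟩ | ⟨u, rfl⟩ := ih
    · obtain rfl | ⟨m, rfl⟩ := eq_zero_or_exists_add_one u
      · exact .inr ⟨1, by ring⟩
      · exact .inl ⟨m, by ring⟩
    · exact .inr ⟨u + 1, by ring⟩

noncomputable instance : LinearOrder (𝓜.C Ty.N) where
  le a b := ∃ u, a + u = b
  le_refl a := ⟨0, _root_.add_zero a⟩
  le_trans := by
    rintro a _ _ ⟨u, rfl⟩ ⟨v, rfl⟩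
    exact ⟨u + v, by ring⟩
  le_antisymm := by
    rintro a _ ⟨u, rfl⟩ ⟨v, h⟩
    have huv : v + u = 0 :=
      add_left_cancel (a := a) (by rw [_root_.add_zero, _root_.add_comm v, ← _root_.add_assoc, h])
    rw [eq_zero_of_add_eq_zero huv, _root_.add_zero]
  le_total := exists_add_eq_or_exists_add_eq
  toDecidableLE := Classical.decRel _

theorem le_iff_exists_add_eq {a b : 𝓜.C Ty.N} : a ≤ b ↔ ∃ u, a + u = b := Iff.rfl

instance : CanonicallyOrderedAdd (𝓜.C Ty.N) where
  exists_add_of_le := fun ⟨u, hu⟩ => ⟨u, hu.symm⟩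
  le_add_self a b := ⟨b, _root_.add_comm a b⟩
  le_self_add _ b := ⟨b, rfl⟩

protected theorem add_one_le_iff {a b : 𝓜.C Ty.N} : a + 1 ≤ b ↔ a < b := by
  constructor
  · rintro ⟨u, rfl⟩
    refine lt_of_le_of_ne ⟨1 + u, by ring⟩ fun h => add_one_ne_zero u ?_
    exact left_eq_add.1 (h.trans (by ring : a + 1 + u = a + (u + 1)))
  · rintro h
    obtain ⟨u, rfl⟩ := h.le
    obtain rfl | ⟨m, rfl⟩ := eq_zero_or_exists_add_one u
    · exact absurd h (by rw [_root_.add_zero]; exact lt_irrefl a)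
    · exact ⟨m, by ring⟩

theorem mul_lt_mul_of_pos {a b c : 𝓜.C Ty.N} (ha : 0 < a) (h : b < c) : a * b < a * c := by
  obtain ⟨u, rfl⟩ := ACAModel.add_one_le_iff.2 ha
  obtain ⟨v, rfl⟩ := ACAModel.add_one_le_iff.2 h
  exact ACAModel.add_one_le_iff.1 ⟨u + v + u * v, by ring⟩

instance : IsStrictOrderedRing (𝓜.C Ty.N) where
  add_le_add_left := by
    rintro a _ ⟨u, rfl⟩ c
    exact ⟨u, by ring⟩
  le_of_add_le_add_left := by
    rintro a b c ⟨u, hu⟩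
    exact ⟨u, add_left_cancel ((_root_.add_assoc a b u).symm.trans hu)⟩
  zero_le_one := ⟨1, _root_.zero_add 1⟩
  exists_pair_ne := ⟨0, 1, 𝓜.one_ne_zero.symm⟩
  mul_lt_mul_of_pos_left _ ha _ _ h := mul_lt_mul_of_pos ha h
  mul_lt_mul_of_pos_right a ha b c h := by
    simpa only [_root_.mul_comm _ a] using mul_lt_mul_of_pos ha h

end ACAModel

namespace DefinablePred

variable {𝓜 : ACAModel} {X : Type} [Context 𝓜 X] (a b : X → 𝓜.C Ty.N) [Definable a] [Definable b]

instance le : DefinablePred 𝓜 fun x => a x ≤ b x :=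
  comp₂ (P := fun a b => a ≤ b) (inferInstanceAs
    (DefinablePred 𝓜 fun p : (Unit × 𝓜.C Ty.N) × 𝓜.C Ty.N => ∃ u, p.1.2 + u = p.2)) a b

instance lt : DefinablePred 𝓜 fun x => a x < b x :=
  congr (P := fun x => a x + 1 ≤ b x) inferInstance fun _ => ACAModel.add_one_le_iff

end DefinablePred

namespace ACAModel

variable {𝓜 : ACAModel}

theorem lt_pow2 (n : 𝓜.C Ty.N) : n < pow2 n := by
  induction n using add_one_induction with
  | definable => infer_instance
  | zero => rw [pow2_zero]; exact one_pos
  | add_one n ih =>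
    rw [pow2_add_one, two_mul]
    exact (ACAModel.add_one_le_iff.2 ih).trans_lt (lt_add_of_pos_left _ (zero_le.trans_lt ih))

theorem exists_bound (f : 𝓜.C Ty.one) (n : 𝓜.C Ty.N) : ∃ B, ∀ i, i ≤ n → f ⬝ i ≤ B := by
  induction n using add_one_induction with
  | definable => infer_instance
  | zero => exact ⟨f ⬝ 0, fun i hi => by rw [le_antisymm hi zero_le]⟩
  | add_one n ih =>
    obtain ⟨B, hB⟩ := ih
    refine ⟨max B (f ⬝ (n + 1)), fun i hi => ?_⟩
    obtain hlt | rfl := hi.lt_or_eq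
    · exact (hB i (le_of_add_le_add_right (ACAModel.add_one_le_iff.2 hlt))).trans
        (le_max_left _ _)
    · exact le_max_right _ _

end ACAModel

/-! ### The ordered field of fractions of a semiring -/

section Differences

variable (N : Type*) [CommSemiring N] [IsCancelAdd N]

/-- The congruence `a + d = c + b` on formal differences `a - b` and `c - d`. A difference
is encoded as an element `a + b ω` with `ω ^ 2 = 1`, so that differences multiply as expected. -/
def differenceCon : RingCon (QuadraticAlgebra N 1 0) where
  r x y := x.re + y.im = y.re + x.im
  iseqv := by
    refine ⟨fun _ => rfl, fun h => h.symm, fun {x y z} hxy hyz => ?_⟩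
    apply add_right_cancel (b := y.re + y.im)
    calc x.re + z.im + (y.re + y.im) = (x.re + y.im) + (y.re + z.im) := by ring
      _ = (y.re + x.im) + (z.re + y.im) := by rw [hxy, hyz]
      _ = _ := by ring
  add' {w x y z} hwx hyz := by
    simp only [QuadraticAlgebra.re_add, QuadraticAlgebra.im_add]
    calc w.re + y.re + (x.im + z.im) = (w.re + x.im) + (y.re + z.im) := by ring
      _ = (x.re + w.im) + (z.re + y.im) := by rw [hwx, hyz]
      _ = _ := by ring
  mul' {w x y z} hwx hyz := by
    simp only [QuadraticAlgebra.re_mul, QuadraticAlgebra.im_mul, one_mul, zero_mul, add_zero]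
    apply add_right_cancel (b := x.re * y.im + x.im * y.re + x.re * y.re + x.im * y.im)
    calc _ = (w.re + x.im) * y.re + (x.re + w.im) * y.im + x.re * (y.re + z.im)
          + x.im * (z.re + y.im) := by ring
      _ = (x.re + w.im) * y.re + (w.re + x.im) * y.im + x.re * (z.re + y.im)
          + x.im * (y.re + z.im) := by rw [hwx, hyz]
      _ = _ := by ring

/-- The ring of differences of elements of a cancellative semiring. -/
abbrev DifferenceRing : Type _ := (differenceCon N).Quotient

namespace DifferenceRing

instance : Neg (DifferenceRing N) :=
  ⟨Quotient.map (fun x => ⟨x.im, x.re⟩) fun x y h => by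
    change x.im + y.re = y.im + x.re
    rw [add_comm, add_comm y.im]
    exact (show x.re + y.im = y.re + x.im from h).symm⟩

noncomputable instance : CommRing (DifferenceRing N) where
  zsmul := zsmulRec
  neg_add_cancel x := by
    induction x using Quotient.inductionOn with
    | h x =>
      refine Quotient.sound (s := (differenceCon N).toSetoid) ?_
      change (x.im + x.re) + 0 = 0 + (x.re + x.im)
      ring

/-- The embedding of the semiring into its ring of differences. -/
def of : N →+* DifferenceRing N :=
  (differenceCon N).mk'.comp (algebraMap N (QuadraticAlgebra N 1 0))

theorem of_injective : Function.Injective (of N) := fun a b h => by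
  have hab : a + 0 = b + 0 := (RingCon.eq _).1 h
  simpa only [add_zero] using hab

variable {N}

theorem exists_eq_of_sub_of (x : DifferenceRing N) : ∃ a b, x = of N a - of N b := by
  induction x using Quotient.inductionOn with
  | h x =>
    refine ⟨x.re, x.im, ?_⟩
    rw [sub_eq_add_neg]
    refine Quotient.sound (s := (differenceCon N).toSetoid) ?_
    change x.re + (0 + x.im) = (x.re + 0) + x.im
    ring

variable [LinearOrder N] [CanonicallyOrderedAdd N]

theorem exists_eq_of_or_eq_neg_of (x : DifferenceRing N) : ∃ u, x = of N u ∨ x = -of N u := by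
  obtain ⟨a, b, rfl⟩ := exists_eq_of_sub_of x
  obtain h | h := le_total a b
  · obtain ⟨u, rfl⟩ := le_iff_exists_add.1 h
    exact ⟨u, .inr (by rw [map_add]; ring)⟩
  · obtain ⟨u, rfl⟩ := le_iff_exists_add.1 h
    exact ⟨u, .inl (by rw [map_add]; ring)⟩

instance [Nontrivial N] : Nontrivial (DifferenceRing N) := (of_injective N).nontrivial

instance [NoZeroDivisors N] : NoZeroDivisors (DifferenceRing N) where
  eq_zero_or_eq_zero_of_mul_eq_zero {x y} hxy := by
    obtain ⟨u, hu⟩ := exists_eq_of_or_eq_neg_of x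
    obtain ⟨v, hv⟩ := exists_eq_of_or_eq_neg_of y
    have huv : of N (u * v) = of N 0 := by
      rw [map_mul, map_zero]
      obtain rfl | rfl := hu <;> obtain rfl | rfl := hv <;>
        simpa only [neg_mul, mul_neg, neg_neg, neg_eq_zero] using hxy
    obtain rfl | rfl := mul_eq_zero.1 (of_injective N huv)
    · left; simpa only [map_zero, neg_zero, or_self] using hu
    · right; simpa only [map_zero, neg_zero, or_self] using hv

instance [Nontrivial N] [NoZeroDivisors N] : IsDomain (DifferenceRing N) :=
  NoZeroDivisors.to_isDomain _

end DifferenceRing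

end Differences

/-- The cone of the quotients of elements of `N`, in a field into which `N` embeds. -/
def quotientCone {N F : Type*} [CommSemiring N] [PartialOrder N] [CanonicallyOrderedAdd N]
    [NoZeroDivisors N] [Field F] (j : N →+* F) (hj : Function.Injective j) : RingCone F where
  carrier := {x | ∃ u d, j d ≠ 0 ∧ x = j u / j d}
  zero_mem' := ⟨0, 1, by simp⟩
  one_mem' := ⟨1, 1, by simp⟩
  add_mem' := by
    rintro _ _ ⟨u, d, hd, rfl⟩ ⟨v, e, he, rfl⟩
    refine ⟨u * e + v * d, d * e, ?_, ?_⟩ <;> simp only [map_mul, map_add]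
    · exact mul_ne_zero hd he
    · field_simp
  mul_mem' := by
    rintro _ _ ⟨u, d, hd, rfl⟩ ⟨v, e, he, rfl⟩
    refine ⟨u * v, d * e, ?_, ?_⟩ <;> simp only [map_mul]
    · exact mul_ne_zero hd he
    · field_simp
  eq_zero_of_mem_of_neg_mem' := by
    rintro _ ⟨u, d, hd, rfl⟩ ⟨v, e, he, hneg⟩
    have hsum : j (u * e + v * d) = j 0 := by
      rw [map_add, map_mul, map_mul, map_zero]
      field_simp at hneg
      linear_combination -hneg
    have hue : u * e = 0 := le_antisymm (hj hsum ▸ le_self_add) zero_le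
    obtain rfl | rfl := mul_eq_zero.1 hue
    · rw [map_zero, zero_div]
    · exact absurd (map_zero j) he

section Fractions

variable (N : Type*) [CommSemiring N] [IsCancelAdd N] [LinearOrder N] [CanonicallyOrderedAdd N]
  [NoZeroDivisors N] [Nontrivial N]

/-- The field of fractions of the ring of differences of a canonically ordered semiring, ordered so
that the quotients of elements of the semiring are its nonnegative elements. -/
def FractionField : Type _ := FractionRing (DifferenceRing N)

namespace FractionField

noncomputable instance : Field (FractionField N) :=
  inferInstanceAs (Field (FractionRing (DifferenceRing N)))

/-- The embedding of the semiring into its field of fractions. -/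
noncomputable def of : N →+* FractionField N :=
  (algebraMap (DifferenceRing N) (FractionRing (DifferenceRing N))).comp (DifferenceRing.of N)

theorem of_injective : Function.Injective (of N) :=
  (IsFractionRing.injective (DifferenceRing N) (FractionRing (DifferenceRing N))).comp
    (DifferenceRing.of_injective N)

variable {N}

theorem eq_of_div_of_or_eq_neg (x : FractionField N) :
    ∃ u d, of N d ≠ 0 ∧ (x = of N u / of N d ∨ x = -(of N u / of N d)) := by
  obtain ⟨r, s, hs, rfl⟩ := IsFractionRing.div_surjective (A := DifferenceRing N)
    (K := FractionRing (DifferenceRing N)) x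
  have hs_ne := IsFractionRing.to_map_ne_zero_of_mem_nonZeroDivisors
    (K := FractionRing (DifferenceRing N)) hs
  obtain ⟨u, hu⟩ := DifferenceRing.exists_eq_of_or_eq_neg_of r
  obtain ⟨d, rfl | rfl⟩ := DifferenceRing.exists_eq_of_or_eq_neg_of s
  · refine ⟨u, d, hs_ne, hu.imp ?_ ?_⟩ <;> rintro rfl
    · rfl
    · rw [map_neg, neg_div]; rfl
  · rw [map_neg] at hs_ne ⊢
    refine ⟨u, d, neg_ne_zero.1 hs_ne, hu.symm.imp ?_ ?_⟩ <;> rintro rfl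
    · rw [map_neg, neg_div_neg_eq]; rfl
    · rw [div_neg]; rfl

instance : HasMemOrNegMem (quotientCone (of N) (of_injective N)) where
  mem_or_neg_mem x := by
    obtain ⟨u, d, hd, h | h⟩ := eq_of_div_of_or_eq_neg x
    · exact .inl ⟨u, d, hd, h⟩
    · exact .inr ⟨u, d, hd, by rw [h, neg_neg]⟩

open Classical in
noncomputable instance : LinearOrder (FractionField N) :=
  .mkOfAddGroupCone (quotientCone (of N) (of_injective N))

instance : IsOrderedRing (FractionField N) :=
  .mkOfCone (quotientCone (of N) (of_injective N))

instance : IsStrictOrderedRing (FractionField N) := IsOrderedRing.toIsStrictOrderedRing _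

theorem of_strictMono : StrictMono (of N) := by
  refine Monotone.strictMono_of_injective (fun a b h => ?_) (of_injective N)
  obtain ⟨u, rfl⟩ := le_iff_exists_add.1 h
  exact ⟨u, 1, by simp, by simp⟩

theorem exists_eq_div (x : FractionField N) :
    ∃ a b d, d ≠ 0 ∧ x = (of N a - of N b) / of N d := by
  obtain ⟨u, d, hd, h | h⟩ := eq_of_div_of_or_eq_neg x
  · exact ⟨u, 0, d, ne_zero_of_map hd, by rw [h, map_zero, sub_zero]⟩
  · exact ⟨0, u, d, ne_zero_of_map hd, by rw [h, map_zero, zero_sub, neg_div]⟩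

end FractionField

end Fractions

/-! ### Rational numbers in a model -/

namespace ACAModel

variable {𝓜 : ACAModel}

/-- The ordered field of rational numbers of the model. -/
abbrev Q (𝓜 : ACAModel) : Type := FractionField (𝓜.C Ty.N)

/-- The embedding of the natural numbers of the model into its rational numbers. -/
noncomputable abbrev toQ (𝓜 : ACAModel) : 𝓜.C Ty.N →+* 𝓜.Q := FractionField.of (𝓜.C Ty.N)

theorem toQ_le_toQ {a b : 𝓜.C Ty.N} : 𝓜.toQ a ≤ 𝓜.toQ b ↔ a ≤ b :=
  FractionField.of_strictMono.le_iff_le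

theorem toQ_lt_toQ {a b : 𝓜.C Ty.N} : 𝓜.toQ a < 𝓜.toQ b ↔ a < b :=
  FractionField.of_strictMono.lt_iff_lt

theorem toQ_nonneg (a : 𝓜.C Ty.N) : 0 ≤ 𝓜.toQ a := by
  rw [← map_zero 𝓜.toQ]
  exact toQ_le_toQ.2 zero_le

theorem toQ_pos {a : 𝓜.C Ty.N} (h : a ≠ 0) : 0 < 𝓜.toQ a := by
  rw [← map_zero 𝓜.toQ]
  exact toQ_lt_toQ.2 (pos_iff_ne_zero.2 h)

theorem one_le_toQ {a : 𝓜.C Ty.N} (h : a ≠ 0) : 1 ≤ 𝓜.toQ a := by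
  rw [← map_one 𝓜.toQ, toQ_le_toQ, ← _root_.zero_add 1]
  exact ACAModel.add_one_le_iff.2 (pos_iff_ne_zero.2 h)

theorem pow2_ne_zero (n : 𝓜.C Ty.N) : pow2 n ≠ 0 := (zero_le.trans_lt (lt_pow2 n)).ne'

/-- `2 ^ (-n)`. -/
noncomputable def halfPow (n : 𝓜.C Ty.N) : 𝓜.Q := (𝓜.toQ (pow2 n))⁻¹

theorem halfPow_pos (n : 𝓜.C Ty.N) : 0 < halfPow n := inv_pos.2 (toQ_pos (pow2_ne_zero n))

theorem halfPow_zero : halfPow (0 : 𝓜.C Ty.N) = 1 := by rw [halfPow, pow2_zero, map_one, inv_one]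

theorem two_mul_halfPow_add_one (n : 𝓜.C Ty.N) : 2 * halfPow (n + 1) = halfPow n := by
  have := (toQ_pos (pow2_ne_zero n)).ne'
  rw [halfPow, halfPow, pow2_add_one, map_mul, map_ofNat]
  field_simp

theorem halfPow_add_le (n i : 𝓜.C Ty.N) : halfPow (n + i) ≤ halfPow n := by
  rw [halfPow, halfPow, inv_le_inv₀ (toQ_pos (pow2_ne_zero _)) (toQ_pos (pow2_ne_zero _)),
    toQ_le_toQ]
  induction i using add_one_induction with
  | definable => infer_instance
  | zero => rw [_root_.add_zero]
  | add_one i ih =>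
    rw [← _root_.add_assoc, pow2_add_one, two_mul]
    exact ih.trans le_self_add

theorem halfPow_antitone : Antitone (halfPow : 𝓜.C Ty.N → 𝓜.Q) := by
  rintro m _ ⟨i, rfl⟩
  exact halfPow_add_le m i

theorem exists_halfPow_lt {ε : 𝓜.Q} (hε : 0 < ε) : ∃ n : 𝓜.C Ty.N, halfPow n < ε := by
  obtain ⟨a, b, d, hd, h⟩ := FractionField.exists_eq_div ε⁻¹
  refine ⟨a, (inv_lt_comm₀ hε (toQ_pos (pow2_ne_zero _))).1 ?_⟩
  have hd_one : 1 ≤ 𝓜.toQ d := one_le_toQ hd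
  rw [h]
  calc (𝓜.toQ a - 𝓜.toQ b) / 𝓜.toQ d ≤ 𝓜.toQ a := by
        rw [div_le_iff₀ (toQ_pos hd)]
        nlinarith [toQ_nonneg b, toQ_nonneg a]
    _ < 𝓜.toQ (pow2 a) := toQ_lt_toQ.2 (lt_pow2 a)

/-- `c` is the code `(a + b) (a + b + 1) / 2 + b` of the pair `(a, b)`; this is `isPair`. -/
def PairCode (c a b : 𝓜.C Ty.N) : Prop := c + c = (a + b) * (a + b + 1) + (b + b)

theorem exists_add_self_eq_mul_add_one (s : 𝓜.C Ty.N) : ∃ t, t + t = s * (s + 1) := by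
  induction s using add_one_induction with
  | definable => infer_instance
  | zero => exact ⟨0, by ring⟩
  | add_one s ih =>
    obtain ⟨t, ht⟩ := ih
    refine ⟨t + s + 1, ?_⟩
    calc t + s + 1 + (t + s + 1) = (t + t) + 2 * s + 2 := by ring
      _ = _ := by rw [ht]; ring

theorem exists_pairCode (a b : 𝓜.C Ty.N) : ∃ c, PairCode c a b := by
  obtain ⟨t, ht⟩ := exists_add_self_eq_mul_add_one (a + b)
  refine ⟨t + b, ?_⟩
  rw [PairCode, ← ht]
  ring

theorem exists_pairCode_eq (c : 𝓜.C Ty.N) : ∃ a b, PairCode c a b := by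
  induction c using add_one_induction with
  | definable => unfold PairCode; infer_instance
  | zero => exact ⟨0, 0, by rw [PairCode]; ring⟩
  | add_one c ih =>
    obtain ⟨a, b, h⟩ := ih
    rw [PairCode] at h
    have hc : c + 1 + (c + 1) = (c + c) + 2 := by ring
    obtain rfl | ⟨a, rfl⟩ := eq_zero_or_exists_add_one a
    · exact ⟨b + 1, 0, by rw [PairCode, hc, h]; ring⟩
    · exact ⟨a, b + 1, by rw [PairCode, hc, h]; ring⟩

theorem PairCode.add_le {c a b a' b' : 𝓜.C Ty.N} (h : PairCode c a b) (h' : PairCode c a' b') :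
    a' + b' ≤ a + b := by
  by_contra! hlt
  have hle : a + b + 1 ≤ a' + b' := ACAModel.add_one_le_iff.2 hlt
  refine lt_irrefl (c + c) ?_
  calc c + c = (a + b) * (a + b + 1) + (b + b) := h
    _ ≤ (a + b) * (a + b + 1) + ((a + b) + (a + b)) := by gcongr <;> exact le_add_self
    _ < (a + b) * (a + b + 1) + ((a + b) + (a + b)) + 2 := lt_add_of_pos_right _ two_pos
    _ = (a + b + 1) * (a + b + 1 + 1) := by ring
    _ ≤ (a' + b') * (a' + b' + 1) := by gcongr
    _ ≤ c + c := h' ▸ le_self_add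

theorem PairCode.unique {c a b a' b' : 𝓜.C Ty.N} (h : PairCode c a b) (h' : PairCode c a' b') :
    a = a' ∧ b = b' := by
  have hsum : a + b = a' + b' := le_antisymm (h'.add_le h) (h.add_le h')
  have hdouble : b + b = b' + b' := by
    have hcode := h.symm.trans h'
    rw [hsum] at hcode
    exact add_left_cancel hcode
  obtain rfl : b = b' := by
    rw [← two_mul, ← two_mul] at hdouble
    exact mul_left_cancel₀ two_ne_zero hdouble
  exact ⟨add_right_cancel hsum, rfl⟩

/-- `q` codes the rational number `(a - b) / (d + 1)`; this is `isRat`. -/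
def RatCode (q a b d : 𝓜.C Ty.N) : Prop := ∃ p, PairCode p a b ∧ PairCode q p d

theorem exists_ratCode (a b d : 𝓜.C Ty.N) : ∃ q, RatCode q a b d := by
  obtain ⟨p, hp⟩ := exists_pairCode a b
  obtain ⟨q, hq⟩ := exists_pairCode p d
  exact ⟨q, p, hp, hq⟩

theorem exists_ratCode_eq (q : 𝓜.C Ty.N) : ∃ a b d, RatCode q a b d := by
  obtain ⟨p, d, hq⟩ := exists_pairCode_eq q
  obtain ⟨a, b, hp⟩ := exists_pairCode_eq p
  exact ⟨a, b, d, p, hp, hq⟩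

theorem RatCode.unique {q a b d a' b' d' : 𝓜.C Ty.N} (h : RatCode q a b d)
    (h' : RatCode q a' b' d') : a = a' ∧ b = b' ∧ d = d' := by
  obtain ⟨p, hp, hq⟩ := h
  obtain ⟨p', hp', hq'⟩ := h'
  obtain ⟨rfl, rfl⟩ := hq.unique hq'
  obtain ⟨rfl, rfl⟩ := hp.unique hp'
  exact ⟨rfl, rfl, rfl⟩

theorem exists_forall_ratCode (q : 𝓜.C Ty.N) :
    ∃ x : 𝓜.Q, ∀ a b d, RatCode q a b d → x = (𝓜.toQ a - 𝓜.toQ b) / (𝓜.toQ d + 1) := by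
  obtain ⟨a, b, d, h⟩ := exists_ratCode_eq q
  refine ⟨(𝓜.toQ a - 𝓜.toQ b) / (𝓜.toQ d + 1), fun a' b' d' h' => ?_⟩
  obtain ⟨rfl, rfl, rfl⟩ := h.unique h'
  rfl

/-- The rational number coded by `q`. -/
noncomputable def rat (q : 𝓜.C Ty.N) : 𝓜.Q := (exists_forall_ratCode q).choose

theorem RatCode.rat_eq {q a b d : 𝓜.C Ty.N} (h : RatCode q a b d) :
    rat q = (𝓜.toQ a - 𝓜.toQ b) / (𝓜.toQ d + 1) :=
  (exists_forall_ratCode q).choose_spec a b d h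

theorem rat_surjective : Function.Surjective (rat : 𝓜.C Ty.N → 𝓜.Q) := fun x => by
  obtain ⟨a, b, d, hd, rfl⟩ := FractionField.exists_eq_div x
  obtain ⟨d, rfl⟩ := (eq_zero_or_exists_add_one d).resolve_left hd
  obtain ⟨q, hq⟩ := exists_ratCode a b d
  exact ⟨q, by rw [hq.rat_eq, map_add, map_one]⟩

theorem rat_zero : rat (0 : 𝓜.C Ty.N) = 0 := by
  have hcode : RatCode (0 : 𝓜.C Ty.N) 0 0 0 := ⟨0, by rw [PairCode]; ring, by rw [PairCode]; ring⟩
  rw [hcode.rat_eq, sub_self, zero_div]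

theorem rat_one : rat (1 : 𝓜.C Ty.N) = 1 := by
  have hcode : RatCode (1 : 𝓜.C Ty.N) 1 0 0 := ⟨1, by rw [PairCode]; ring, by rw [PairCode]; ring⟩
  rw [hcode.rat_eq, map_zero, map_one, sub_zero, _root_.zero_add, div_one]

end ACAModel

/-! ### Definable functions with rational values -/

section DefinableRat

open ACAModel

variable {𝓜 : ACAModel} {X : Type} [Context 𝓜 X]

/-- `f` is a quotient of differences of definable functions. -/
class DefinableRat (f : X → 𝓜.Q) : Prop where
  exists_quotient : ∃ a b d : X → 𝓜.C Ty.N, Definable a ∧ Definable b ∧ Definable d ∧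
    ∀ x, d x ≠ 0 ∧ f x = (𝓜.toQ (a x) - 𝓜.toQ (b x)) / 𝓜.toQ (d x)

namespace DefinableRat

instance const (c : 𝓜.Q) : DefinableRat fun _ : X => c := by
  obtain ⟨a, b, d, h⟩ := FractionField.exists_eq_div c
  exact ⟨fun _ => a, fun _ => b, fun _ => d, inferInstance, inferInstance, inferInstance,
    fun _ => h⟩

instance toQ (a : X → 𝓜.C Ty.N) [Definable a] : DefinableRat fun x => 𝓜.toQ (a x) :=
  ⟨a, fun _ => 0, fun _ => 1, inferInstance, inferInstance, inferInstance,
    fun x => ⟨one_ne_zero, by rw [map_zero, map_one, sub_zero, div_one]⟩⟩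

instance halfPow (a : X → 𝓜.C Ty.N) [Definable a] : DefinableRat fun x => halfPow (a x) :=
  ⟨fun _ => 1, fun _ => 0, fun x => pow2 (a x), inferInstance, inferInstance, inferInstance,
    fun x => ⟨pow2_ne_zero _, by simp [ACAModel.halfPow]⟩⟩

instance rat (a : X → 𝓜.C Ty.N) [Definable a] : DefinableRat fun x => rat (a x) := by
  obtain ⟨f, hf⟩ := Definable.exists_choice_element
    (fun (q a : 𝓜.C Ty.N) => ∃ b d, RatCode q a b d)
    (hP := by unfold RatCode PairCode; infer_instance)
  obtain ⟨g, hg⟩ := Definable.exists_choice_element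
    (fun (q b : 𝓜.C Ty.N) => ∃ a d, RatCode q a b d)
    (hP := by unfold RatCode PairCode; infer_instance)
  obtain ⟨h, hh⟩ := Definable.exists_choice_element
    (fun (q d : 𝓜.C Ty.N) => ∃ a b, RatCode q a b d)
    (hP := by unfold RatCode PairCode; infer_instance)
  refine ⟨fun x => f ⬝ a x, fun x => g ⬝ a x, fun x => h ⬝ a x + 1, inferInstance, inferInstance,
    inferInstance, fun x => ⟨add_one_ne_zero _, ?_⟩⟩
  obtain ⟨u, v, w, hcode⟩ := exists_ratCode_eq (a x)
  obtain ⟨_, _, hcode_f⟩ := hf _ ⟨u, v, w, hcode⟩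
  obtain ⟨_, _, hcode_g⟩ := hg _ ⟨v, u, w, hcode⟩
  obtain ⟨_, _, hcode_h⟩ := hh _ ⟨w, u, v, hcode⟩
  beta_reduce
  rw [hcode.rat_eq, (hcode_f.unique hcode).1, (hcode_g.unique hcode).2.1,
    (hcode_h.unique hcode).2.2, map_add, map_one]

theorem comp_fst {σ : Ty} {f : X → 𝓜.Q} (hf : DefinableRat f) :
    DefinableRat fun p : X × 𝓜.C σ => f p.1 := by
  obtain ⟨a, b, d, ha, hb, hd, hf⟩ := hf
  exact ⟨_, _, _, ha.comp_fst, hb.comp_fst, hd.comp_fst, fun p => hf p.1⟩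

variable (f g : X → 𝓜.Q) [hf : DefinableRat f] [hg : DefinableRat g]

instance add : DefinableRat fun x => f x + g x := by
  obtain ⟨a, b, d, ha, hb, hd, hfx⟩ := hf
  obtain ⟨a', b', d', ha', hb', hd', hgx⟩ := hg
  refine ⟨fun x => a x * d' x + a' x * d x, fun x => b x * d' x + b' x * d x,
    fun x => d x * d' x, inferInstance, inferInstance, inferInstance, fun x => ?_⟩
  have hdx := (toQ_pos (hfx x).1).ne'
  have hdx' := (toQ_pos (hgx x).1).ne'
  refine ⟨mul_ne_zero (hfx x).1 (hgx x).1, ?_⟩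
  rw [(hfx x).2, (hgx x).2]
  simp only [map_add, map_mul]
  field_simp
  ring

instance mul : DefinableRat fun x => f x * g x := by
  obtain ⟨a, b, d, ha, hb, hd, hfx⟩ := hf
  obtain ⟨a', b', d', ha', hb', hd', hgx⟩ := hg
  refine ⟨fun x => a x * a' x + b x * b' x, fun x => a x * b' x + b x * a' x,
    fun x => d x * d' x, inferInstance, inferInstance, inferInstance, fun x => ?_⟩
  have hdx := (toQ_pos (hfx x).1).ne'
  have hdx' := (toQ_pos (hgx x).1).ne'
  refine ⟨mul_ne_zero (hfx x).1 (hgx x).1, ?_⟩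
  rw [(hfx x).2, (hgx x).2]
  simp only [map_add, map_mul]
  field_simp
  ring

end DefinableRat

namespace DefinablePred

variable (f g : X → 𝓜.Q) [hf : DefinableRat f] [hg : DefinableRat g]

instance rat_le : DefinablePred 𝓜 fun x => f x ≤ g x := by
  obtain ⟨a, b, d, ha, hb, hd, hfx⟩ := hf
  obtain ⟨a', b', d', ha', hb', hd', hgx⟩ := hg
  refine congr (P := fun x => a x * d' x + b' x * d x ≤ a' x * d x + b x * d' x)
    inferInstance fun x => ?_
  rw [(hfx x).2, (hgx x).2, div_le_div_iff₀ (toQ_pos (hfx x).1) (toQ_pos (hgx x).1),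
    ← toQ_le_toQ]
  simp only [map_add, map_mul]
  constructor <;> intro h <;> linarith

instance rat_lt : DefinablePred 𝓜 fun x => f x < g x :=
  congr (P := fun x => ¬ g x ≤ f x) inferInstance fun _ => not_le

instance rat_eq : DefinablePred 𝓜 fun x => f x = g x :=
  congr (P := fun x => f x ≤ g x ∧ g x ≤ f x) inferInstance fun _ => le_antisymm_iff.symm

end DefinablePred

end DefinableRat

/-! ### Truth of formulas about real numbers -/

namespace ACAModel

variable {𝓜 : ACAModel}

/-- `x` is a real number of the model; this is `isReal`. -/
def IsReal (x : 𝓜.C Ty.one) : Prop :=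
  ∀ n i, rat (x ⬝ n) < rat (x ⬝ (n + i)) + halfPow n ∧
    rat (x ⬝ (n + i)) < rat (x ⬝ n) + halfPow n

/-- Equality of real numbers of the model; this is `eqR`. -/
def EqR (x y : 𝓜.C Ty.one) : Prop :=
  ∀ n, rat (x ⬝ n) ≤ rat (y ⬝ n) + 2 * halfPow n ∧ rat (y ⬝ n) ≤ rat (x ⬝ n) + 2 * halfPow n

/-- The strict order of the real numbers of the model; this is `ltR`. -/
def LtR (x y : 𝓜.C Ty.one) : Prop := ∃ n, rat (x ⬝ n) + 2 * halfPow n < rat (y ⬝ n)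

/-- `x < y + z` for real numbers of the model; this is `ltAddR`. -/
def LtAddR (x y z : 𝓜.C Ty.one) : Prop :=
  ∃ n, rat (x ⬝ n) + 4 * halfPow n < rat (y ⬝ n) + rat (z ⬝ n)

/-- `x` lies in the open ball with centre `y` and radius `z`; this is `inBall`. -/
def InBall (x y z : 𝓜.C Ty.one) : Prop := LtAddR x y z ∧ LtAddR y x z

/-- The rational number coded by `q` as a real number, namely the constant sequence. -/
def constReal (q : 𝓜.C Ty.N) : 𝓜.C Ty.one := 𝓜.K _ _ ⬝ q

/-- `x` lies in the unit interval of the model; this is `inUnit`. -/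
def InUnit (x : 𝓜.C Ty.one) : Prop :=
  IsReal x ∧ ¬ LtR x (constReal 0) ∧ ¬ LtR (constReal 1) x

section Definability

variable {X : Type} [Context 𝓜 X] (x y : X → 𝓜.C Ty.one) [Definable x] [Definable y]

instance : DefinablePred 𝓜 fun p => IsReal (x p) :=
  DefinablePred.comp (P := IsReal) (by unfold IsReal; infer_instance) x

instance : DefinablePred 𝓜 fun p => EqR (x p) (y p) :=
  DefinablePred.comp₂ (P := EqR) (by unfold EqR; infer_instance) x y

instance : DefinablePred 𝓜 fun p => LtR (x p) (y p) :=
  DefinablePred.comp₂ (P := LtR) (by unfold LtR; infer_instance) x y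

instance (a : X → 𝓜.C Ty.N) [Definable a] : Definable fun p => constReal (a p) := by
  unfold constReal
  infer_instance

instance : DefinablePred 𝓜 fun p => InUnit (x p) := by
  unfold InUnit
  infer_instance

end Definability

section Sat

variable {V : Ty → Type} (ρ : 𝓜.Assign V)

@[simp] theorem eval_S1 (t : Tm V Ty.N) : t.S1.eval ρ = t.eval ρ + 1 := succ_eq_add_one _

@[simp] theorem eval_add (s t : Tm V Ty.N) : (s +ₒ t).eval ρ = s.eval ρ + t.eval ρ := rfl

@[simp] theorem eval_mul (s t : Tm V Ty.N) : (s *ₒ t).eval ρ = s.eval ρ * t.eval ρ := rfl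

@[simp] theorem eval_pow2 (t : Tm V Ty.N) : t.pow2.eval ρ = pow2 (t.eval ρ) := rfl

@[simp] theorem eval_zero : (Tm.zero : Tm V _).eval ρ = (0 : 𝓜.C Ty.N) := rfl

@[simp] theorem eval_n1 : (Tm.n1 : Tm V _).eval ρ = (1 : 𝓜.C Ty.N) := rfl

@[simp] theorem eval_n2 : (Tm.n2 : Tm V _).eval ρ = (2 : 𝓜.C Ty.N) := by
  rw [Tm.n2, eval_S1, eval_n1, one_add_one_eq_two]

@[simp] theorem eval_n4 : (Tm.n4 : Tm V _).eval ρ = (4 : 𝓜.C Ty.N) := by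
  rw [Tm.n4, eval_S1, eval_S1, eval_n2]
  norm_num

@[simp] theorem eval_zeroR : (zeroR : Tm V _).eval ρ = constReal (0 : 𝓜.C Ty.N) := rfl

@[simp] theorem eval_oneR : (oneR : Tm V _).eval ρ = constReal (1 : 𝓜.C Ty.N) := rfl

@[simp] theorem sat_leN (s t : Tm V Ty.N) : (leN s t).Sat ρ ↔ s.eval ρ ≤ t.eval ρ := by
  simp only [leN, sat_exB, Fm.sat_eq, eval_add, Tm.eval_wk, Tm.eval_new, le_iff_exists_add_eq]

@[simp] theorem sat_ltN (s t : Tm V Ty.N) : (ltN s t).Sat ρ ↔ s.eval ρ < t.eval ρ := by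
  rw [ltN, sat_leN, eval_S1, ACAModel.add_one_le_iff]

/-- The fraction `q` has a nonzero denominator and value `v`. -/
def HasValue (q : Frac V) (v : 𝓜.Q) : Prop :=
  q.den.eval ρ ≠ 0 ∧
    v = (𝓜.toQ (q.pos.eval ρ) - 𝓜.toQ (q.neg.eval ρ)) / 𝓜.toQ (q.den.eval ρ)

variable {ρ}

namespace HasValue

variable {q r : Frac V} {v w : 𝓜.Q}

theorem wk (h : HasValue ρ q v) {σ : Ty} (a : 𝓜.C σ) : HasValue (Struct.cons ρ a) q.wk v := by
  simpa only [HasValue, Frac.wk, Tm.eval_wk] using h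

theorem add (hq : HasValue ρ q v) (hr : HasValue ρ r w) : HasValue ρ (q.add r) (v + w) := by
  obtain ⟨hq_den, rfl⟩ := hq
  obtain ⟨hr_den, rfl⟩ := hr
  refine ⟨mul_ne_zero hq_den hr_den, ?_⟩
  have hq_ne := (toQ_pos hq_den).ne'
  have hr_ne := (toQ_pos hr_den).ne'
  simp only [Frac.add, eval_add, eval_mul, map_add, map_mul]
  field_simp
  ring

theorem scaled (c n : Tm V Ty.N) :
    HasValue ρ (.scaled c n) (𝓜.toQ (c.eval ρ) * halfPow (n.eval ρ)) := by
  refine ⟨pow2_ne_zero _, ?_⟩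
  simp only [Frac.scaled, eval_zero, map_zero, sub_zero, eval_pow2, halfPow, div_eq_mul_inv]

theorem sat_lt (hq : HasValue ρ q v) (hr : HasValue ρ r w) : (Frac.lt q r).Sat ρ ↔ v < w := by
  obtain ⟨hq_den, rfl⟩ := hq
  obtain ⟨hr_den, rfl⟩ := hr
  rw [Frac.lt, sat_ltN, ← toQ_lt_toQ, div_lt_div_iff₀ (toQ_pos hq_den) (toQ_pos hr_den)]
  simp only [eval_add, eval_mul, map_add, map_mul]
  constructor <;> intro h <;> linarith

theorem sat_le (hq : HasValue ρ q v) (hr : HasValue ρ r w) : (Frac.le q r).Sat ρ ↔ v ≤ w := by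
  obtain ⟨hq_den, rfl⟩ := hq
  obtain ⟨hr_den, rfl⟩ := hr
  rw [Frac.le, sat_leN, ← toQ_le_toQ, div_le_div_iff₀ (toQ_pos hq_den) (toQ_pos hr_den)]
  simp only [eval_add, eval_mul, map_add, map_mul]
  constructor <;> intro h <;> linarith

end HasValue

theorem RatCode.hasValue {q a b d : 𝓜.C Ty.N} (h : RatCode q a b d) :
    HasValue (Struct.cons (Struct.cons (Struct.cons ρ a) b) d)
      ⟨(Tm.var .new)⇑⇑, (Tm.var .new)⇑, (Tm.var .new).S1⟩ (rat q) := by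
  simp only [HasValue, eval_S1, Tm.eval_new, Tm.eval_wk, h.rat_eq, map_add, map_one, and_true]
  exact add_one_ne_zero d

theorem sat_isRat (q a b d : Tm V Ty.N) :
    (isRat q a b d).Sat ρ ↔ RatCode (q.eval ρ) (a.eval ρ) (b.eval ρ) (d.eval ρ) := by
  simp only [isRat, isPair, sat_exB, Fm.sat_and, Fm.sat_eq, eval_add, eval_mul, eval_S1,
    Tm.eval_wk, Tm.eval_new, RatCode, PairCode]

theorem sat_withRat {q : Tm V Ty.N}
    {φ : Frac (Ext (Ext (Ext V Ty.N) Ty.N) Ty.N) → Fm (Ext (Ext (Ext V Ty.N) Ty.N) Ty.N)}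
    {P : Prop}
    (h : ∀ (a b d : 𝓜.C Ty.N) (r : Frac (Ext (Ext (Ext V Ty.N) Ty.N) Ty.N)),
      HasValue (Struct.cons (Struct.cons (Struct.cons ρ a) b) d) r (rat (q.eval ρ)) →
      ((φ r).Sat (Struct.cons (Struct.cons (Struct.cons ρ a) b) d) ↔ P)) :
    (withRat q φ).Sat ρ ↔ P := by
  simp only [withRat, sat_exB, Fm.sat_and, sat_isRat, Tm.eval_wk, Tm.eval_new]
  constructor
  · rintro ⟨a, b, d, hcode, hφ⟩
    exact (h a b d _ hcode.hasValue).1 hφ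
  · intro hP
    obtain ⟨a, b, d, hcode⟩ := exists_ratCode_eq (q.eval ρ)
    exact ⟨a, b, d, hcode, (h a b d _ hcode.hasValue).2 hP⟩

variable (ρ)

@[simp] theorem sat_isReal (x : Tm V Ty.one) : (isReal x).Sat ρ ↔ IsReal (x.eval ρ) := by
  simp only [isReal, sat_allB]
  refine forall_congr' fun n => forall_congr' fun i => ?_
  refine sat_withRat fun a b d q hq => sat_withRat fun a' b' d' r hr => ?_
  have hq' := ((hq.wk a').wk b').wk d'
  rw [Fm.sat_and, hq'.sat_lt (hr.add (.scaled _ _)), hr.sat_lt (hq'.add (.scaled _ _))]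
  simp only [Tm.eval_app, eval_add, Tm.eval_wk, Tm.eval_new, eval_n1, map_one, one_mul]

@[simp] theorem sat_eqR (x y : Tm V Ty.one) : (eqR x y).Sat ρ ↔ EqR (x.eval ρ) (y.eval ρ) := by
  rw [eqR, sat_allB]
  refine forall_congr' fun n => ?_
  refine sat_withRat fun a b d q hq => sat_withRat fun a' b' d' r hr => ?_
  have hq' := ((hq.wk a').wk b').wk d'
  rw [Fm.sat_and, hq'.sat_le (hr.add (.scaled _ _)), hr.sat_le (hq'.add (.scaled _ _))]
  simp only [Tm.eval_app, Tm.eval_wk, Tm.eval_new, eval_n2, map_ofNat]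

@[simp] theorem sat_ltR (x y : Tm V Ty.one) : (ltR x y).Sat ρ ↔ LtR (x.eval ρ) (y.eval ρ) := by
  rw [ltR, sat_exB]
  refine exists_congr fun n => ?_
  refine sat_withRat fun a b d q hq => sat_withRat fun a' b' d' r hr => ?_
  have hq' := ((hq.wk a').wk b').wk d'
  rw [(hq'.add (.scaled _ _)).sat_lt hr]
  simp only [Tm.eval_app, Tm.eval_wk, Tm.eval_new, eval_n2, map_ofNat]

@[simp] theorem sat_ltAddR (x y z : Tm V Ty.one) :
    (ltAddR x y z).Sat ρ ↔ LtAddR (x.eval ρ) (y.eval ρ) (z.eval ρ) := by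
  rw [ltAddR, sat_exB]
  refine exists_congr fun n => ?_
  refine sat_withRat fun a b d q hq => sat_withRat fun a' b' d' r hr =>
    sat_withRat fun a'' b'' d'' s hs => ?_
  have hq' := (((((hq.wk a').wk b').wk d').wk a'').wk b'').wk d''
  have hr' := ((hr.wk a'').wk b'').wk d''
  rw [(hq'.add (.scaled _ _)).sat_lt (hr'.add hs)]
  simp only [Tm.eval_app, Tm.eval_wk, Tm.eval_new, eval_n4, map_ofNat]

@[simp] theorem sat_inBall (x y z : Tm V Ty.one) :
    (inBall x y z).Sat ρ ↔ InBall (x.eval ρ) (y.eval ρ) (z.eval ρ) := by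
  simp only [inBall, Fm.sat_and, sat_ltAddR, InBall]

@[simp] theorem sat_inUnit (x : Tm V Ty.one) : (inUnit x).Sat ρ ↔ InUnit (x.eval ρ) := by
  simp only [inUnit, Fm.sat_and, Fm.sat_neg, sat_isReal, sat_ltR, InUnit, eval_zeroR, eval_oneR]

@[simp] theorem sat_isMem {σ : Ty} (x : Tm V σ) (A : Tm V (σ ⟶ₜ Ty.N)) :
    (isMem x A).Sat ρ ↔ A.eval ρ ⬝ x.eval ρ = (1 : 𝓜.C Ty.N) := by
  simp only [isMem, Fm.sat_eq, Tm.eval_app, eval_n1]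

/-- `f` is an element of the Cantor space of the model; this is `isBinary`. -/
def IsBinary (f : 𝓜.C Ty.one) : Prop := ∀ n, f ⬝ n ≤ 1

@[simp] theorem sat_isBinary (f : Tm V Ty.one) :
    (isBinary f).Sat ρ ↔ IsBinary (f.eval ρ) := by
  simp only [isBinary, sat_allB, sat_leN, Tm.eval_app, Tm.eval_wk, Tm.eval_new, eval_n1, IsBinary]

end Sat

/-! ### Truth of the principles -/

/-- `Y` is an injection from the unit interval of the model to its numbers; `NIN` says that there
is none. -/
def IsInjection (Y : 𝓜.C Ty.two) : Prop :=
  ∀ x y, InUnit x → InUnit y → (EqR x y ↔ Y ⬝ x = Y ⬝ y)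

/-- `Ψ` is a function from the unit interval to the positive reals; this is `isGauge`. -/
def IsGauge (Ψ : 𝓜.C (Ty.one ⟶ₜ Ty.one)) : Prop :=
  (∀ x, InUnit x → IsReal (Ψ ⬝ x) ∧ LtR (constReal 0) (Ψ ⬝ x)) ∧
    ∀ x y, InUnit x → InUnit y → EqR x y → EqR (Ψ ⬝ x) (Ψ ⬝ y)

/-- Finitely many balls `B(y_i, Ψ(y_i))` cover the unit interval; this is `hasFiniteCover`. -/
def HasFiniteCover (Ψ : 𝓜.C (Ty.one ⟶ₜ Ty.one)) : Prop :=
  ∃ (k : 𝓜.C Ty.N) (y : 𝓜.C (Ty.N ⟶ₜ Ty.one)), (∀ i, i ≤ k → InUnit (y ⬝ i)) ∧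
    ∀ x, InUnit x → ∃ i, i ≤ k ∧ InBall x (y ⬝ i) (Ψ ⬝ (y ⬝ i))

/-- `f` is upper semi-continuous on the unit interval; this is `isUSC`. -/
def IsUSC (f : 𝓜.C (Ty.one ⟶ₜ Ty.one)) : Prop :=
  ∀ x₀, InUnit x₀ → ∀ ε, IsReal ε → LtR (constReal 0) ε → ∃ δ, IsReal δ ∧ LtR (constReal 0) δ ∧
    ∀ x, InUnit x → InBall x x₀ δ → LtAddR (f ⬝ x) (f ⬝ x₀) ε

/-- `A` is the characteristic function of a set of reals of the model; this is `isSet`. -/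
def IsSet (A : 𝓜.C Ty.two) : Prop :=
  (∀ x, IsReal x → A ⬝ x ≤ 1) ∧ ∀ x y, IsReal x → IsReal y → EqR x y → A ⬝ x = A ⬝ y

/-- The closure properties of a σ-algebra containing the open intervals, as in `isSigmaAlgebra`.
The bound `𝒮 ≤ 1` is left out, so this is implied by, not equivalent to, `isSigmaAlgebra`. -/
structure IsSigmaAlgebra (𝒮 : 𝓜.C (Ty.two ⟶ₜ Ty.N)) : Prop where
  interval : ∀ a b A, IsReal a → IsReal b → IsSet A →
    (∀ x, IsReal x → (A ⬝ x = 1 ↔ LtR a x ∧ LtR x b)) → 𝒮 ⬝ A = 1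
  compl : ∀ A B, IsSet A → IsSet B → 𝒮 ⬝ A = 1 →
    (∀ x, IsReal x → (B ⬝ x = 1 ↔ ¬ A ⬝ x = 1)) → 𝒮 ⬝ B = 1
  union : ∀ (A : 𝓜.C (Ty.N ⟶ₜ Ty.two)) (B : 𝓜.C Ty.two),
    (∀ n, IsSet (A ⬝ n) ∧ 𝒮 ⬝ (A ⬝ n) = 1) → IsSet B →
    (∀ x, IsReal x → (B ⬝ x = 1 ↔ ∃ n, A ⬝ n ⬝ x = 1)) → 𝒮 ⬝ B = 1

/-- `B` belongs to every σ-algebra containing the open intervals; since `IsSigmaAlgebra` is weaker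
than `isSigmaAlgebra`, this implies the truth of `isBorelSet`. -/
def IsBorelSet (B : 𝓜.C Ty.two) : Prop := IsSet B ∧ ∀ 𝒮, IsSigmaAlgebra 𝒮 → 𝒮 ⬝ B = 1

/-- The sets `{x | f x > a}` are Borel; this implies the truth of `isBorelFun`. -/
def IsBorelFun (f : 𝓜.C (Ty.one ⟶ₜ Ty.one)) : Prop :=
  ∀ a, IsReal a → ∃ B, IsBorelSet B ∧
    ∀ x, IsReal x → (B ⬝ x = 1 ↔ InUnit x ∧ LtR a (f ⬝ x))

section SatPrinciples

variable {V : Ty → Type} (ρ : 𝓜.Assign V)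

theorem sat_NIN : (NIN V).Sat ρ ↔ ¬ ∃ Y : 𝓜.C Ty.two, IsInjection Y := by
  simp only [NIN, Fm.sat_neg, sat_exB, sat_allB, Fm.sat_imp, Fm.sat_iff, Fm.sat_eq, sat_inUnit,
    sat_eqR, Tm.eval_app, Tm.eval_wk, Tm.eval_new, IsInjection]

theorem sat_isGauge (Ψ : Tm V (Ty.one ⟶ₜ Ty.one)) :
    (isGauge Ψ).Sat ρ ↔ IsGauge (Ψ.eval ρ) := by
  simp only [isGauge, Fm.sat_and, sat_allB, Fm.sat_imp, sat_inUnit, sat_isReal, sat_ltR, eval_zeroR,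
    sat_eqR, Tm.eval_app, Tm.eval_wk, Tm.eval_new, IsGauge]

theorem sat_hasFiniteCover (Ψ : Tm V (Ty.one ⟶ₜ Ty.one)) :
    (hasFiniteCover Ψ).Sat ρ ↔ HasFiniteCover (Ψ.eval ρ) := by
  simp only [hasFiniteCover, Fm.sat_and, sat_allB, sat_exB, Fm.sat_imp, sat_inUnit, sat_leN,
    sat_inBall, Tm.eval_app, Tm.eval_wk, Tm.eval_new, HasFiniteCover]

theorem sat_isUSC (f : Tm V (Ty.one ⟶ₜ Ty.one)) : (isUSC f).Sat ρ ↔ IsUSC (f.eval ρ) := by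
  simp only [isUSC, Fm.sat_and, sat_allB, sat_exB, Fm.sat_imp, sat_inUnit, sat_isReal, sat_ltR,
    eval_zeroR, sat_inBall, sat_ltAddR, Tm.eval_app, Tm.eval_wk, Tm.eval_new, IsUSC]

@[simp] theorem sat_isSet (A : Tm V Ty.two) : (isSet A).Sat ρ ↔ IsSet (A.eval ρ) := by
  simp only [isSet, Fm.sat_and, sat_allB, Fm.sat_imp, sat_isReal, sat_leN, eval_n1, sat_eqR,
    Fm.sat_eq, Tm.eval_app, Tm.eval_wk, Tm.eval_new, IsSet]

theorem isSigmaAlgebra_of_sat (𝒮 : Tm V (Ty.two ⟶ₜ Ty.N)) (h : (isSigmaAlgebra 𝒮).Sat ρ) :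
    IsSigmaAlgebra (𝒮.eval ρ) := by
  simp only [isSigmaAlgebra, Fm.sat_and, sat_allB, sat_exB, Fm.sat_imp, Fm.sat_iff, Fm.sat_neg,
    sat_isReal, sat_isSet, sat_isMem, sat_ltR, sat_leN, Tm.eval_app, Tm.eval_wk,
    Tm.eval_new] at h
  exact ⟨h.2.1, h.2.2.1, h.2.2.2⟩

theorem IsBorelSet.sat_isBorelSet {B : Tm V Ty.two} (h : IsBorelSet (B.eval ρ)) :
    (isBorelSet B).Sat ρ := by
  rw [isBorelSet, Fm.sat_and, sat_isSet, sat_allB]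
  refine ⟨h.1, fun 𝒮 h𝒮 => ?_⟩
  rw [sat_isMem, Tm.eval_wk]
  exact h.2 𝒮 (isSigmaAlgebra_of_sat _ _ h𝒮)

theorem IsBorelFun.sat_isBorelFun {f : Tm V (Ty.one ⟶ₜ Ty.one)} (h : IsBorelFun (f.eval ρ)) :
    (isBorelFun f).Sat ρ := by
  simp only [isBorelFun, Fm.sat_and, sat_allB, sat_exB, Fm.sat_imp, Fm.sat_iff,
    sat_isReal, sat_isMem, sat_ltR, sat_inUnit, Tm.eval_app, Tm.eval_wk, Tm.eval_new]
  intro a ha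
  obtain ⟨B, hB, hmem⟩ := h a ha
  exact ⟨B, IsBorelSet.sat_isBorelSet _ hB, hmem⟩

theorem of_sat_IND (h : (IND V).Sat ρ) (Y : 𝓜.C (Ty.one ⟶ₜ Ty.N ⟶ₜ Ty.N))
    (hY : ∀ n f g, IsBinary f → IsBinary g → Y ⬝ f ⬝ n = 0 → Y ⬝ g ⬝ n = 0 → f = g)
    (k : 𝓜.C Ty.N) :
    ∃ (l : 𝓜.C Ty.N) (w : 𝓜.C (Ty.N ⟶ₜ Ty.one)), ∀ m, m ≤ k →
      ((∃ i, i < l ∧ IsBinary (w ⬝ i) ∧ Y ⬝ (w ⬝ i) ⬝ m = 0) ↔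
        ∃ f, IsBinary f ∧ Y ⬝ f ⬝ m = 0) := by
  simp only [IND, Fm.sat_and, sat_allB, sat_exB, Fm.sat_imp, Fm.sat_iff, Fm.sat_eq, sat_eqAt,
    sat_isBinary, sat_leN, sat_ltN, eval_zero, Tm.eval_app, Tm.eval_wk, Tm.eval_new] at h
  exact h Y hY k

end SatPrinciples

end ACAModel

/-! ### Comparison of reals with rationals -/

namespace ACAModel

variable {𝓜 : ACAModel}

/-- The strict order between the rational number `q` and the real number `x`. -/
def RatLt (q : 𝓜.Q) (x : 𝓜.C Ty.one) : Prop := ∃ n, q + halfPow n < rat (x ⬝ n)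

/-- The strict order between the real number `x` and the rational number `q`. -/
def LtRat (x : 𝓜.C Ty.one) (q : 𝓜.Q) : Prop := ∃ n, rat (x ⬝ n) + halfPow n < q

section Definability

variable {X : Type} [Context 𝓜 X] (x : X → 𝓜.C Ty.one) (q : X → 𝓜.Q)
variable [hx : Definable x] [hq : DefinableRat q]

instance : DefinablePred 𝓜 fun p => RatLt (q p) (x p) := by
  have := hq.comp_fst (σ := Ty.N)
  have := hx.comp_fst (σ := Ty.N)
  unfold RatLt
  infer_instance

instance : DefinablePred 𝓜 fun p => LtRat (x p) (q p) := by
  have := hq.comp_fst (σ := Ty.N)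
  have := hx.comp_fst (σ := Ty.N)
  unfold LtRat
  infer_instance

end Definability

theorem isReal_constReal (q : 𝓜.C Ty.N) : IsReal (constReal q) := fun n i => by
  simp only [constReal, 𝓜.app_K]
  constructor <;> linarith [halfPow_pos n]

theorem rat_constReal_app (q n : 𝓜.C Ty.N) : rat (constReal q ⬝ n) = rat q := by
  rw [constReal, 𝓜.app_K]

theorem EqR.refl (x : 𝓜.C Ty.one) : EqR x x := fun n => by
  constructor <;> linarith [halfPow_pos n]

theorem EqR.symm {x y : 𝓜.C Ty.one} (h : EqR x y) : EqR y x := fun n => (h n).symm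

theorem exists_ge_halfPow_lt (n : 𝓜.C Ty.N) {ε : 𝓜.Q} (hε : 0 < ε) :
    ∃ m, n ≤ m ∧ halfPow m < ε := by
  obtain ⟨m, hm⟩ := exists_halfPow_lt hε
  exact ⟨max n m, le_max_left _ _, (halfPow_antitone (le_max_right _ _)).trans_lt hm⟩

theorem IsReal.lt_add_halfPow {x : 𝓜.C Ty.one} (hx : IsReal x) {m n : 𝓜.C Ty.N} (h : n ≤ m) :
    rat (x ⬝ n) < rat (x ⬝ m) + halfPow n ∧ rat (x ⬝ m) < rat (x ⬝ n) + halfPow n := by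
  obtain ⟨i, rfl⟩ := h
  exact hx n i

section RealRat

variable {x y : 𝓜.C Ty.one} {p q : 𝓜.Q}

theorem RatLt.exists_forall_lt (hx : IsReal x) (h : RatLt q x) :
    ∃ ε > 0, ∃ n, ∀ m, n ≤ m → q + ε < rat (x ⬝ m) := by
  obtain ⟨n, hn⟩ := h
  refine ⟨rat (x ⬝ n) - halfPow n - q, by linarith, n, fun m hm => ?_⟩
  linarith [(hx.lt_add_halfPow hm).1]

theorem LtRat.exists_forall_lt (hx : IsReal x) (h : LtRat x q) :
    ∃ ε > 0, ∃ n, ∀ m, n ≤ m → rat (x ⬝ m) + ε < q := by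
  obtain ⟨n, hn⟩ := h
  refine ⟨q - rat (x ⬝ n) - halfPow n, by linarith, n, fun m hm => ?_⟩
  linarith [(hx.lt_add_halfPow hm).2]

theorem RatLt.trans_ltRat (hx : IsReal x) (hp : RatLt p x) (hq : LtRat x q) : p < q := by
  obtain ⟨ε, hε, n, hn⟩ := hp.exists_forall_lt hx
  obtain ⟨δ, hδ, m, hm⟩ := hq.exists_forall_lt hx
  linarith [hn _ (le_max_left n m), hm _ (le_max_right n m)]

theorem RatLt.mono (h : RatLt q x) (hpq : p ≤ q) : RatLt p x := by
  obtain ⟨n, hn⟩ := h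
  exact ⟨n, by linarith⟩

theorem LtRat.mono (h : LtRat x p) (hpq : p ≤ q) : LtRat x q := by
  obtain ⟨n, hn⟩ := h
  exact ⟨n, by linarith⟩

theorem RatLt.lt_of_not_ratLt (hp : RatLt p x) (hq : ¬ RatLt q x) : p < q :=
  lt_of_not_ge fun h => hq (hp.mono h)

theorem RatLt.exists_gt (h : RatLt q x) : ∃ p, q < p ∧ RatLt p x := by
  obtain ⟨n, hn⟩ := h
  exact ⟨(q + (rat (x ⬝ n) - halfPow n)) / 2, by linarith, n, by linarith⟩

theorem LtRat.exists_lt (h : LtRat x q) : ∃ p, p < q ∧ LtRat x p := by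
  obtain ⟨n, hn⟩ := h
  exact ⟨(q + (rat (x ⬝ n) + halfPow n)) / 2, by linarith, n, by linarith⟩

theorem EqR.ratLt (h : EqR x y) (hx : IsReal x) (hq : RatLt q x) : RatLt q y := by
  obtain ⟨ε, hε, n, hn⟩ := hq.exists_forall_lt hx
  obtain ⟨m, hm, hmε⟩ := exists_ge_halfPow_lt n (show 0 < ε / 4 by linarith)
  exact ⟨m, by linarith [hn m hm, (h m).1]⟩

theorem EqR.ltRat (h : EqR x y) (hx : IsReal x) (hq : LtRat x q) : LtRat y q := by
  obtain ⟨ε, hε, n, hn⟩ := hq.exists_forall_lt hx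
  obtain ⟨m, hm, hmε⟩ := exists_ge_halfPow_lt n (show 0 < ε / 4 by linarith)
  exact ⟨m, by linarith [hn m hm, (h m).2]⟩

theorem ltR_iff (hx : IsReal x) (hy : IsReal y) : LtR x y ↔ ∃ q, LtRat x q ∧ RatLt q y := by
  constructor
  · rintro ⟨n, hn⟩
    exact ⟨(rat (x ⬝ n) + rat (y ⬝ n)) / 2, ⟨n, by linarith⟩, n, by linarith⟩
  · rintro ⟨q, hxq, hqy⟩
    obtain ⟨ε, hε, n, hn⟩ := hxq.exists_forall_lt hx
    obtain ⟨δ, hδ, k, hk⟩ := hqy.exists_forall_lt hy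
    obtain ⟨m, hm, hmε⟩ := exists_ge_halfPow_lt (max n k) (show 0 < ε / 2 by linarith)
    exact ⟨m, by linarith [hn m ((le_max_left _ _).trans hm), hk m ((le_max_right _ _).trans hm)]⟩

theorem ltR_or_ltR_of_not_eqR (h : ¬ EqR x y) : LtR x y ∨ LtR y x := by
  simp only [EqR, not_forall, not_and_or, not_le] at h
  obtain ⟨n, h | h⟩ := h
  · exact .inr ⟨n, h⟩
  · exact .inl ⟨n, h⟩

theorem eqR_of_forall_ratLt_iff (hx : IsReal x) (hy : IsReal y)
    (h : ∀ q, RatLt q x ↔ RatLt q y) : EqR x y := by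
  by_contra hne
  obtain hlt | hlt := ltR_or_ltR_of_not_eqR hne
  · obtain ⟨q, hxq, hqy⟩ := (ltR_iff hx hy).1 hlt
    exact lt_irrefl q (((h q).2 hqy).trans_ltRat hx hxq)
  · obtain ⟨q, hyq, hqx⟩ := (ltR_iff hy hx).1 hlt
    exact lt_irrefl q (((h q).1 hqx).trans_ltRat hy hyq)

variable {r : 𝓜.C Ty.N}

theorem constReal_ltRat : LtRat (constReal r) p ↔ rat r < p := by
  simp only [LtRat, rat_constReal_app]
  constructor
  · rintro ⟨n, hn⟩
    linarith [halfPow_pos n]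
  · intro h
    obtain ⟨n, hn⟩ := exists_halfPow_lt (sub_pos.2 h)
    exact ⟨n, by linarith⟩

theorem ratLt_constReal : RatLt p (constReal r) ↔ p < rat r := by
  simp only [RatLt, rat_constReal_app]
  constructor
  · rintro ⟨n, hn⟩
    linarith [halfPow_pos n]
  · intro h
    obtain ⟨n, hn⟩ := exists_halfPow_lt (sub_pos.2 h)
    exact ⟨n, by linarith⟩

theorem constReal_ltR (hx : IsReal x) : LtR (constReal r) x ↔ RatLt (rat r) x := by
  simp only [ltR_iff (isReal_constReal r) hx, constReal_ltRat]
  exact ⟨fun ⟨_, hp, h⟩ => h.mono hp.le, fun h => h.exists_gt⟩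

theorem ltR_constReal (hx : IsReal x) : LtR x (constReal r) ↔ LtRat x (rat r) := by
  simp only [ltR_iff hx (isReal_constReal r), ratLt_constReal]
  constructor
  · rintro ⟨p, h, hp⟩
    exact h.mono hp.le
  · intro h
    obtain ⟨p, hp, h⟩ := h.exists_lt
    exact ⟨p, h, hp⟩

theorem zero_ltR_constReal : LtR (constReal 0) (constReal r) ↔ 0 < rat r := by
  rw [constReal_ltR (isReal_constReal r), ratLt_constReal, rat_zero]

theorem inUnit_iff : InUnit x ↔ IsReal x ∧ ¬ LtRat x 0 ∧ ¬ RatLt 1 x := by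
  refine and_congr_right fun hx => ?_
  rw [ltR_constReal hx, constReal_ltR hx, rat_zero, rat_one]

theorem inUnit_constReal (hzero : 0 ≤ rat r) (hone : rat r ≤ 1) : InUnit (constReal r) := by
  rw [inUnit_iff, constReal_ltRat, ratLt_constReal]
  exact ⟨isReal_constReal r, hzero.not_gt, hone.not_gt⟩

theorem InUnit.congr (hx : InUnit x) (hy : IsReal y) (h : EqR x y) : InUnit y := by
  rw [inUnit_iff] at hx ⊢
  exact ⟨hy, fun hlt => hx.2.1 (h.symm.ltRat hy hlt), fun hlt => hx.2.2 (h.symm.ratLt hy hlt)⟩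

theorem ltAddR_constReal (hx : IsReal x) (hy : IsReal y) :
    LtAddR x y (constReal r) ↔ ∃ q, LtRat x q ∧ RatLt (q - rat r) y := by
  simp only [LtAddR, rat_constReal_app]
  constructor
  · rintro ⟨n, hn⟩
    have hpos := halfPow_pos n
    exact ⟨rat (x ⬝ n) + 2 * halfPow n, ⟨n, by linarith⟩, n, by linarith⟩
  · rintro ⟨q, hxq, hqy⟩
    obtain ⟨ε, hε, n, hn⟩ := hxq.exists_forall_lt hx
    obtain ⟨δ, hδ, k, hk⟩ := hqy.exists_forall_lt hy
    obtain ⟨m, hm, hmε⟩ := exists_ge_halfPow_lt (max n k) (show 0 < ε / 4 by linarith)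
    exact ⟨m, by linarith [hn m ((le_max_left _ _).trans hm), hk m ((le_max_right _ _).trans hm)]⟩

theorem inBall_constReal (hx : IsReal x) (hy : IsReal y) : InBall x y (constReal r) ↔
    (∃ q, LtRat x q ∧ RatLt (q - rat r) y) ∧ ∃ q, LtRat y q ∧ RatLt (q - rat r) x := by
  rw [InBall, ltAddR_constReal hx hy, ltAddR_constReal hy hx]

end RealRat

/-! ### Points avoided by finitely many balls -/

/-- `A ⬝ m * 4 ^ (-m)` is the left endpoint of the `m`-th of a sequence of intervals, each of which
is the first or the last quarter of its predecessor, starting with `[0,1]`. -/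
def IsQuartering (A : 𝓜.C Ty.one) : Prop :=
  A ⬝ 0 = 0 ∧ ∀ m, A ⬝ (m + 1) = 4 * A ⬝ m ∨ A ⬝ (m + 1) = 4 * A ⬝ m + 3

theorem exists_isQuartering (Last : 𝓜.C Ty.N → 𝓜.C Ty.N → Prop)
    [DefinablePred 𝓜 fun p : (Unit × 𝓜.C Ty.N) × 𝓜.C Ty.N => Last p.1.2 p.2] :
    ∃ A : 𝓜.C Ty.one, IsQuartering A ∧ (∀ m, Last m (A ⬝ m) → A ⬝ (m + 1) = 4 * A ⬝ m + 3) ∧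
      ∀ m, ¬ Last m (A ⬝ m) → A ⬝ (m + 1) = 4 * A ⬝ m := by
  classical
  obtain ⟨A, hzero, hsucc⟩ := Definable.exists_rec 0
    (fun m a : 𝓜.C Ty.N => if Last m a then 4 * a + 3 else 4 * a)
  simp only [succ_eq_add_one] at hsucc
  have hlast : ∀ m, Last m (A ⬝ m) → A ⬝ (m + 1) = 4 * A ⬝ m + 3 := fun m h => by
    rw [hsucc, if_pos h]
  have hfirst : ∀ m, ¬ Last m (A ⬝ m) → A ⬝ (m + 1) = 4 * A ⬝ m := fun m h => by
    rw [hsucc, if_neg h]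
  exact ⟨A, ⟨hzero, fun m => (em (Last m (A ⬝ m))).symm.imp (hfirst m) (hlast m)⟩, hlast, hfirst⟩

/-- The left endpoint of the `m`-th interval of a quartering. -/
noncomputable def leftEnd (A : 𝓜.C Ty.one) (m : 𝓜.C Ty.N) : 𝓜.Q :=
  𝓜.toQ (A ⬝ m) * halfPow (2 * m)

theorem four_mul_halfPow_two_mul_add_one (n : 𝓜.C Ty.N) :
    4 * halfPow (2 * (n + 1)) = halfPow (2 * n) := by
  have hexp : 2 * (n + 1) = 2 * n + 1 + 1 := by ring
  rw [hexp]
  linarith [two_mul_halfPow_add_one (2 * n), two_mul_halfPow_add_one (2 * n + 1)]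

theorem leftEnd_add_one_of_eq_four_mul {A : 𝓜.C Ty.one} {m : 𝓜.C Ty.N}
    (h : A ⬝ (m + 1) = 4 * A ⬝ m) : leftEnd A (m + 1) = leftEnd A m := by
  rw [leftEnd, leftEnd, h, ← four_mul_halfPow_two_mul_add_one m, map_mul, map_ofNat]
  ring

theorem leftEnd_add_one_of_eq_four_mul_add_three {A : 𝓜.C Ty.one} {m : 𝓜.C Ty.N}
    (h : A ⬝ (m + 1) = 4 * A ⬝ m + 3) :
    leftEnd A (m + 1) = leftEnd A m + 3 * halfPow (2 * (m + 1)) := by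
  rw [leftEnd, leftEnd, h, ← four_mul_halfPow_two_mul_add_one m, map_add, map_mul, map_ofNat,
    map_ofNat]
  ring

namespace IsQuartering

variable {A : 𝓜.C Ty.one}

theorem leftEnd_zero (hA : IsQuartering A) : leftEnd A 0 = 0 := by
  rw [leftEnd, hA.1, map_zero, zero_mul]

theorem nested_add_one (hA : IsQuartering A) (m : 𝓜.C Ty.N) :
    leftEnd A m ≤ leftEnd A (m + 1) ∧
      leftEnd A (m + 1) + halfPow (2 * (m + 1)) ≤ leftEnd A m + halfPow (2 * m) := by
  have hpos := halfPow_pos (2 * (m + 1))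
  have hlen := four_mul_halfPow_two_mul_add_one m
  obtain h | h := hA.2 m
  · rw [leftEnd_add_one_of_eq_four_mul h]
    constructor <;> linarith
  · rw [leftEnd_add_one_of_eq_four_mul_add_three h]
    constructor <;> linarith

theorem nested (hA : IsQuartering A) {m n : 𝓜.C Ty.N} (h : m ≤ n) :
    leftEnd A m ≤ leftEnd A n ∧
      leftEnd A n + halfPow (2 * n) ≤ leftEnd A m + halfPow (2 * m) := by
  obtain ⟨i, rfl⟩ := h
  induction i using add_one_induction with
  | definable => unfold leftEnd; infer_instance
  | zero => rw [_root_.add_zero]; exact ⟨le_rfl, le_rfl⟩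
  | add_one i ih =>
    rw [← _root_.add_assoc]
    have hstep := hA.nested_add_one (m + i)
    exact ⟨ih.1.trans hstep.1, hstep.2.trans ih.2⟩

theorem leftEnd_mem (hA : IsQuartering A) (m : 𝓜.C Ty.N) :
    0 ≤ leftEnd A m ∧ leftEnd A m ≤ 1 := by
  have hnested := hA.nested (zero_le : 0 ≤ m)
  rw [hA.leftEnd_zero, mul_zero, halfPow_zero] at hnested
  exact ⟨hnested.1, by linarith [hnested.2, halfPow_pos (2 * m)]⟩

end IsQuartering

/-- At stage `m` the only labelled point that matters is the one with label `m`: moving to the last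
quarter if it is below the midpoint, and to the first quarter otherwise, leaves it at least one
quarter away. -/
theorem exists_isQuartering_avoiding {k : 𝓜.C Ty.N} {y : 𝓜.C (Ty.N ⟶ₜ Ty.one)}
    {label : 𝓜.C Ty.one} (hreal : ∀ i, i ≤ k → IsReal (y ⬝ i))
    (hinj : ∀ i j, i ≤ k → j ≤ k → label ⬝ i = label ⬝ j → EqR (y ⬝ i) (y ⬝ j)) :
    ∃ A, IsQuartering A ∧ ∀ i, i ≤ k →
      LtRat (y ⬝ i) (leftEnd A (label ⬝ i + 1) - halfPow (2 * (label ⬝ i + 1))) ∨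
        ¬ LtRat (y ⬝ i) (leftEnd A (label ⬝ i + 1) + 2 * halfPow (2 * (label ⬝ i + 1))) := by
  let BelowMid (m a : 𝓜.C Ty.N) : Prop := ∃ i, i ≤ k ∧ label ⬝ i = m ∧
    LtRat (y ⬝ i) (𝓜.toQ a * halfPow (2 * m) + 2 * halfPow (2 * (m + 1)))
  obtain ⟨A, hA, hlast, hfirst⟩ := exists_isQuartering BelowMid
  refine ⟨A, hA, fun i hi => ?_⟩
  by_cases hmid : BelowMid (label ⬝ i) (A ⬝ (label ⬝ i))
  · left
    rw [leftEnd_add_one_of_eq_four_mul_add_three (hlast _ hmid)]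
    obtain ⟨j, hj, hlabel, hlt⟩ := hmid
    exact ((hinj j i hj hi hlabel).ltRat (hreal j hj) hlt).mono (by rw [leftEnd]; linarith)
  · right
    rw [leftEnd_add_one_of_eq_four_mul (hfirst _ hmid)]
    exact fun hlt => hmid ⟨i, hi, rfl, hlt⟩

theorem exists_rat_avoiding {k : 𝓜.C Ty.N} {y : 𝓜.C (Ty.N ⟶ₜ Ty.one)} {label : 𝓜.C Ty.one}
    (hreal : ∀ i, i ≤ k → IsReal (y ⬝ i))
    (hinj : ∀ i j, i ≤ k → j ≤ k → label ⬝ i = label ⬝ j → EqR (y ⬝ i) (y ⬝ j)) :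
    ∃ q : 𝓜.Q, 0 ≤ q ∧ q ≤ 1 ∧ ∀ i, i ≤ k → LtRat (y ⬝ i) (q - halfPow (2 * (label ⬝ i + 1))) ∨
      ¬ LtRat (y ⬝ i) (q + halfPow (2 * (label ⬝ i + 1))) := by
  obtain ⟨A, hA, havoid⟩ := exists_isQuartering_avoiding hreal hinj
  obtain ⟨B, hB⟩ := exists_bound label k
  refine ⟨leftEnd A (B + 1), (hA.leftEnd_mem _).1, (hA.leftEnd_mem _).2, fun i hi => ?_⟩
  have hnested := hA.nested (add_le_add_left (hB i hi) 1)
  have hpos := halfPow_pos (2 * (B + 1))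
  refine (havoid i hi).imp (fun h => h.mono ?_) (fun h hlt => h (hlt.mono ?_)) <;> linarith

/-- `Ψ x = 4 ^ (-(Y x + 1))`, as a constant sequence depending only on `Y x`. For an injection `Y`
this is a gauge without finite subcover. -/
def IsInjectionGauge (Y : 𝓜.C Ty.two) (Ψ : 𝓜.C (Ty.one ⟶ₜ Ty.one)) : Prop :=
  ∃ e : 𝓜.C Ty.one, (∀ n, rat (e ⬝ n) = halfPow (2 * (n + 1))) ∧
    ∀ x, Ψ ⬝ x = constReal (e ⬝ (Y ⬝ x))

theorem exists_halfPow_element (f : 𝓜.C Ty.N → 𝓜.C Ty.N)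
    [DefinablePred 𝓜 fun p : (Unit × 𝓜.C Ty.N) × 𝓜.C Ty.N => rat p.2 = halfPow (f p.1.2)] :
    ∃ e : 𝓜.C Ty.one, ∀ n, rat (e ⬝ n) = halfPow (f n) := by
  obtain ⟨e, he⟩ := Definable.exists_choice_element
    (fun n q : 𝓜.C Ty.N => rat q = halfPow (f n))
  exact ⟨e, fun n => he n (rat_surjective _)⟩

theorem exists_isInjectionGauge (Y : 𝓜.C Ty.two) :
    ∃ Ψ : 𝓜.C (Ty.one ⟶ₜ Ty.one), IsInjectionGauge Y Ψ := by
  obtain ⟨e, he⟩ := exists_halfPow_element fun n : 𝓜.C Ty.N => 2 * (n + 1)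
  obtain ⟨Ψ, hΨ⟩ := Definable.exists_element fun x : 𝓜.C Ty.one => constReal (e ⬝ (Y ⬝ x))
  exact ⟨Ψ, e, he, hΨ⟩

namespace IsInjectionGauge

variable {Y : 𝓜.C Ty.two} {Ψ : 𝓜.C (Ty.one ⟶ₜ Ty.one)}

theorem exists_eq_constReal (hΨ : IsInjectionGauge Y Ψ) (x : 𝓜.C Ty.one) :
    ∃ r, Ψ ⬝ x = constReal r ∧ rat r = halfPow (2 * (Y ⬝ x + 1)) := by
  obtain ⟨e, he, hΨ⟩ := hΨ
  exact ⟨_, hΨ x, he _⟩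

theorem congr (hΨ : IsInjectionGauge Y Ψ) {x y : 𝓜.C Ty.one} (h : Y ⬝ x = Y ⬝ y) :
    Ψ ⬝ x = Ψ ⬝ y := by
  obtain ⟨e, -, hΨ⟩ := hΨ
  rw [hΨ, hΨ, h]

theorem isGauge (hΨ : IsInjectionGauge Y Ψ) (hY : IsInjection Y) : IsGauge Ψ := by
  refine ⟨fun x _ => ?_, fun x y hx hy hxy => ?_⟩
  · obtain ⟨r, hΨx, hr⟩ := hΨ.exists_eq_constReal x
    rw [hΨx, zero_ltR_constReal, hr]
    exact ⟨isReal_constReal r, halfPow_pos _⟩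
  · rw [hΨ.congr ((hY x y hx hy).1 hxy)]
    exact EqR.refl _

theorem not_hasFiniteCover (hΨ : IsInjectionGauge Y Ψ) (hY : IsInjection Y) :
    ¬ HasFiniteCover Ψ := by
  rintro ⟨k, y, hy, hcover⟩
  obtain ⟨label, hlabel⟩ := Definable.exists_element fun i : 𝓜.C Ty.N => Y ⬝ (y ⬝ i)
  obtain ⟨q, hq_nonneg, hq_le_one, havoid⟩ := exists_rat_avoiding (label := label)
    (fun i hi => (hy i hi).1) fun i j hi hj h =>
      (hY _ _ (hy i hi) (hy j hj)).2 (by rwa [hlabel, hlabel] at h)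
  obtain ⟨c, rfl⟩ := rat_surjective q
  obtain ⟨i, hi, hball⟩ := hcover _ (inUnit_constReal hq_nonneg hq_le_one)
  obtain ⟨r, hΨi, hr⟩ := hΨ.exists_eq_constReal (y ⬝ i)
  have hreal := (hy i hi).1
  rw [hΨi, inBall_constReal (isReal_constReal c) hreal] at hball
  obtain ⟨⟨p, hcp, hp⟩, p', hp', hp'c⟩ := hball
  rw [constReal_ltRat] at hcp
  rw [ratLt_constReal] at hp'c
  rw [← hlabel] at hr
  obtain hlt | hnot_lt := havoid i hi
  · linarith [hp.trans_ltRat hreal hlt]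
  · exact hnot_lt (hp'.mono (by linarith))

end IsInjectionGauge

end ACAModel

/-! ### Borel gauges -/

namespace ACAModel

variable {𝓜 : ACAModel}

/-- Membership in `P` depends only on the real number represented, so that `P` restricted to the
reals is a set of reals of the model. -/
def RespectsEqR (P : 𝓜.C Ty.one → Prop) : Prop :=
  ∀ x y, IsReal x → IsReal y → EqR x y → P x → P y

/-- `A` is the characteristic function of the set of reals with the property `P`. -/
def IsSetOf (A : 𝓜.C Ty.two) (P : 𝓜.C Ty.one → Prop) : Prop :=
  IsSet A ∧ ∀ x, IsReal x → (A ⬝ x = 1 ↔ P x)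

theorem IsSetOf.of_eq_ite {A : 𝓜.C Ty.two} {P : 𝓜.C Ty.one → Prop} [DecidablePred P]
    (hP : RespectsEqR P) (hA : ∀ x, A ⬝ x = if P x then 1 else 0) : IsSetOf A P := by
  refine ⟨⟨fun x _ => ?_, fun x y hx hy h => ?_⟩, fun x _ => ?_⟩
  · rw [hA]
    split_ifs
    exacts [le_rfl, zero_le_one]
  · rw [hA, hA]
    exact if_congr ⟨hP x y hx hy h, hP y x hy hx h.symm⟩ rfl rfl
  · rw [hA]
    split_ifs with hx <;> simp [hx]

theorem exists_isSetOf {P : 𝓜.C Ty.one → Prop} [DefinablePred 𝓜 fun p : Unit × 𝓜.C Ty.one => P p.2]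
    (hP : RespectsEqR P) : ∃ A, IsSetOf A P := by
  classical
  obtain ⟨A, hA⟩ := Definable.exists_element fun x => if P x then (1 : 𝓜.C Ty.N) else 0
  exact ⟨A, .of_eq_ite hP hA⟩

theorem exists_isSetOf_seq {P : 𝓜.C Ty.N → 𝓜.C Ty.one → Prop}
    [DefinablePred 𝓜 fun p : (Unit × 𝓜.C Ty.N) × 𝓜.C Ty.one => P p.1.2 p.2]
    (hP : ∀ n, RespectsEqR (P n)) : ∃ A : 𝓜.C (Ty.N ⟶ₜ Ty.two), ∀ n, IsSetOf (A ⬝ n) (P n) := by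
  classical
  obtain ⟨A, hA⟩ := Definable.exists_element₂ fun n x => if P n x then (1 : 𝓜.C Ty.N) else 0
  exact ⟨A, fun n => .of_eq_ite (hP n) (hA n)⟩

theorem exists_rat_interval_missing {x x₀ : 𝓜.C Ty.one} (hx : IsReal x) (hx₀ : IsReal x₀)
    (hne : ¬ EqR x x₀) : ∃ p q, RatLt p x ∧ LtRat x q ∧ ¬ (RatLt p x₀ ∧ LtRat x₀ q) := by
  obtain h | h := ltR_or_ltR_of_not_eqR hne
  · obtain ⟨q, hxq, hq⟩ := (ltR_iff hx hx₀).1 h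
    exact ⟨rat (x ⬝ 0) - halfPow 0 - 1, q, ⟨0, by linarith⟩, hxq,
      fun h => lt_irrefl q (hq.trans_ltRat hx₀ h.2)⟩
  · obtain ⟨p, hp, hpx⟩ := (ltR_iff hx₀ hx).1 h
    exact ⟨p, rat (x ⬝ 0) + halfPow 0 + 1, hpx, ⟨0, by linarith⟩,
      fun h => lt_irrefl p (h.1.trans_ltRat hx₀ hp)⟩

/-- `c` codes an open interval with rational endpoints that contains `x` but misses `x₀`. -/
def IsIntervalMissing (x₀ : 𝓜.C Ty.one) (c : 𝓜.C Ty.N) (x : 𝓜.C Ty.one) : Prop :=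
  ∃ p q, PairCode c p q ∧ (RatLt (rat p) x ∧ LtRat x (rat q)) ∧
    ¬ (RatLt (rat p) x₀ ∧ LtRat x₀ (rat q))

instance (x₀ : 𝓜.C Ty.one) : DefinablePred 𝓜 fun p : (Unit × 𝓜.C Ty.N) × 𝓜.C Ty.one =>
    IsIntervalMissing x₀ p.1.2 p.2 := by
  unfold IsIntervalMissing PairCode
  infer_instance

theorem respectsEqR_isIntervalMissing (x₀ : 𝓜.C Ty.one) (c : 𝓜.C Ty.N) :
    RespectsEqR (IsIntervalMissing x₀ c) := by
  rintro x y hx - h ⟨p, q, hc, ⟨hp, hq⟩, hx₀⟩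
  exact ⟨p, q, hc, ⟨h.ratLt hx hp, h.ltRat hx hq⟩, hx₀⟩

theorem exists_isIntervalMissing_iff {x x₀ : 𝓜.C Ty.one} (hx : IsReal x) (hx₀ : IsReal x₀) :
    (∃ c, IsIntervalMissing x₀ c x) ↔ ¬ EqR x x₀ := by
  constructor
  · rintro ⟨c, p, q, -, ⟨hp, hq⟩, hmiss⟩ heq
    exact hmiss ⟨heq.ratLt hx hp, heq.ltRat hx hq⟩
  · intro hne
    obtain ⟨p, q, hp, hq, hmiss⟩ := exists_rat_interval_missing hx hx₀ hne
    obtain ⟨a, rfl⟩ := rat_surjective p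
    obtain ⟨b, rfl⟩ := rat_surjective q
    obtain ⟨c, hc⟩ := exists_pairCode a b
    exact ⟨c, a, b, hc, ⟨hp, hq⟩, hmiss⟩

namespace IsSigmaAlgebra

variable {𝒮 : 𝓜.C (Ty.two ⟶ₜ Ty.N)} {A : 𝓜.C Ty.two} {x₀ : 𝓜.C Ty.one}

theorem mem_Ioo (h𝒮 : IsSigmaAlgebra 𝒮) {p q : 𝓜.Q}
    (hA : IsSetOf A fun x => RatLt p x ∧ LtRat x q) : 𝒮 ⬝ A = 1 := by
  obtain ⟨a, rfl⟩ := rat_surjective p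
  obtain ⟨b, rfl⟩ := rat_surjective q
  refine h𝒮.interval (constReal a) (constReal b) A (isReal_constReal a) (isReal_constReal b) hA.1
    fun x hx => ?_
  rw [hA.2 x hx, constReal_ltR hx, ltR_constReal hx]

theorem mem_empty (h𝒮 : IsSigmaAlgebra 𝒮) (hA : IsSetOf A fun _ => False) : 𝒮 ⬝ A = 1 := by
  refine h𝒮.mem_Ioo (p := 0) (q := 0) ⟨hA.1, fun x hx => (hA.2 x hx).trans ?_⟩
  exact ⟨False.elim, fun h => lt_irrefl _ (h.1.trans_ltRat hx h.2)⟩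

theorem mem_isIntervalMissing (h𝒮 : IsSigmaAlgebra 𝒮) {c : 𝓜.C Ty.N}
    (hA : IsSetOf A (IsIntervalMissing x₀ c)) : 𝒮 ⬝ A = 1 := by
  obtain ⟨p, q, hc⟩ := exists_pairCode_eq c
  by_cases hmem : RatLt (rat p) x₀ ∧ LtRat x₀ (rat q)
  · refine h𝒮.mem_empty ⟨hA.1, fun x hx => (hA.2 x hx).trans ⟨?_, False.elim⟩⟩
    rintro ⟨p', q', hc', -, hmiss⟩
    obtain ⟨rfl, rfl⟩ := hc.unique hc'
    exact hmiss hmem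
  · refine h𝒮.mem_Ioo (p := rat p) (q := rat q)
      ⟨hA.1, fun x hx => (hA.2 x hx).trans ⟨?_, fun h => ⟨p, q, hc, h, hmem⟩⟩⟩
    rintro ⟨p', q', hc', h, -⟩
    obtain ⟨rfl, rfl⟩ := hc.unique hc'
    exact h

theorem mem_compl_singleton (h𝒮 : IsSigmaAlgebra 𝒮) (hx₀ : IsReal x₀)
    (hA : IsSetOf A fun x => ¬ EqR x x₀) : 𝒮 ⬝ A = 1 := by
  obtain ⟨B, hB⟩ := exists_isSetOf_seq (respectsEqR_isIntervalMissing x₀)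
  refine h𝒮.union B A (fun c => ⟨(hB c).1, h𝒮.mem_isIntervalMissing (hB c)⟩) hA.1 fun x hx => ?_
  refine (hA.2 x hx).trans ((exists_isIntervalMissing_iff hx hx₀).symm.trans ?_)
  exact exists_congr fun c => ((hB c).2 x hx).symm

theorem mem_singleton (h𝒮 : IsSigmaAlgebra 𝒮) (hx₀ : IsReal x₀)
    (hA : IsSetOf A fun x => EqR x x₀) : 𝒮 ⬝ A = 1 := by
  have hrespects : RespectsEqR fun x => ¬ EqR x x₀ := fun x y hx hy h hne hy' =>
    hne ((hA.2 x hx).1 ((hA.1.2 x y hx hy h).trans ((hA.2 y hy).2 hy')))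
  obtain ⟨B, hB⟩ := exists_isSetOf hrespects
  refine h𝒮.compl B A hB.1 hA.1 (h𝒮.mem_compl_singleton hx₀ hB) fun x hx => ?_
  rw [hA.2 x hx, hB.2 x hx, not_not]

end IsSigmaAlgebra

namespace IsInjection

variable {Y : 𝓜.C Ty.two}

theorem app_eq_of_eqR (hY : IsInjection Y) {x y : 𝓜.C Ty.one} (hx : InUnit x) (hy : IsReal y)
    (h : EqR x y) : Y ⬝ x = Y ⬝ y :=
  (hY x y hx (hx.congr hy h)).1 h

/-- `B` is the union of the sets `{x ∈ B | Y x = m}`, which have at most one element. -/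
theorem isBorelSet (hY : IsInjection Y) {B : 𝓜.C Ty.two} (hB : IsSet B)
    (hunit : ∀ x, IsReal x → B ⬝ x = 1 → InUnit x) : IsBorelSet B := by
  refine ⟨hB, fun 𝒮 h𝒮 => ?_⟩
  have hrespects : ∀ m, RespectsEqR fun x => InUnit x ∧ Y ⬝ x = m ∧ B ⬝ x = 1 := by
    rintro m x y hx hy h ⟨hxunit, hYx, hBx⟩
    exact ⟨hxunit.congr hy h, hY.app_eq_of_eqR hxunit hy h ▸ hYx, hB.2 x y hx hy h ▸ hBx⟩
  obtain ⟨A, hA⟩ := exists_isSetOf_seq hrespects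
  refine h𝒮.union A B (fun m => ⟨(hA m).1, ?_⟩) hB fun x hx => ?_
  · by_cases hne : ∃ x, InUnit x ∧ Y ⬝ x = m ∧ B ⬝ x = 1
    · obtain ⟨x₀, hx₀, hYx₀, hBx₀⟩ := hne
      refine h𝒮.mem_singleton hx₀.1 ⟨(hA m).1, fun x hx => ((hA m).2 x hx).trans ⟨?_, fun h => ?_⟩⟩
      · rintro ⟨hxunit, hYx, -⟩
        exact (hY x x₀ hxunit hx₀).2 (hYx.trans hYx₀.symm)
      · exact hrespects m x₀ x hx₀.1 hx h.symm ⟨hx₀, hYx₀, hBx₀⟩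
    · exact h𝒮.mem_empty ⟨(hA m).1, fun x hx =>
        ((hA m).2 x hx).trans ⟨fun h => hne ⟨x, h⟩, False.elim⟩⟩
  · simp only [(hA _).2 x hx]
    exact ⟨fun h => ⟨Y ⬝ x, hunit x hx h, rfl, h⟩, fun ⟨_, _, _, h⟩ => h⟩

theorem isBorelFun (hY : IsInjection Y) {f : 𝓜.C (Ty.one ⟶ₜ Ty.one)}
    (hreal : ∀ x, InUnit x → IsReal (f ⬝ x))
    (hcongr : ∀ x y, InUnit x → InUnit y → EqR x y → EqR (f ⬝ x) (f ⬝ y)) : IsBorelFun f := by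
  intro a ha
  have hrespects : RespectsEqR fun x => InUnit x ∧ LtR a (f ⬝ x) := by
    rintro x y - hy h ⟨hx, hlt⟩
    have hy' := hx.congr hy h
    refine ⟨hy', (ltR_iff ha (hreal y hy')).2 ?_⟩
    obtain ⟨q, haq, hq⟩ := (ltR_iff ha (hreal x hx)).1 hlt
    exact ⟨q, haq, (hcongr x y hx hy' h).ratLt (hreal x hx) hq⟩
  obtain ⟨B, hB⟩ := exists_isSetOf hrespects
  exact ⟨B, hY.isBorelSet hB.1 fun x hx h => ((hB.2 x hx).1 h).1, hB.2⟩

end IsInjection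

/-! ### Upper semi-continuous gauges -/

/-- `f` is the characteristic function of the lower Dedekind cut of `x`. Equal reals have the same
cut, so cuts turn the uniqueness of a real into that of an element of the Cantor space. -/
def IsCut (f x : 𝓜.C Ty.one) : Prop := IsBinary f ∧ ∀ c, f ⬝ c = 1 ↔ RatLt (rat c) x

instance {X : Type} [Context 𝓜 X] (f x : X → 𝓜.C Ty.one) [Definable f] [Definable x] :
    DefinablePred 𝓜 fun p => IsCut (f p) (x p) :=
  DefinablePred.comp₂ (P := IsCut) (by unfold IsCut IsBinary; infer_instance) f x

theorem exists_isCut (x : 𝓜.C Ty.one) : ∃ f, IsCut f x := by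
  classical
  obtain ⟨f, hf⟩ := Definable.exists_element fun c => if RatLt (rat c) x then (1 : 𝓜.C Ty.N) else 0
  refine ⟨f, fun c => ?_, fun c => ?_⟩ <;> rw [hf]
  · split_ifs
    exacts [le_rfl, zero_le_one]
  · split_ifs with hc <;> simp [hc]

theorem eq_zero_or_eq_one_of_le_one {a : 𝓜.C Ty.N} (h : a ≤ 1) : a = 0 ∨ a = 1 := by
  obtain rfl | ⟨m, rfl⟩ := eq_zero_or_exists_add_one a
  · exact .inl rfl
  · exact .inr (le_antisymm h le_add_self)

namespace IsCut

variable {f g x y : 𝓜.C Ty.one}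

theorem congr (hf : IsCut f x) (hx : IsReal x) (hy : IsReal y) (h : EqR x y) : IsCut f y :=
  ⟨hf.1, fun c => (hf.2 c).trans ⟨h.ratLt hx, h.symm.ratLt hy⟩⟩

theorem unique (hf : IsCut f x) (hg : IsCut g x) : f = g := by
  refine 𝓜.ext fun c => ?_
  have hiff : f ⬝ c = 1 ↔ g ⬝ c = 1 := (hf.2 c).trans (hg.2 c).symm
  obtain hfc | hfc := eq_zero_or_eq_one_of_le_one (hf.1 c)
  · obtain hgc | hgc := eq_zero_or_eq_one_of_le_one (hg.1 c)
    · rw [hfc, hgc]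
    · rw [hiff.2 hgc, hgc]
  · rw [hfc, hiff.1 hfc]

end IsCut

/-- The `n`-th entry of `z` is less than `x`, by at most `2 ^ (-(n + 1))`. -/
def ApproximatesFromBelow (z x : 𝓜.C Ty.one) : Prop :=
  ∀ n, RatLt (rat (z ⬝ n)) x ∧ ¬ RatLt (rat (z ⬝ n) + halfPow (n + 1)) x

namespace ApproximatesFromBelow

variable {z x : 𝓜.C Ty.one}

theorem isReal (h : ApproximatesFromBelow z x) : IsReal z := fun n i => by
  have hle : rat (z ⬝ n) < rat (z ⬝ (n + i)) + halfPow (n + i + 1) :=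
    (h n).1.lt_of_not_ratLt (h (n + i)).2
  have hge : rat (z ⬝ (n + i)) < rat (z ⬝ n) + halfPow (n + 1) :=
    (h (n + i)).1.lt_of_not_ratLt (h n).2
  have hanti : halfPow (n + i + 1) ≤ halfPow (n + 1) :=
    halfPow_antitone (add_le_add_left le_self_add 1)
  have hdouble := two_mul_halfPow_add_one n
  constructor <;> linarith

theorem eqR (h : ApproximatesFromBelow z x) (hx : IsReal x) : EqR z x := by
  refine eqR_of_forall_ratLt_iff h.isReal hx fun q => ⟨?_, fun hq => ?_⟩
  · rintro ⟨n, hn⟩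
    exact (h n).1.mono (by linarith [halfPow_pos n])
  · obtain ⟨p, hqp, hp⟩ := hq.exists_gt
    obtain ⟨n, hn⟩ := exists_halfPow_lt (show 0 < (p - q) / 2 by linarith)
    have hpn := hp.lt_of_not_ratLt (h n).2
    exact ⟨n, by linarith [two_mul_halfPow_add_one n, halfPow_pos (n + 1)]⟩

end ApproximatesFromBelow

theorem exists_ratLt_of_width {x : 𝓜.C Ty.one} (hx : IsReal x) (n : 𝓜.C Ty.N) :
    ∃ c c' : 𝓜.C Ty.N, RatLt (rat c) x ∧ ¬ RatLt (rat c') x ∧ rat c' ≤ rat c + halfPow n := by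
  obtain ⟨m, hm⟩ : ∃ m, m = n + 1 + 1 := ⟨_, rfl⟩
  have hwidth : 4 * halfPow m = halfPow n := by
    rw [hm]
    linarith [two_mul_halfPow_add_one n, two_mul_halfPow_add_one (n + 1)]
  have hpos := halfPow_pos m
  obtain ⟨c, hc⟩ := rat_surjective (rat (x ⬝ m) - 2 * halfPow m)
  obtain ⟨c', hc'⟩ := rat_surjective (rat (x ⬝ m) + 2 * halfPow m)
  refine ⟨c, c', ⟨m, by linarith⟩, fun h => ?_, by linarith⟩
  exact lt_irrefl _ (h.trans_ltRat hx (⟨m, by linarith⟩ : LtRat x (rat c')))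

theorem exists_real_of_isCut (𝓜 : ACAModel) : ∃ G : 𝓜.C (Ty.one ⟶ₜ Ty.one), ∀ x f, IsReal x →
    IsCut f x → IsReal (G ⬝ f) ∧ EqR (G ⬝ f) x := by
  obtain ⟨g, hg, hchoice⟩ := Definable.exists_choice
    fun (p : (Unit × 𝓜.C Ty.one) × 𝓜.C Ty.N) c =>
      p.1.2 ⬝ c = 1 ∧ ∃ c', ¬ p.1.2 ⬝ c' = 1 ∧ rat c' ≤ rat c + halfPow (p.2 + 1)
  obtain ⟨G, hG⟩ := Definable.exists_element₂ fun f n => g (((), f), n)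
  refine ⟨G, fun x f hx hf => ?_⟩
  have happrox : ApproximatesFromBelow (G ⬝ f) x := fun n => by
    obtain ⟨c, c', hc, hc', hwidth⟩ := exists_ratLt_of_width hx (n + 1)
    obtain ⟨hbelow, d, hd, hwidth⟩ := hchoice (((), f), n)
      ⟨c, (hf.2 c).2 hc, c', fun h => hc' ((hf.2 c').1 h), hwidth⟩
    rw [hG]
    exact ⟨(hf.2 _).1 hbelow, fun h => hd ((hf.2 d).2 (h.mono hwidth))⟩
  exact ⟨happrox.isReal, happrox.eqR hx⟩

/-- `f` is the cut of the point `G ⬝ f` of the unit interval, where `Y` takes the value `m`. -/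
def IsCutAt (G : 𝓜.C (Ty.one ⟶ₜ Ty.one)) (Y : 𝓜.C Ty.two) (f : 𝓜.C Ty.one) (m : 𝓜.C Ty.N) :
    Prop :=
  InUnit (G ⬝ f) ∧ IsCut f (G ⬝ f) ∧ Y ⬝ (G ⬝ f) = m

instance (G : 𝓜.C (Ty.one ⟶ₜ Ty.one)) (Y : 𝓜.C Ty.two) :
    DefinablePred 𝓜 fun p : (Unit × 𝓜.C Ty.one) × 𝓜.C Ty.N => IsCutAt G Y p.1.2 p.2 := by
  unfold IsCutAt
  infer_instance

section IND

variable {V : Ty → Type} {ρ : 𝓜.Assign V} {Y : 𝓜.C Ty.two}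

theorem exists_finite_list_of_app_le (hIND : (IND V).Sat ρ) (hY : IsInjection Y) (k : 𝓜.C Ty.N) :
    ∃ (l : 𝓜.C Ty.N) (z : 𝓜.C (Ty.N ⟶ₜ Ty.one)), ∀ x, InUnit x → Y ⬝ x ≤ k →
      ∃ i, i < l ∧ InUnit (z ⬝ i) ∧ EqR (z ⬝ i) x := by
  classical
  obtain ⟨G, hG⟩ := exists_real_of_isCut 𝓜
  obtain ⟨Z, hZ_eq⟩ := Definable.exists_element₂
    fun f m => if IsCutAt G Y f m then (0 : 𝓜.C Ty.N) else 1
  have hZ : ∀ f m, Z ⬝ f ⬝ m = 0 ↔ IsCutAt G Y f m := fun f m => by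
    rw [hZ_eq]
    split_ifs with h <;> simp [h]
  have hunique : ∀ n f g, IsBinary f → IsBinary g → Z ⬝ f ⬝ n = 0 → Z ⬝ g ⬝ n = 0 → f = g := by
    intro n f g _ _ hf hg
    obtain ⟨hfunit, hf, hfn⟩ := (hZ f n).1 hf
    obtain ⟨hgunit, hg, hgn⟩ := (hZ g n).1 hg
    have heq : EqR (G ⬝ f) (G ⬝ g) := (hY _ _ hfunit hgunit).2 (hfn.trans hgn.symm)
    exact (hf.congr hfunit.1 hgunit.1 heq).unique hg
  obtain ⟨l, w, hw⟩ := of_sat_IND ρ hIND Z hunique k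
  obtain ⟨z, hz⟩ := Definable.exists_element fun i => G ⬝ (w ⬝ i)
  refine ⟨l, z, fun x hx hle => ?_⟩
  obtain ⟨f, hf⟩ := exists_isCut x
  obtain ⟨hreal, heq⟩ := hG x f hx.1 hf
  have hunit : InUnit (G ⬝ f) := hx.congr hreal heq.symm
  have hcut : IsCutAt G Y f (Y ⬝ x) :=
    ⟨hunit, hf.congr hx.1 hreal heq.symm, hY.app_eq_of_eqR hunit hx.1 heq⟩
  obtain ⟨i, hi, -, hZi⟩ := (hw (Y ⬝ x) hle).2 ⟨f, hf.1, (hZ _ _).2 hcut⟩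
  obtain ⟨hwunit, -, hYw⟩ := (hZ _ _).1 hZi
  rw [← hz] at hwunit hYw
  exact ⟨i, hi, hwunit, (hY _ _ hwunit hx).2 hYw⟩

theorem InBall.congr_of_le {x y z : 𝓜.C Ty.one} {r s : 𝓜.C Ty.N} (h : InBall x y (constReal r))
    (hx : IsReal x) (hy : IsReal y) (hz : IsReal z) (hxz : EqR x z) (hrs : rat r ≤ rat s) :
    InBall z y (constReal s) := by
  rw [inBall_constReal hx hy] at h
  rw [inBall_constReal hz hy]
  obtain ⟨⟨p, hxp, hp⟩, q, hyq, hq⟩ := h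
  exact ⟨⟨p, hxz.ltRat hx hxp, hp.mono (by linarith)⟩,
    q, hyq, (hxz.ratLt hx hq).mono (by linarith)⟩

theorem eqR_of_forall_inBall {x y : 𝓜.C Ty.one} (hx : IsReal x) (hy : IsReal y)
    (h : ∀ n : 𝓜.C Ty.N, ∃ r, rat r = halfPow n ∧ InBall x y (constReal r)) : EqR x y := by
  refine eqR_of_forall_ratLt_iff hx hy fun q => ⟨fun hq => ?_, fun hq => ?_⟩ <;>
    obtain ⟨p, hp, hq⟩ := hq.exists_gt <;>
    obtain ⟨n, hn⟩ := exists_halfPow_lt (sub_pos.2 hp) <;>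
    obtain ⟨r, hr, hball⟩ := h n <;>
    obtain ⟨⟨s, hxs, hsy⟩, t, hyt, htx⟩ := (inBall_constReal hx hy).1 hball
  · exact hsy.mono (by linarith [hq.trans_ltRat hx hxs])
  · exact htx.mono (by linarith [hq.trans_ltRat hy hyt])

theorem exists_forall_app_le_of_inBall (hIND : (IND V).Sat ρ) (hY : IsInjection Y)
    {x₀ : 𝓜.C Ty.one} (hx₀ : InUnit x₀) : ∃ r : 𝓜.C Ty.N, 0 < rat r ∧
      ∀ x, InUnit x → InBall x x₀ (constReal r) → Y ⬝ x₀ ≤ Y ⬝ x := by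
  obtain ⟨l, z, hz⟩ := exists_finite_list_of_app_le hIND hY (Y ⬝ x₀)
  obtain ⟨e, he⟩ := exists_halfPow_element fun n : 𝓜.C Ty.N => n
  obtain ⟨s, hs⟩ := Definable.exists_choice_element
    (fun i n : 𝓜.C Ty.N => ¬ InBall (z ⬝ i) x₀ (constReal (e ⬝ n)))
    (hP := by unfold InBall LtAddR; infer_instance)
  obtain ⟨B, hB⟩ := exists_bound s l
  refine ⟨e ⬝ B, by rw [he]; exact halfPow_pos B, fun x hx hball => ?_⟩
  by_contra! hlt
  obtain ⟨i, hi, hzunit, hzx⟩ := hz x hx hlt.le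
  have hfar : ∃ n, ¬ InBall (z ⬝ i) x₀ (constReal (e ⬝ n)) := by
    by_contra! hnear
    have hzx₀ := eqR_of_forall_inBall hzunit.1 hx₀.1 fun n => ⟨_, he n, hnear n⟩
    have hYx : Y ⬝ x = Y ⬝ x₀ := ((hY _ _ hzunit hx).1 hzx).symm.trans ((hY _ _ hzunit hx₀).1 hzx₀)
    exact hlt.ne hYx
  refine hs i hfar (hball.congr_of_le hx.1 hx₀.1 hzunit.1 hzx.symm ?_)
  rw [he, he]
  exact halfPow_antitone (hB i hi.le)

theorem IsInjectionGauge.isUSC {Ψ : 𝓜.C (Ty.one ⟶ₜ Ty.one)} (hΨ : IsInjectionGauge Y Ψ)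
    (hIND : (IND V).Sat ρ) (hY : IsInjection Y) : IsUSC Ψ := by
  intro x₀ hx₀ ε hε hε_pos
  obtain ⟨δ, hδ, hmin⟩ := exists_forall_app_le_of_inBall hIND hY hx₀
  refine ⟨constReal δ, isReal_constReal δ, zero_ltR_constReal.2 hδ, fun x hx hball => ?_⟩
  obtain ⟨r, hΨx, hr⟩ := hΨ.exists_eq_constReal x
  obtain ⟨r₀, hΨx₀, hr₀⟩ := hΨ.exists_eq_constReal x₀
  have hle : rat r ≤ rat r₀ := by
    rw [hr, hr₀]
    refine halfPow_antitone ?_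
    gcongr
    exact hmin x hx hball
  rw [constReal_ltR hε, rat_zero] at hε_pos
  obtain ⟨η, hη, n, hn⟩ := hε_pos.exists_forall_lt hε
  obtain ⟨m, hm, hmη⟩ := exists_ge_halfPow_lt n (show 0 < η / 4 by linarith)
  refine ⟨m, ?_⟩
  rw [hΨx, hΨx₀, rat_constReal_app, rat_constReal_app]
  linarith [hn m hm]

end IND

theorem sat_NIN_of_forall_hasFiniteCover {V : Ty → Type} (ρ : 𝓜.Assign V)
    (h : ∀ (Y : 𝓜.C Ty.two) Ψ, IsInjection Y → IsInjectionGauge Y Ψ → HasFiniteCover Ψ) :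
    (NIN V).Sat ρ := by
  rw [sat_NIN]
  rintro ⟨Y, hY⟩
  obtain ⟨Ψ, hΨ⟩ := exists_isInjectionGauge Y
  exact hΨ.not_hasFiniteCover hY (h Y Ψ hY hΨ)

theorem sat_HBUsemi_imp_NIN {V : Ty → Type} {ρ : 𝓜.Assign V} (hIND : (IND V).Sat ρ) :
    (HBUsemi V ⇒ₒ NIN V).Sat ρ := by
  intro hHBU
  refine sat_NIN_of_forall_hasFiniteCover ρ fun Y Ψ hY hΨ => ?_
  exact (sat_hasFiniteCover _ _).1 <| hHBU Ψ ((sat_isGauge _ _).2 (hΨ.isGauge hY))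
    ((sat_isUSC _ _).2 (hΨ.isUSC hIND hY))

theorem sat_HBUBorel_imp_NIN {V : Ty → Type} (ρ : 𝓜.Assign V) :
    (HBUBorel V ⇒ₒ NIN V).Sat ρ := by
  intro hHBU
  refine sat_NIN_of_forall_hasFiniteCover ρ fun Y Ψ hY hΨ => ?_
  have hgauge := hΨ.isGauge hY
  have hBorel : IsBorelFun Ψ := hY.isBorelFun (fun x hx => (hgauge.1 x hx).1) hgauge.2
  exact (sat_hasFiniteCover _ _).1 <|
    hHBU Ψ ((sat_isGauge _ _).2 hgauge) (IsBorelFun.sat_isBorelFun _ hBorel)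

end ACAModel

theorem ACA_plus_IND_proves_HBUsemi_imp_NIN : (ACA.plus IND).Proves (HBUsemi _ ⇒ₒ NIN _) := by
  refine (ACA.plus IND).proves_of_forall_models (ACA_closed.plus fun _ => rfl)
    (ACA_extensional.plus IND) _ fun 𝓜 h𝓜 ρ => ?_
  have hACA : 𝓜.Models ACA := h𝓜.of_plus
  have hIND : (IND _).Sat ρ := h𝓜 _ (.inl rfl) ρ
  exact ACAModel.sat_HBUsemi_imp_NIN (𝓜 := hACA.toACAModel) hIND

theorem ACA_proves_HBUBorel_imp_NIN : ACA.Proves (HBUBorel _ ⇒ₒ NIN _) :=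
  ACA.proves_of_forall_models ACA_closed ACA_extensional _ fun _ h𝓜 ρ =>
    ACAModel.sat_HBUBorel_imp_NIN (𝓜 := h𝓜.toACAModel) ρ

end HigherOrder

theorem mainTheorem3 :
    (HigherOrder.ACA.plus HigherOrder.IND).Proves
        (HigherOrder.Fm.imp (HigherOrder.HBUsemi _) (HigherOrder.NIN _)) ∧
      HigherOrder.ACA.Proves
        (HigherOrder.Fm.imp (HigherOrder.HBUBorel _) (HigherOrder.NIN _)) :=
  ⟨HigherOrder.ACA_plus_IND_proves_HBUsemi_imp_NIN, HigherOrder.ACA_proves_HBUBorel_imp_NIN⟩
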